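/- For $p,q>0$, $x\ge 0$, $0\le y\le 1$ let $$B_{p,q}(x,y)=e^{-x/2}\sum_{j=0}^\infty \frac{1}{j!}\Bigl(\frac x2\Bigr)^j I_y(p+j,q),\qquad I_y(p,q)=\frac{\Gamma(p+q)}{\Gamma(p)\Gamma(q)}\int_0^y t^{p-1}(1-t)^{q-1}\,dt$$ be the cumulative noncentral beta distribution. Write $p=r\cos^2\theta$, $q=r\sin^2\theta$ with $r=p+q$ and $\theta\in(0,\frac12\pi)$, $\frac12xy=r\xi$, and put $$\phi(t)=\ln t-\sin^2\theta\,\ln(t-1)+\xi t\quad(t>1),\qquad t_0=\frac{\xi-\cos^2\theta+\sqrt{(\cos^2\theta-\xi)^2+4\xi}}{2\xi}$$ (with $t_0=1/\cos^2\theta$ when $\xi=0$), $$y_0=\frac{x+2p}{x+2p+2q},\qquad x_0=2\,\frac{(p+q)y-p}{1-y}.$$ (i) For $\theta\in(0,\frac12\pi)$ and $\xi\ge0$: $t_0>1$, $\phi'(t_0)=0$, and $\phi(t)-\phi(t_0)=\frac12w^2$, $\operatorname{sign}(w)=\operatorname{sign}(t-t_0)$, defines a bijection $t\mapsto w$ of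 $(1,\infty)$ onto $\mathbb R$. Let $t=t(w)$ be its inverse and $$f(w)=\frac{1}{t(1-yt)}\,\frac{dt}{dw}.$$ (ii) If moreover $y\ge0$ and $yt_0<1$ (the saddle point $t_0$ is to the left of the pole $1/y$), then $f(w)=\sum_{k=0}^\infty f_kw^k$ for all $w$ near $0$, where $f_k=f^{(k)}(0)/k!$. With $\phi_k=\phi^{(k)}(t_0)$, $$f_0=\frac{1}{\sqrt{\phi_2}\;t_0(1-yt_0)}=\frac{t_0-1}{(1-yt_0)\sqrt{\sin^2\theta\,t_0^2-(t_0-1)^2}},$$ $$\begin{aligned}f_2=\frac{1}{24\phi_2^{7/2}t_0^3(1-yt_0)^3}\Bigl(&24\phi_2^2+12\phi_2(\phi_3-6y\phi_2)t_0+(72\phi_2^2y^2+5\phi_3^2-36\phi_3y\phi_2-3\phi_4\phi_2)t_0^2\\&+2y(12\phi_3y\phi_2+3\phi_4\phi_2-5\phi_3^2)t_0^3+y^2(5\phi_3^2-3\phi_4\phi_2)t_0^4\Bigr).\end{aligned}$$ (iii) For $0<y<1$ and $x\ge0$: $t_0<1/y$ if and only if $y<y_0$, if and only if $x>x_0$.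 (iv) As $r\to\infty$, $$B_{p,q}(x,y)\sim\frac{e^{-x/2+r\phi(t_0)}y^p(1-y)^q}{\sqrt{2\pi r}}\sum_{k=0}^\infty(-1)^kf_{2k}\frac{2^k(\frac12)_k}{r^k},\qquad \bigl(\tfrac12\bigr)_k=\tfrac12\bigl(\tfrac12+1\bigr)\cdots\bigl(\tfrac12+k-1\bigr),$$ uniformly in the following sense. For all $\delta_1,\delta_2,\delta_3>0$ and every integer $N\ge0$ there are constants $C$ and $R>0$, depending only on $\delta_1,\delta_2,\delta_3,N$, such that for all $r\ge R$, $\theta\in[\delta_1,\frac12\pi-\delta_1]$, $x\ge0$ and $y\in[0,y_0-\delta_3]$ with $t_0\ge1+\delta_2$, $$\Bigl|B_{p,q}(x,y)-P\sum_{k=0}^{N-1}(-1)^kf_{2k}\frac{2^k(\frac12)_k}{r^k}\Bigr|\le C\,\frac{P}{r^{N}},\qquad P=\frac{e^{-x/2+r\phi(t_0)}y^p(1-y)^q}{\sqrt{2\pi r}}.$$ -/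

import Mathlib

open Real Set

namespace NoncentralBeta

noncomputable section

/-- The central beta distribution (regularized incomplete beta function) `I_y(p,q)`. -/
def centralBeta (p q y : ℝ) : ℝ :=
  (∫ t in (0 : ℝ)..y, t ^ (p - 1) * (1 - t) ^ (q - 1)) / ProbabilityTheory.beta p q

/-- The cumulative noncentral beta distribution `B_{p,q}(x,y)`. -/
def noncentralBeta (p q x y : ℝ) : ℝ :=
  exp (-x / 2) * ∑' j : ℕ, (x / 2) ^ j / (j.factorial : ℝ) * centralBeta (p + j) q y

/-- The phase function `φ(t) = ln t - sin²θ ln(t-1) + ξ t`, used for `t > 1`. -/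
def phase (θ ξ t : ℝ) : ℝ :=
  log t - sin θ ^ 2 * log (t - 1) + ξ * t

/-- The positive saddle point `t₀` of `phase θ ξ`; at `ξ = 0` it is the limiting value
`1 / cos²θ`. -/
def saddle (θ ξ : ℝ) : ℝ :=
  if ξ = 0 then 1 / cos θ ^ 2
  else (ξ - cos θ ^ 2 + √((cos θ ^ 2 - ξ) ^ 2 + 4 * ξ)) / (2 * ξ)

/-- The new variable `w`, as a function of `t > 1`: `φ(t) - φ(t₀) = w² / 2` and
`sign w = sign (t - t₀)`. -/
def wOf (θ ξ t : ℝ) : ℝ :=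
  Real.sign (t - saddle θ ξ) * √(2 * (phase θ ξ t - phase θ ξ (saddle θ ξ)))

/-- The inverse substitution: `t` as a function of `w`, with values in `(1, ∞)`. -/
def tOf (θ ξ w : ℝ) : ℝ :=
  Function.invFunOn (wOf θ ξ) (Ioi 1) w

/-- `f(w) = (1 / (t (1 - y t))) dt/dw`. -/
def amplitude (θ ξ y w : ℝ) : ℝ :=
  1 / (tOf θ ξ w * (1 - y * tOf θ ξ w)) * deriv (tOf θ ξ) w

/-- The Maclaurin coefficients `f_k` of `amplitude`. -/
def fCoeff (θ ξ y : ℝ) (k : ℕ) : ℝ :=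
  iteratedDeriv k (amplitude θ ξ y) 0 / (k.factorial : ℝ)

/-- `φ_k`, the `k`th derivative of the phase function at the saddle point. -/
def phaseDeriv (θ ξ : ℝ) (k : ℕ) : ℝ :=
  iteratedDeriv k (phase θ ξ) (saddle θ ξ)

/-- The transition value `y₀` with respect to `y`. -/
def yTransition (p q x : ℝ) : ℝ := (x + 2 * p) / (x + 2 * p + 2 * q)

/-- The transition value `x₀` with respect to `x`. -/
def xTransition (p q y : ℝ) : ℝ := 2 * (((p + q) * y - p) / (1 - y))

/-- The prefactor `e^{-x/2 + r φ(t₀)} y^p (1-y)^q / √(2π r)`, with `r = p + q`. -/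
def prefactor (p q x y θ ξ : ℝ) : ℝ :=
  exp (-x / 2 + (p + q) * phase θ ξ (saddle θ ξ)) * y ^ p * (1 - y) ^ q / √(2 * π * (p + q))

/-- The first `N` terms of the series `∑ (-1)^k f_{2k} 2^k (1/2)_k / r^k`. -/
def partialSeries (θ ξ y r : ℝ) (N : ℕ) : ℝ :=
  ∑ k ∈ Finset.range N,
    (-1) ^ k * fCoeff θ ξ y (2 * k) * (2 ^ k * (ascPochhammer ℝ k).eval (1 / 2)) / r ^ k

end

end NoncentralBeta

/-! The substitution `u = 1 / t` turns the problem into a saddle point analysis on a vertical line.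
For `y < c < 1` the central beta distribution is `y ^ p (1 - y) ^ q / (2π)` times the integral over
`v` of `u ^ (-p) (1 - u) ^ (-q) / (u - y)`, `u = c + i v` (`centralBeta_eq_integral`). No residues
are used: as a function of `y`, this expression without the `2π` has derivative a constant times the
beta density away from `c`, vanishes at `0` and `1`, and drops by `2π` across `c`, which fixes the
constant. Raising `p` to `p + j` only inserts `u ^ (-j)`, so the Poisson-weighted sum produces `exp
(x y / (2 u))` (`noncentralBeta_eq_integral`), and the integrand becomes `exp (r φ) / (u - y)`.

Take `c = a = 1 / t₀`. On this line `Re (φ(u) - φ(a)) ≤ -log (1 + v²) / 2`, so the part away from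
`a` is exponentially small. Near `a`, `φ' = (u - a) K` with `Re K ≥ 1/2`; hence the second divided
difference `H` has positive real part and `W = (u - a) √(2H)` satisfies `φ - φ(a) = W² / 2`. With `G
= 1 / ((u - y) W')` the local integral is that of `exp (r W² / 2) G W'`. Repeated divided
differences expand `G` in powers of `W` with a bounded remainder, so `W` need not be inverted in the
complex domain. The moments of `exp (r W² / 2)` along the path agree with those on the imaginary
axis up to exponentially small terms; odd ones vanish, even ones give the factors `2^k (1/2)_k /
r^k`.

On the real axis `W(1/t) = -w(t)`, so `w` is analytic with nonzero derivative at `t₀`, its inverse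
is analytic, and the coefficients of `G` are `(-1)^k f_k` (`fCoeff_eq_saddleCoeff`). The formulas
for `f₀` and `f₂` come from differentiating `φ(t(w)) = w² / 2 + φ(t₀)` up to four times.

Every constant depends only on `N`, a lower bound for `a`, `1 - a` and `a - y`, and an upper bound
for `ξ`; the three `δ`s provide these. The separation from the pole and part (iii) both rest on
`one_sub_mul_saddle_identity`. -/

namespace NoncentralBeta

/-! ### The real saddle point, the bijection `t ↦ w`, and the transition values. -/

section Saddle

variable {θ ξ : ℝ}

theorem cos_sq_pos_of_mem (hθ : θ ∈ Ioo 0 (π / 2)) : 0 < cos θ ^ 2 :=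
  pow_pos (cos_pos_of_mem_Ioo ⟨by linarith [hθ.1, pi_pos], hθ.2⟩) 2

theorem sin_sq_pos_of_mem (hθ : θ ∈ Ioo 0 (π / 2)) : 0 < sin θ ^ 2 :=
  pow_pos (sin_pos_of_pos_of_lt_pi hθ.1 (by linarith [hθ.2, pi_pos])) 2

theorem saddle_spec (hθ : θ ∈ Ioo 0 (π / 2)) (hξ : 0 ≤ ξ) :
    1 < saddle θ ξ ∧ ξ * saddle θ ξ ^ 2 + (cos θ ^ 2 - ξ) * saddle θ ξ - 1 = 0 := by
  have hc := cos_sq_pos_of_mem hθ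
  have hs := sin_sq_pos_of_mem hθ
  have hcs := sin_sq_add_cos_sq θ
  unfold saddle
  generalize cos θ ^ 2 = α at *
  split_ifs with h
  · subst h
    refine ⟨by rw [lt_div_iff₀ hc]; linarith, by field_simp; ring⟩
  · have hξ' : 0 < ξ := lt_of_le_of_ne hξ (Ne.symm h)
    have h0 : 0 ≤ (α - ξ) ^ 2 + 4 * ξ := by positivity
    have hsq := Real.sq_sqrt h0
    -- After squaring this is `4 α ξ < 4 ξ`, that is `α = cos² θ < 1`.
    have hlt : ξ + α < √((α - ξ) ^ 2 + 4 * ξ) := by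
      apply Real.lt_sqrt_of_sq_lt
      nlinarith [mul_pos hξ' hs]
    generalize √((α - ξ) ^ 2 + 4 * ξ) = D at *
    refine ⟨by rw [lt_div_iff₀ (by positivity)]; linarith, ?_⟩
    field_simp
    linear_combination hsq

theorem one_lt_saddle (hθ : θ ∈ Ioo 0 (π / 2)) (hξ : 0 ≤ ξ) : 1 < saddle θ ξ :=
  (saddle_spec hθ hξ).1

/-- The product of the roots is `-1 / ξ`, so the other root is negative; writing the cofactor as `ξ
t + 1 / t₀` covers `ξ = 0` too and makes its positivity for `t > 0` visible. -/
theorem saddle_quadratic_factor (hθ : θ ∈ Ioo 0 (π / 2)) (hξ : 0 ≤ ξ) (t : ℝ) :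
    ξ * t ^ 2 + (cos θ ^ 2 - ξ) * t - 1 = (t - saddle θ ξ) * (ξ * t + 1 / saddle θ ξ) := by
  obtain ⟨h1, h2⟩ := saddle_spec hθ hξ
  have h0 : saddle θ ξ ≠ 0 := by positivity
  field_simp
  linear_combination t * h2

theorem hasDerivAt_phase (θ ξ : ℝ) {t : ℝ} (ht : 1 < t) :
    HasDerivAt (phase θ ξ) (1 / t - sin θ ^ 2 / (t - 1) + ξ) t := by
  have h1 := Real.hasDerivAt_log (x := t) (by positivity)
  have h2 := ((hasDerivAt_id t).sub_const 1).log (sub_ne_zero.2 ht.ne')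
  have h3 := (hasDerivAt_id t).const_mul ξ
  convert! (h1.sub (h2.const_mul (sin θ ^ 2))).add h3 using 1
  simp; ring

theorem phase_deriv_factor (hθ : θ ∈ Ioo 0 (π / 2)) (hξ : 0 ≤ ξ) {t : ℝ} (ht : 1 < t) :
    1 / t - sin θ ^ 2 / (t - 1) + ξ =
      (t - saddle θ ξ) * (ξ * t + 1 / saddle θ ξ) / (t * (t - 1)) := by
  rw [← saddle_quadratic_factor hθ hξ]
  have h1 : t - 1 ≠ 0 := sub_ne_zero.2 ht.ne'
  have h2 : t ≠ 0 := by positivity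
  rw [sin_sq]
  field_simp
  ring

theorem hasDerivAt_phase_saddle (hθ : θ ∈ Ioo 0 (π / 2)) (hξ : 0 ≤ ξ) :
    HasDerivAt (phase θ ξ) 0 (saddle θ ξ) := by
  have h := hasDerivAt_phase θ ξ (one_lt_saddle hθ hξ)
  rw [phase_deriv_factor hθ hξ (one_lt_saddle hθ hξ)] at h
  simpa using h

theorem strictMonoOn_phase (hθ : θ ∈ Ioo 0 (π / 2)) (hξ : 0 ≤ ξ) :
    StrictMonoOn (phase θ ξ) (Ici (saddle θ ξ)) := by
  have h1 := one_lt_saddle hθ hξ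
  apply strictMonoOn_of_deriv_pos (convex_Ici _)
  · exact fun t ht => (hasDerivAt_phase θ ξ (h1.trans_le ht)).continuousAt.continuousWithinAt
  · intro t ht
    rw [interior_Ici] at ht
    have ht : saddle θ ξ < t := ht
    have ht1 := h1.trans ht
    rw [(hasDerivAt_phase θ ξ ht1).deriv, phase_deriv_factor hθ hξ ht1]
    have := sub_pos.2 ht
    have := sub_pos.2 ht1
    positivity

theorem strictAntiOn_phase (hθ : θ ∈ Ioo 0 (π / 2)) (hξ : 0 ≤ ξ) :
    StrictAntiOn (phase θ ξ) (Ioc 1 (saddle θ ξ)) := by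
  have h1 := one_lt_saddle hθ hξ
  apply strictAntiOn_of_deriv_neg (convex_Ioc _ _)
  · exact fun t ht => (hasDerivAt_phase θ ξ ht.1).continuousAt.continuousWithinAt
  · intro t ht
    rw [interior_Ioc] at ht
    obtain ⟨ht1, ht⟩ := ht
    rw [(hasDerivAt_phase θ ξ ht1).deriv, phase_deriv_factor hθ hξ ht1, mul_div_assoc]
    have := sub_pos.2 ht1
    exact mul_neg_of_neg_of_pos (sub_neg.2 ht) (by positivity)

theorem phase_saddle_lt (hθ : θ ∈ Ioo 0 (π / 2)) (hξ : 0 ≤ ξ) {t : ℝ} (ht : 1 < t)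
    (hne : t ≠ saddle θ ξ) : phase θ ξ (saddle θ ξ) < phase θ ξ t := by
  have h1 := one_lt_saddle hθ hξ
  rcases lt_or_gt_of_ne hne with h | h
  · exact strictAntiOn_phase hθ hξ ⟨ht, h.le⟩ ⟨h1, le_rfl⟩ h
  · exact strictMonoOn_phase hθ hξ (mem_Ici.2 le_rfl) h.le h

theorem phase_saddle_le (hθ : θ ∈ Ioo 0 (π / 2)) (hξ : 0 ≤ ξ) {t : ℝ} (ht : 1 < t) :
    phase θ ξ (saddle θ ξ) ≤ phase θ ξ t := by
  by_cases h : t = saddle θ ξ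
  · rw [h]
  · exact (phase_saddle_lt hθ hξ ht h).le

theorem wOf_saddle (θ ξ : ℝ) : wOf θ ξ (saddle θ ξ) = 0 := by simp [wOf]

theorem wOf_of_lt {t : ℝ} (h : saddle θ ξ < t) :
    wOf θ ξ t = √(2 * (phase θ ξ t - phase θ ξ (saddle θ ξ))) := by
  rw [wOf, Real.sign_of_pos (sub_pos.2 h), one_mul]

theorem wOf_of_gt {t : ℝ} (h : t < saddle θ ξ) :
    wOf θ ξ t = -√(2 * (phase θ ξ t - phase θ ξ (saddle θ ξ))) := by
  rw [wOf, Real.sign_of_neg (sub_neg.2 h), neg_one_mul]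

theorem wOf_sq (hθ : θ ∈ Ioo 0 (π / 2)) (hξ : 0 ≤ ξ) {t : ℝ} (ht : 1 < t) :
    wOf θ ξ t ^ 2 = 2 * (phase θ ξ t - phase θ ξ (saddle θ ξ)) := by
  have h := phase_saddle_le hθ hξ ht
  rcases lt_trichotomy t (saddle θ ξ) with h' | h' | h'
  · rw [wOf_of_gt h', neg_sq, Real.sq_sqrt (by linarith)]
  · rw [h', wOf_saddle]; simp
  · rw [wOf_of_lt h', Real.sq_sqrt (by linarith)]

theorem wOf_pos (hθ : θ ∈ Ioo 0 (π / 2)) (hξ : 0 ≤ ξ) {t : ℝ} (h : saddle θ ξ < t) :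
    0 < wOf θ ξ t := by
  have h1 := one_lt_saddle hθ hξ
  rw [wOf_of_lt h]
  have := phase_saddle_lt hθ hξ (h1.trans h) h.ne'
  exact Real.sqrt_pos.2 (by linarith)

theorem wOf_neg (hθ : θ ∈ Ioo 0 (π / 2)) (hξ : 0 ≤ ξ) {t : ℝ} (h1 : 1 < t)
    (h : t < saddle θ ξ) : wOf θ ξ t < 0 := by
  rw [wOf_of_gt h]
  have := phase_saddle_lt hθ hξ h1 h.ne
  exact neg_neg_of_pos (Real.sqrt_pos.2 (by linarith))

theorem injOn_wOf (hθ : θ ∈ Ioo 0 (π / 2)) (hξ : 0 ≤ ξ) : InjOn (wOf θ ξ) (Ioi 1) := by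
  intro a ha b hb hab
  have ha : 1 < a := ha
  have hb : 1 < b := hb
  have hph : phase θ ξ a = phase θ ξ b := by
    have h1 := wOf_sq hθ hξ ha
    have h2 := wOf_sq hθ hξ hb
    rw [hab] at h1; linarith
  rcases lt_trichotomy a (saddle θ ξ) with h | h | h <;>
  rcases lt_trichotomy b (saddle θ ξ) with h' | h' | h'
  · exact (strictAntiOn_phase hθ hξ).injOn ⟨ha, h.le⟩ ⟨hb, h'.le⟩ hph
  · have := wOf_neg hθ hξ ha h
    rw [hab, h', wOf_saddle] at this; exact absurd this (lt_irrefl _)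
  · have := wOf_neg hθ hξ ha h
    have := wOf_pos hθ hξ h'
    linarith
  · have := wOf_neg hθ hξ hb h'
    rw [← hab, h, wOf_saddle] at this; exact absurd this (lt_irrefl _)
  · rw [h, h']
  · have := wOf_pos hθ hξ h'
    rw [← hab, h, wOf_saddle] at this; exact absurd this (lt_irrefl _)
  · have := wOf_neg hθ hξ hb h'
    have := wOf_pos hθ hξ h
    linarith
  · have := wOf_pos hθ hξ h
    rw [hab, h', wOf_saddle] at this; exact absurd this (lt_irrefl _)
  · exact (strictMonoOn_phase hθ hξ).injOn h.le h'.le hph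

theorem exists_phase_eq_right (hθ : θ ∈ Ioo 0 (π / 2)) (hξ : 0 ≤ ξ) {M : ℝ}
    (hM : phase θ ξ (saddle θ ξ) ≤ M) : ∃ t, saddle θ ξ ≤ t ∧ phase θ ξ t = M := by
  have h1 := one_lt_saddle hθ hξ
  have hc := cos_sq_pos_of_mem hθ
  -- Since `log (T - 1) ≤ log T`, the phase at `T` is at least `cos² θ log T`, and this `T` pushes
  -- it above `M`.
  set T := max (saddle θ ξ) (exp (M / cos θ ^ 2)) with hT
  have hT1 : saddle θ ξ ≤ T := le_max_left _ _
  have hT0 : 1 < T := h1.trans_le hT1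
  have hlog : M / cos θ ^ 2 ≤ log T := by
    rw [Real.le_log_iff_exp_le (by positivity)]; exact le_max_right _ _
  have hTM : M ≤ phase θ ξ T := by
    rw [div_le_iff₀ hc] at hlog
    have h2 : log (T - 1) ≤ log T := Real.log_le_log (by linarith) (by linarith)
    have h3 := mul_le_mul_of_nonneg_left h2 (sq_nonneg (sin θ))
    have h4 : 0 ≤ ξ * T := by positivity
    have h5 : cos θ ^ 2 = 1 - sin θ ^ 2 := cos_sq' θ
    rw [h5] at hlog
    unfold phase
    linarith
  obtain ⟨t, ht, rfl⟩ := intermediate_value_Icc hT1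
    (fun t ht => (hasDerivAt_phase θ ξ (h1.trans_le ht.1)).continuousAt.continuousWithinAt)
    (show M ∈ Icc _ _ from ⟨hM, hTM⟩)
  exact ⟨t, ht.1, rfl⟩

theorem exists_phase_eq_left (hθ : θ ∈ Ioo 0 (π / 2)) (hξ : 0 ≤ ξ) {M : ℝ}
    (hM : phase θ ξ (saddle θ ξ) ≤ M) :
    ∃ t, 1 < t ∧ t ≤ saddle θ ξ ∧ phase θ ξ t = M := by
  have h1 := one_lt_saddle hθ hξ
  have hc := sin_sq_pos_of_mem hθ
  -- Near `1` the term `-sin² θ log (t - 1)` alone exceeds `M`.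
  set T := min (saddle θ ξ) (1 + exp (-M / sin θ ^ 2)) with hT
  have hT1 : T ≤ saddle θ ξ := min_le_left _ _
  have hT0 : 1 < T := lt_min h1 (by linarith [exp_pos (-M / sin θ ^ 2)])
  have hlog : log (T - 1) ≤ -M / sin θ ^ 2 := by
    rw [Real.log_le_iff_le_exp (by linarith)]
    have := min_le_right (saddle θ ξ) (1 + exp (-M / sin θ ^ 2))
    linarith
  have hTM : M ≤ phase θ ξ T := by
    rw [le_div_iff₀ hc] at hlog
    have h2 : 0 ≤ log T := Real.log_nonneg hT0.le
    have h4 : 0 ≤ ξ * T := by positivity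
    unfold phase
    linarith
  obtain ⟨t, ht, rfl⟩ := intermediate_value_Icc' hT1
    (fun t ht => (hasDerivAt_phase θ ξ (hT0.trans_le ht.1)).continuousAt.continuousWithinAt)
    (show M ∈ Icc _ _ from ⟨hM, hTM⟩)
  exact ⟨t, hT0.trans_le ht.1, ht.2, rfl⟩

theorem bijOn_wOf (hθ : θ ∈ Ioo 0 (π / 2)) (hξ : 0 ≤ ξ) :
    BijOn (wOf θ ξ) (Ioi 1) univ := by
  refine ⟨mapsTo_univ _ _, injOn_wOf hθ hξ, ?_⟩
  intro w _
  have h1 := one_lt_saddle hθ hξ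
  have hM : phase θ ξ (saddle θ ξ) ≤ phase θ ξ (saddle θ ξ) + w ^ 2 / 2 := by
    linarith [sq_nonneg w]
  rcases lt_trichotomy w 0 with h | h | h
  · obtain ⟨t, ht1, ht, hph⟩ := exists_phase_eq_left hθ hξ hM
    refine ⟨t, ht1, ?_⟩
    have hlt : t < saddle θ ξ := lt_of_le_of_ne ht (by
      rintro rfl
      have := pow_pos (neg_pos.2 h) 2
      nlinarith)
    rw [wOf_of_gt hlt, hph, show 2 * (phase θ ξ (saddle θ ξ) + w ^ 2 / 2 -
      phase θ ξ (saddle θ ξ)) = (-w) ^ 2 by ring, Real.sqrt_sq (by linarith)]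
    ring
  · exact ⟨saddle θ ξ, h1, by rw [wOf_saddle, h]⟩
  · obtain ⟨t, ht, hph⟩ := exists_phase_eq_right hθ hξ hM
    have hlt : saddle θ ξ < t := lt_of_le_of_ne ht (by
      rintro rfl
      have := pow_pos h 2
      nlinarith)
    refine ⟨t, h1.trans hlt, ?_⟩
    rw [wOf_of_lt hlt, hph, show 2 * (phase θ ξ (saddle θ ξ) + w ^ 2 / 2 -
      phase θ ξ (saddle θ ξ)) = w ^ 2 by ring, Real.sqrt_sq h.le]

/-- For `y ≠ 0` this is the factorization of the saddle quadratic at `t = 1 / y`, multiplied by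
`y²`. The right side is `(y₀ - y)(ξ + y)` by `yTransition_eq`, so `1 - y t₀` and `y₀ - y` have the
same sign. -/
theorem one_sub_mul_saddle_identity (hθ : θ ∈ Ioo 0 (π / 2)) (hξ : 0 ≤ ξ) (y : ℝ) :
    (1 - y * saddle θ ξ) * (ξ + y / saddle θ ξ) = ξ + cos θ ^ 2 * y - y * (ξ + y) := by
  obtain ⟨h1, h2⟩ := saddle_spec hθ hξ
  have h0 : saddle θ ξ ≠ 0 := by positivity
  field_simp
  linear_combination -y * h2

theorem yTransition_eq {r p q x y : ℝ} (hr : 0 < r) (hy : 0 < y) (hξ : 0 ≤ ξ)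
    (hp : p = r * cos θ ^ 2) (hq : q = r * sin θ ^ 2) (hx : x * y / 2 = r * ξ) :
    yTransition p q x = (ξ + cos θ ^ 2 * y) / (ξ + y) := by
  have hx' : x = 2 * r * ξ / y := by field_simp; linarith
  have : 0 < ξ + y := by linarith
  rw [yTransition, hp, hq, hx', sin_sq]
  have h2 : 2 * r * ξ / y + 2 * (r * cos θ ^ 2) + 2 * (r * (1 - cos θ ^ 2)) =
    2 * r * (ξ + y) / y := by field_simp; ring
  rw [h2]
  field_simp

theorem saddle_lt_iff_yTransition {r p q x y : ℝ} (hθ : θ ∈ Ioo 0 (π / 2)) (hr : 0 < r)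
    (hp : p = r * cos θ ^ 2) (hq : q = r * sin θ ^ 2) (hy : 0 < y)
    (hξ : 0 ≤ ξ) (hx : x * y / 2 = r * ξ) :
    saddle θ ξ < 1 / y ↔ y < yTransition p q x := by
  have h1 := one_lt_saddle hθ hξ
  have hid := one_sub_mul_saddle_identity hθ hξ y
  have hpos : 0 < ξ + y / saddle θ ξ := by positivity
  rw [yTransition_eq hr hy hξ hp hq hx, lt_div_iff₀ hy, lt_div_iff₀ (by linarith)]
  constructor
  · intro h
    have : 0 < (1 - y * saddle θ ξ) * (ξ + y / saddle θ ξ) := mul_pos (by linarith) hpos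
    linarith
  · intro h
    have : 0 < (1 - y * saddle θ ξ) * (ξ + y / saddle θ ξ) := by linarith
    have := pos_of_mul_pos_left this hpos.le
    linarith

theorem lt_yTransition_iff {p q x y : ℝ} (hpq : 0 < p + q) (hx : 0 ≤ x) (hy : y < 1) :
    y < yTransition p q x ↔ xTransition p q y < x := by
  have h1 : 0 < x + 2 * p + 2 * q := by linarith
  have h2 : 0 < 1 - y := by linarith
  rw [yTransition, xTransition, lt_div_iff₀ h1, ← mul_div_assoc, div_lt_iff₀ h2]
  constructor <;> intro h <;> nlinarith

/-- In `(1 - y t₀)(ξ + y / t₀) = (y₀ - y)(ξ + y)` the second factor on the left is at most the one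
on the right because `t₀ > 1`. This is what converts `δ₃` into a uniform distance from the pole. -/
theorem le_one_sub_mul_saddle {r p q x y δ : ℝ} (hθ : θ ∈ Ioo 0 (π / 2)) (hr : 0 < r)
    (hp : p = r * cos θ ^ 2) (hq : q = r * sin θ ^ 2) (hy : 0 < y)
    (hξ : 0 ≤ ξ) (hx : x * y / 2 = r * ξ) (hδ : 0 < δ) (hyδ : y ≤ yTransition p q x - δ) :
    δ ≤ 1 - y * saddle θ ξ := by
  have h1 := one_lt_saddle hθ hξ
  have hid := one_sub_mul_saddle_identity hθ hξ y
  have hpos : 0 < ξ + y / saddle θ ξ := by positivity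
  have hle : ξ + y / saddle θ ξ ≤ ξ + y := by
    gcongr; exact div_le_self hy.le h1.le
  rw [yTransition_eq hr hy hξ hp hq hx, le_sub_iff_add_le, le_div_iff₀ (by linarith)] at hyδ
  have h3 : δ * (ξ + y / saddle θ ξ) ≤ (1 - y * saddle θ ξ) * (ξ + y / saddle θ ξ) := by
    rw [hid]
    nlinarith [mul_le_mul_of_nonneg_left hle hδ.le]
  exact le_of_mul_le_mul_right h3 hpos

end Saddle

/-! ### Gaussian moments along a path through the saddle. -/

section SaddlePath

open Filter Topology MeasureTheory

theorem exp_neg_mul_le_inv_pow {η r : ℝ} (hη : 0 < η) (hr : 0 < r) (n : ℕ) :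
    exp (-(r * η)) ≤ (n.factorial / η ^ n) / r ^ n := by
  have h := Real.pow_div_factorial_le_exp (r * η) (by positivity) n
  rw [Real.exp_neg, div_div, inv_le_comm₀ (exp_pos _) (by positivity), inv_div]
  rwa [mul_comm (η ^ n), ← mul_pow]

theorem exists_primitive_exp_sq (r : ℝ) :
    ∃ E : ℂ → ℂ, ∀ z, HasDerivAt E (Complex.exp (r * z ^ 2 / 2)) z := by
  have hd : Differentiable ℂ fun z : ℂ => Complex.exp (r * z ^ 2 / 2) := by fun_prop
  obtain ⟨E, hE⟩ := hd.isExactOn_univ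
  exact ⟨E, fun z => hE z (mem_univ z)⟩

theorem norm_exp_half_mul_sq (r : ℝ) (z : ℂ) :
    ‖Complex.exp (r * z ^ 2 / 2)‖ = exp (r * (z ^ 2).re / 2) := by
  rw [Complex.norm_exp]
  congr 1
  rw [show (r : ℂ) * z ^ 2 / 2 = ((r / 2 : ℝ) : ℂ) * z ^ 2 by push_cast; ring, Complex.re_ofReal_mul]
  ring

/-- Moving `b` horizontally to the imaginary axis keeps `Im z` and shrinks `|Re z|`, so `Re z²`
never exceeds `Re b²` and the integrand stays exponentially small. With a primitive, this replaces
contour deformation. -/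
theorem norm_primitive_sub_imag_le {E : ℂ → ℂ} {r η M : ℝ} (hr : 0 ≤ r)
    (hE : ∀ z, HasDerivAt E (Complex.exp (r * z ^ 2 / 2)) z) {b : ℂ} (hb : ‖b‖ ≤ M)
    (hre : (b ^ 2).re ≤ -(2 * η)) :
    ‖E b - E (b.im * Complex.I)‖ ≤ M * exp (-(r * η)) := by
  have hre' : b.re ^ 2 - b.im ^ 2 ≤ -(2 * η) := by
    rw [sq, Complex.mul_re] at hre; nlinarith
  have hbound : ∀ z ∈ segment ℝ (b.im * Complex.I) b,
      ‖Complex.exp (r * z ^ 2 / 2)‖ ≤ exp (-(r * η)) := by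
    intro z hz
    rw [segment_eq_image] at hz
    obtain ⟨s, ⟨hs0, hs1⟩, rfl⟩ := hz
    rw [norm_exp_half_mul_sq, exp_le_exp]
    have h : (((1 - s) • ((b.im : ℂ) * Complex.I) + s • b) ^ 2).re =
        (s * b.re) ^ 2 - b.im ^ 2 := by
      simp [sq, Complex.mul_re]; ring
    rw [h]
    have h2 : (s * b.re) ^ 2 ≤ b.re ^ 2 := by
      rw [mul_pow]; exact mul_le_of_le_one_left (sq_nonneg _) (pow_le_one₀ hs0 hs1)
    nlinarith [mul_le_mul_of_nonneg_left (show (s * b.re) ^ 2 - b.im ^ 2 ≤ -(2 * η) by linarith) hr]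
  have h := (convex_segment (𝕜 := ℝ) ((b.im : ℂ) * Complex.I) b).norm_image_sub_le_of_norm_hasDerivWithin_le
    (fun z _ => (hE z).hasDerivWithinAt) hbound (left_mem_segment _ _ _) (right_mem_segment _ _ _)
  refine h.trans ?_
  rw [mul_comm]
  gcongr
  have h3 : b - b.im * Complex.I = b.re := by
    apply Complex.ext <;> simp
  rw [h3, Complex.norm_real]
  exact (Complex.abs_re_le_norm b).trans hb

/-- Outside the interval `s² ≥ 2η`; half of the exponent gives the small factor and the other half
keeps the tail integrable. -/
theorem norm_gaussian_truncation_le {r η β β' : ℝ} (hr : 1 ≤ r) (hβ : 0 < β) (hβ' : β' < 0)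
    (h1 : 2 * η ≤ β ^ 2) (h2 : 2 * η ≤ β' ^ 2) :
    |(∫ s in β'..β, exp (-(r / 2) * s ^ 2)) - √(2 * π / r)| ≤ √(4 * π) * exp (-(r * (η / 2))) := by
  have hr0 : 0 < r := by linarith
  have hi : Integrable fun s : ℝ => exp (-(r / 2) * s ^ 2) := integrable_exp_neg_mul_sq (by positivity)
  have hi4 : Integrable fun s : ℝ => exp (-(r / 4) * s ^ 2) := integrable_exp_neg_mul_sq (by positivity)
  have hG : √(2 * π / r) = ∫ s : ℝ, exp (-(r / 2) * s ^ 2) := by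
    rw [integral_gaussian]; congr 1; field_simp
  have hsplit := integral_add_compl (measurableSet_Ioc (a := β') (b := β)) hi
  rw [intervalIntegral.integral_of_le (by linarith), hG, ← hsplit, sub_add_cancel_left, abs_neg,
    abs_of_nonneg (integral_nonneg fun _ => (exp_pos _).le)]
  calc ∫ s in (Ioc β' β)ᶜ, exp (-(r / 2) * s ^ 2)
      ≤ ∫ s in (Ioc β' β)ᶜ, exp (-(r * (η / 2))) * exp (-(r / 4) * s ^ 2) := by
        apply setIntegral_mono_on hi.integrableOn (hi4.const_mul _).integrableOn
          measurableSet_Ioc.compl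
        intro s hs
        rw [← exp_add, exp_le_exp]
        have hs2 : 2 * η ≤ s ^ 2 := by
          rw [mem_compl_iff, mem_Ioc, not_and_or, not_lt, not_le] at hs
          rcases hs with hs | hs <;> nlinarith
        nlinarith
    _ ≤ ∫ s : ℝ, exp (-(r * (η / 2))) * exp (-(r / 4) * s ^ 2) := by
        apply setIntegral_le_integral (hi4.const_mul _)
        exact Eventually.of_forall fun s => by positivity
    _ = √(4 * π / r) * exp (-(r * (η / 2))) := by
        rw [integral_const_mul, integral_gaussian, mul_comm]
        congr 2; field_simp
    _ ≤ _ := by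
        gcongr
        exact div_le_self (by positivity) hr

/-- A continuously differentiable path through `0`, crossing the sector `Re z² < 0` from the
lower to the upper half plane. -/
structure IsSaddlePath (ρ M : ℝ) (γ γ' : ℝ → ℂ) : Prop where
  hasDerivAt : ∀ v ∈ Icc (-ρ) ρ, HasDerivAt γ (γ' v) v
  continuousOn : ContinuousOn γ' (Icc (-ρ) ρ)
  re_sq_le : ∀ v ∈ Icc (-ρ) ρ, ((γ v) ^ 2).re ≤ -(v ^ 2 / 2)
  norm_le : ∀ v ∈ Icc (-ρ) ρ, ‖γ v‖ ≤ M * |v|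
  norm_deriv_le : ∀ v ∈ Icc (-ρ) ρ, ‖γ' v‖ ≤ M
  im_pos : 0 < (γ ρ).im
  im_neg : (γ (-ρ)).im < 0

/-- The moments of `exp (r z² / 2)` along a path. -/
noncomputable def pathMoment (ρ r : ℝ) (γ γ' : ℝ → ℂ) (k : ℕ) : ℂ :=
  ∫ v in (-ρ)..ρ, Complex.exp (r * γ v ^ 2 / 2) * γ v ^ k * γ' v

namespace IsSaddlePath

variable {ρ M r : ℝ} {γ γ' : ℝ → ℂ}

theorem continuousOn_path (h : IsSaddlePath ρ M γ γ') : ContinuousOn γ (Icc (-ρ) ρ) :=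
  fun v hv => (h.hasDerivAt v hv).continuousAt.continuousWithinAt

theorem intervalIntegrable (h : IsSaddlePath ρ M γ γ') (hρ : 0 < ρ) (r : ℝ) {G : ℝ → ℂ}
    (hG : ContinuousOn G (Icc (-ρ) ρ)) :
    IntervalIntegrable (fun v => Complex.exp (r * γ v ^ 2 / 2) * G v * γ' v) volume (-ρ) ρ := by
  apply ContinuousOn.intervalIntegrable_of_Icc (by linarith)
  have h1 := h.continuousOn_path
  have h2 := h.continuousOn
  fun_prop

theorem norm_end_le (h : IsSaddlePath ρ M γ γ') (hρ : 0 < ρ) :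
    ‖γ ρ‖ ≤ M * ρ ∧ ‖γ (-ρ)‖ ≤ M * ρ := by
  have h1 := h.norm_le ρ ⟨by linarith, le_rfl⟩
  have h2 := h.norm_le (-ρ) ⟨le_rfl, by linarith⟩
  rw [abs_neg] at h2
  rw [abs_of_pos hρ] at h1 h2
  exact ⟨h1, h2⟩

theorem re_sq_end_le (h : IsSaddlePath ρ M γ γ') (hρ : 0 < ρ) :
    (γ ρ ^ 2).re ≤ -(2 * (ρ ^ 2 / 4)) ∧ (γ (-ρ) ^ 2).re ≤ -(2 * (ρ ^ 2 / 4)) := by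
  have h1 := h.re_sq_le ρ ⟨by linarith, le_rfl⟩
  have h2 := h.re_sq_le (-ρ) ⟨le_rfl, by linarith⟩
  rw [neg_sq] at h2
  exact ⟨by linarith, by linarith⟩

/-- The integral is a difference of values of an entire primitive at the endpoints. Each endpoint is
projected to the imaginary axis, where what remains is a truncated real Gaussian integral. -/
theorem norm_pathMoment_zero_sub_le (h : IsSaddlePath ρ M γ γ') (hρ : 0 < ρ) (hM : 0 ≤ M)
    (hr : 1 ≤ r) :
    ‖pathMoment ρ r γ γ' 0 - Complex.I * √(2 * π / r)‖ ≤
      (2 * (M * ρ) + √(4 * π)) * exp (-(r * (ρ ^ 2 / 8))) := by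
  obtain ⟨E, hE⟩ := exists_primitive_exp_sq r
  obtain ⟨hn1, hn2⟩ := h.norm_end_le hρ
  obtain ⟨hr1, hr2⟩ := h.re_sq_end_le hρ
  have hr0 : 0 ≤ r := by linarith
  have hJ : pathMoment ρ r γ γ' 0 = E (γ ρ) - E (γ (-ρ)) := by
    have := intervalIntegral.integral_eq_sub_of_hasDerivAt (a := -ρ) (b := ρ) (f := E ∘ γ)
      (f' := fun v => Complex.exp (r * γ v ^ 2 / 2) * 1 * γ' v) (fun v hv => by
        rw [uIcc_of_le (by linarith)] at hv
        rw [mul_one]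
        exact (hE _).comp v (h.hasDerivAt v hv)) (h.intervalIntegrable hρ r continuousOn_const)
    simpa [pathMoment] using this
  have him : E ((γ ρ).im * Complex.I) - E ((γ (-ρ)).im * Complex.I) =
      Complex.I * ((∫ s in (γ (-ρ)).im..(γ ρ).im, exp (-(r / 2) * s ^ 2) : ℝ) : ℂ) := by
    have := intervalIntegral.integral_eq_sub_of_hasDerivAt (a := (γ (-ρ)).im) (b := (γ ρ).im)
      (f := fun s : ℝ => E (s * Complex.I))
      (f' := fun s : ℝ => Complex.I * ((exp (-(r / 2) * s ^ 2) : ℝ) : ℂ)) (fun s _ => by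
        have h1 : HasDerivAt (fun s : ℝ => (s : ℂ) * Complex.I) (1 * Complex.I) s :=
          (hasDerivAt_id _).ofReal_comp.mul_const _
        convert! (hE (s * Complex.I)).comp s h1 using 1
        rw [one_mul, mul_comm]
        push_cast
        congr 2
        rw [mul_pow, Complex.I_sq]; ring) (by
          apply Continuous.intervalIntegrable; fun_prop)
    rw [← this, intervalIntegral.integral_const_mul, intervalIntegral.integral_ofReal]
  have e1 := norm_primitive_sub_imag_le hr0 hE hn1 hr1
  have e2 := norm_primitive_sub_imag_le hr0 hE hn2 hr2
  have hq1 : 2 * (ρ ^ 2 / 4) ≤ (γ ρ).im ^ 2 := by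
    rw [sq (γ ρ), Complex.mul_re] at hr1; nlinarith [sq_nonneg (γ ρ).re]
  have hq2 : 2 * (ρ ^ 2 / 4) ≤ (γ (-ρ)).im ^ 2 := by
    rw [sq (γ (-ρ)), Complex.mul_re] at hr2; nlinarith [sq_nonneg (γ (-ρ)).re]
  have e3 := norm_gaussian_truncation_le hr h.im_pos h.im_neg hq1 hq2
  have hdec : exp (-(r * (ρ ^ 2 / 4))) ≤ exp (-(r * (ρ ^ 2 / 8))) := by
    rw [exp_le_exp]; nlinarith [sq_nonneg ρ]
  rw [show ρ ^ 2 / 4 / 2 = ρ ^ 2 / 8 by ring] at e3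
  have e4 : ‖Complex.I * ((∫ s in (γ (-ρ)).im..(γ ρ).im, exp (-(r / 2) * s ^ 2) : ℝ) : ℂ) -
      Complex.I * √(2 * π / r)‖ ≤ √(4 * π) * exp (-(r * (ρ ^ 2 / 8))) := by
    rw [← mul_sub, norm_mul, Complex.norm_I, one_mul, ← Complex.ofReal_sub, Complex.norm_real]
    exact e3
  rw [hJ]
  have hdecomp : E (γ ρ) - E (γ (-ρ)) - Complex.I * √(2 * π / r) =
      (E (γ ρ) - E ((γ ρ).im * Complex.I)) - (E (γ (-ρ)) - E ((γ (-ρ)).im * Complex.I)) +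
      (Complex.I * ((∫ s in (γ (-ρ)).im..(γ ρ).im, exp (-(r / 2) * s ^ 2) : ℝ) : ℂ) -
      Complex.I * √(2 * π / r)) := by
    rw [← him]; ring
  rw [hdecomp]
  have hMρ : 0 ≤ M * ρ := by positivity
  have hm := mul_le_mul_of_nonneg_left hdec hMρ
  calc _ ≤ ‖E (γ ρ) - E ((γ ρ).im * Complex.I)‖ + ‖E (γ (-ρ)) - E ((γ (-ρ)).im * Complex.I)‖ +
        _ := (norm_add_le _ _).trans (add_le_add_left (norm_sub_le _ _) _)
    _ ≤ _ := by linarith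

theorem norm_boundary_le (h : IsSaddlePath ρ M γ γ') (hρ : 0 < ρ) (hM : 0 ≤ M)
    (hr : 1 ≤ r) (k : ℕ) :
    ‖(γ ρ ^ k * Complex.exp (r * γ ρ ^ 2 / 2) - γ (-ρ) ^ k * Complex.exp (r * γ (-ρ) ^ 2 / 2)) / r‖ ≤
      2 * (M * ρ) ^ k * exp (-(r * (ρ ^ 2 / 8))) := by
  obtain ⟨hn1, hn2⟩ := h.norm_end_le hρ
  obtain ⟨hr1, hr2⟩ := h.re_sq_end_le hρ
  have hMρ : 0 ≤ M * ρ := by positivity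
  have key : ∀ b : ℂ, ‖b‖ ≤ M * ρ → (b ^ 2).re ≤ -(2 * (ρ ^ 2 / 4)) →
      ‖b ^ k * Complex.exp (r * b ^ 2 / 2)‖ ≤ (M * ρ) ^ k * exp (-(r * (ρ ^ 2 / 8))) := by
    intro b hb hb2
    rw [norm_mul, norm_pow, norm_exp_half_mul_sq]
    gcongr
    nlinarith [sq_nonneg ρ]
  rw [norm_div, Complex.norm_real, norm_of_nonneg (by linarith : 0 ≤ r)]
  refine (div_le_self (norm_nonneg _) hr).trans ((norm_sub_le _ _).trans ?_)
  linarith [key _ hn1 hr1, key _ hn2 hr2]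

theorem hasDerivAt_pow_mul_exp (h : IsSaddlePath ρ M γ γ') (r : ℝ) (k : ℕ) {v : ℝ}
    (hv : v ∈ Icc (-ρ) ρ) :
    HasDerivAt (fun v => γ v ^ k * Complex.exp (r * γ v ^ 2 / 2))
      (k * γ v ^ (k - 1) * γ' v * Complex.exp (r * γ v ^ 2 / 2) +
        γ v ^ k * (Complex.exp (r * γ v ^ 2 / 2) * (r * γ v * γ' v))) v := by
  have h1 := h.hasDerivAt v hv
  have h2 : HasDerivAt (fun v => (r : ℂ) * γ v ^ 2 / 2) (r * γ v * γ' v) v := by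
    convert! ((h1.pow 2).const_mul (r : ℂ)).div_const 2 using 1
    simp; ring
  exact (h1.pow k).mul h2.cexp

theorem pathMoment_one (h : IsSaddlePath ρ M γ γ') (hρ : 0 < ρ) (hr : 1 ≤ r) :
    pathMoment ρ r γ γ' 1 = (γ ρ ^ 0 * Complex.exp (r * γ ρ ^ 2 / 2) -
      γ (-ρ) ^ 0 * Complex.exp (r * γ (-ρ) ^ 2 / 2)) / r := by
  have hr0 : (r : ℂ) ≠ 0 := by exact_mod_cast (by linarith : r ≠ 0)
  have hi := h.intervalIntegrable hρ r (G := fun v => r * γ v)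
    (by have := h.continuousOn_path; fun_prop)
  have := intervalIntegral.integral_eq_sub_of_hasDerivAt (a := -ρ) (b := ρ)
      (fun v hv => h.hasDerivAt_pow_mul_exp r 0 (by rwa [uIcc_of_le (by linarith)] at hv))
      (hi.congr (fun v _ => by simp; ring))
  rw [← this, pathMoment, eq_div_iff hr0, mul_comm, ← intervalIntegral.integral_const_mul]
  congr 1; ext v; simp; ring

/-- Integration by parts applied to `γ ^ (k + 1) exp (r γ² / 2)`; up to the boundary term it is the
recursion that defines `gaussMoment`. -/
theorem pathMoment_add_two (h : IsSaddlePath ρ M γ γ') (hρ : 0 < ρ) (hr : 1 ≤ r) (k : ℕ) :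
    pathMoment ρ r γ γ' (k + 2) = (γ ρ ^ (k + 1) * Complex.exp (r * γ ρ ^ 2 / 2) -
      γ (-ρ) ^ (k + 1) * Complex.exp (r * γ (-ρ) ^ 2 / 2)) / r
      - (k + 1) / r * pathMoment ρ r γ γ' k := by
  have hr0 : (r : ℂ) ≠ 0 := by exact_mod_cast (by linarith : r ≠ 0)
  have hc := h.continuousOn_path
  have hi1 := h.intervalIntegrable hρ r (G := fun v => γ v ^ (k + 2)) (by fun_prop)
  have hi2 := h.intervalIntegrable hρ r (G := fun v => γ v ^ k) (by fun_prop)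
  have := intervalIntegral.integral_eq_sub_of_hasDerivAt (a := -ρ) (b := ρ)
      (fun v hv => h.hasDerivAt_pow_mul_exp r (k + 1) (by rwa [uIcc_of_le (by linarith)] at hv))
      (((hi2.const_mul ((k : ℂ) + 1)).add (hi1.const_mul (r : ℂ))).congr
        (fun v _ => by simp; ring))
  have h3 : ∫ v in (-ρ)..ρ, ((↑(k + 1) : ℂ) * γ v ^ (k + 1 - 1) * γ' v *
      Complex.exp (r * γ v ^ 2 / 2) +
        γ v ^ (k + 1) * (Complex.exp (r * γ v ^ 2 / 2) * (r * γ v * γ' v))) =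
      (k + 1) * pathMoment ρ r γ γ' k + r * pathMoment ρ r γ γ' (k + 2) := by
    rw [pathMoment, pathMoment, ← intervalIntegral.integral_const_mul,
      ← intervalIntegral.integral_const_mul, ← intervalIntegral.integral_add
      (hi2.const_mul ((k : ℂ) + 1)) (hi1.const_mul (r : ℂ))]
    congr 1; ext v; simp; ring
  rw [← this, h3]
  field_simp
  ring

end IsSaddlePath

/-- The moments of `exp (r z² / 2)` along the imaginary axis. -/
noncomputable def gaussMoment (r : ℝ) : ℕ → ℂ
  | 0 => Complex.I * √(2 * π / r)
  | 1 => 0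
  | k + 2 => -((k + 1) / r) * gaussMoment r k

theorem gaussMoment_odd (r : ℝ) (k : ℕ) : gaussMoment r (2 * k + 1) = 0 := by
  induction k with
  | zero => simp [gaussMoment]
  | succ k ih => rw [show 2 * (k + 1) + 1 = (2 * k + 1) + 2 by ring, gaussMoment, ih, mul_zero]

theorem gaussMoment_even (r : ℝ) (k : ℕ) : gaussMoment r (2 * k) =
    Complex.I * √(2 * π / r) *
      (((-1) ^ k * (2 ^ k * (ascPochhammer ℝ k).eval (1 / 2)) / r ^ k : ℝ) : ℂ) := by
  induction k with
  | zero => simp [gaussMoment]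
  | succ k ih =>
    rw [show 2 * (k + 1) = 2 * k + 2 by ring, gaussMoment, ih, ascPochhammer_succ_eval]
    push_cast
    field_simp
    ring

theorem exists_norm_pathMoment_sub_le {ρ M : ℝ} (hρ : 0 < ρ) (hM : 0 ≤ M) (k : ℕ) :
    ∃ C, 0 ≤ C ∧ ∀ r : ℝ, 1 ≤ r → ∀ γ γ' : ℝ → ℂ, IsSaddlePath ρ M γ γ' →
      ‖pathMoment ρ r γ γ' k - gaussMoment r k‖ ≤ C * exp (-(r * (ρ ^ 2 / 8))) := by
  induction k using Nat.twoStepInduction with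
  | zero =>
    exact ⟨2 * (M * ρ) + √(4 * π), by positivity,
      fun r hr γ γ' h => h.norm_pathMoment_zero_sub_le hρ hM hr⟩
  | one =>
    refine ⟨2 * (M * ρ) ^ 0, by positivity, fun r hr γ γ' h => ?_⟩
    rw [gaussMoment, sub_zero, h.pathMoment_one hρ hr]
    exact h.norm_boundary_le hρ hM hr 0
  | more k ih _ =>
    obtain ⟨C, hC, hk⟩ := ih
    refine ⟨2 * (M * ρ) ^ (k + 1) + (k + 1) * C, by positivity, fun r hr γ γ' h => ?_⟩
    rw [gaussMoment, h.pathMoment_add_two hρ hr]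
    have h1 := h.norm_boundary_le hρ hM hr (k + 1)
    have h2 := hk r hr γ γ' h
    have h3 : ‖((k : ℂ) + 1) / r‖ ≤ k + 1 := by
      rw [norm_div, Complex.norm_real, norm_of_nonneg (by linarith : 0 ≤ r)]
      have : ‖(k : ℂ) + 1‖ = k + 1 := by
        rw [show (k : ℂ) + 1 = ((k + 1 : ℕ) : ℂ) by push_cast; rfl, Complex.norm_natCast]
        push_cast; rfl
      rw [this]
      exact div_le_self (by positivity) hr
    rw [show ∀ a b c d : ℂ, a - b * c - -b * d = a - b * (c - d) by intros; ring]
    refine (norm_sub_le _ _).trans ?_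
    rw [norm_mul, add_mul, mul_assoc (_ + 1) C]
    gcongr

/-- Watson's lemma along a path, uniform over all paths and amplitudes with the same `ρ` and `M`.
Cutting at the power `2N` leaves a remainder of order `r ^ (-N - 1/2)`, the size of the `2N`-th
absolute moment of a Gaussian. -/
theorem exists_norm_saddlePath_integral_sub_le {ρ M : ℝ} (hρ : 0 < ρ) (hM : 0 ≤ M) (N : ℕ) :
    ∃ C, 0 ≤ C ∧ ∀ r : ℝ, 1 ≤ r → ∀ γ γ' : ℝ → ℂ, IsSaddlePath ρ M γ γ' →
      ∀ (a : ℕ → ℂ) (G : ℝ → ℂ), (∀ k < 2 * N, ‖a k‖ ≤ M) → ContinuousOn G (Icc (-ρ) ρ) →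
      (∀ v ∈ Icc (-ρ) ρ, ‖G v‖ ≤ M) →
      ‖(∫ v in (-ρ)..ρ, Complex.exp (r * γ v ^ 2 / 2) *
          (∑ k ∈ Finset.range (2 * N), a k * γ v ^ k + γ v ^ (2 * N) * G v) * γ' v) -
        ∑ k ∈ Finset.range (2 * N), a k * gaussMoment r k‖ ≤ C / (√r * r ^ N) := by
  choose Ck hCk0 hCk using exists_norm_pathMoment_sub_le hρ hM
  set D := M * ∑ k ∈ Finset.range (2 * N), Ck k with hD
  have hD0 : 0 ≤ D := mul_nonneg hM (Finset.sum_nonneg fun k _ => hCk0 k)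
  -- The exponent `N + 1` suffices because `√r r^N ≤ r^(N+1)` for `r ≥ 1`.
  set F := ((N + 1).factorial : ℝ) / (ρ ^ 2 / 8) ^ (N + 1) with hF
  set B := M ^ (2 * N) * M * M * (N.factorial / (1 / 8) ^ N) * √(8 * π) with hB
  refine ⟨D * F + B, by positivity, fun r hr γ γ' h a G ha hGc hG => ?_⟩
  have hr0 : 0 < r := by linarith
  have hc := h.continuousOn_path
  have hi1 : ∀ k, IntervalIntegrable (fun v => Complex.exp (r * γ v ^ 2 / 2) * γ v ^ k * γ' v)
      volume (-ρ) ρ := fun k => h.intervalIntegrable hρ r (G := fun v => γ v ^ k) (by fun_prop)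
  have hi2 := h.intervalIntegrable hρ r (G := fun v => γ v ^ (2 * N) * G v) (by fun_prop)
  have hsplit : (∫ v in (-ρ)..ρ, Complex.exp (r * γ v ^ 2 / 2) *
          (∑ k ∈ Finset.range (2 * N), a k * γ v ^ k + γ v ^ (2 * N) * G v) * γ' v) =
      ∑ k ∈ Finset.range (2 * N), a k * pathMoment ρ r γ γ' k +
      ∫ v in (-ρ)..ρ, Complex.exp (r * γ v ^ 2 / 2) * (γ v ^ (2 * N) * G v) * γ' v := by
    simp only [pathMoment, ← intervalIntegral.integral_const_mul]
    rw [← intervalIntegral.integral_finsetSum fun k _ => (hi1 k).const_mul (a k),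
      ← intervalIntegral.integral_add _ hi2]
    · congr 1; ext v
      rw [mul_add, add_mul, Finset.mul_sum, Finset.sum_mul]
      congr 1
      exact Finset.sum_congr rfl fun k _ => by ring
    · have := IntervalIntegrable.sum (Finset.range (2 * N)) (μ := volume) (a := -ρ) (b := ρ)
        (f := fun k v => a k * (Complex.exp (r * γ v ^ 2 / 2) * γ v ^ k * γ' v))
        fun k _ => (hi1 k).const_mul (a k)
      simpa [Finset.sum_fn] using this
  have hexp : exp (-(r * (ρ ^ 2 / 8))) ≤ F / (√r * r ^ N) := by
    refine (exp_neg_mul_le_inv_pow (by positivity) hr0 (N + 1)).trans ?_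
    rw [hF]
    gcongr
    rw [pow_succ, mul_comm (r ^ N)]
    gcongr
    exact Real.sqrt_le_iff.2 ⟨hr0.le, by nlinarith⟩
  have hmain : ‖∑ k ∈ Finset.range (2 * N), a k * pathMoment ρ r γ γ' k -
      ∑ k ∈ Finset.range (2 * N), a k * gaussMoment r k‖ ≤ D * F / (√r * r ^ N) := by
    rw [← Finset.sum_sub_distrib]
    calc _ ≤ ∑ k ∈ Finset.range (2 * N), M * (Ck k * exp (-(r * (ρ ^ 2 / 8)))) := by
          refine norm_sum_le_of_le _ fun k hk => ?_
          rw [← mul_sub, norm_mul]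
          exact mul_le_mul (ha k (Finset.mem_range.1 hk)) (hCk k r hr γ γ' h) (norm_nonneg _) hM
      _ = D * exp (-(r * (ρ ^ 2 / 8))) := by
          rw [hD, ← Finset.mul_sum, ← Finset.sum_mul, mul_assoc]
      _ ≤ _ := by
          rw [mul_div_assoc]; gcongr
  have hi8 : Integrable fun s : ℝ => exp (-(r / 8) * s ^ 2) := integrable_exp_neg_mul_sq (by positivity)
  have hrem : ‖∫ v in (-ρ)..ρ, Complex.exp (r * γ v ^ 2 / 2) * (γ v ^ (2 * N) * G v) * γ' v‖ ≤
      B / (√r * r ^ N) := by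
    set c := M ^ (2 * N) * M * M * (N.factorial / (1 / 8) ^ N / r ^ N) with hcdef
    have hc0 : 0 ≤ c := by positivity
    calc _ ≤ ∫ v in (-ρ)..ρ, c * exp (-(r / 8) * v ^ 2) := by
          apply intervalIntegral.norm_integral_le_of_norm_le (by linarith)
          · refine Eventually.of_forall fun v hv => ?_
            have hv : v ∈ Icc (-ρ) ρ := Ioc_subset_Icc_self hv
            -- The decay `exp (-r v² / 4)` is split in two: one factor absorbs `v ^ (2N)` at the
            -- price of `r ^ (-N)`, the other is integrated and gives `r ^ (-1/2)`.
            have e1 : exp (r * (γ v ^ 2).re / 2) ≤ exp (-(r / 8) * v ^ 2) * exp (-(r / 8) * v ^ 2) := by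
              rw [← exp_add, exp_le_exp]
              nlinarith [h.re_sq_le v hv]
            have e2 : (v ^ 2) ^ N * exp (-(r / 8) * v ^ 2) ≤ N.factorial / (1 / 8) ^ N / r ^ N := by
              have := Real.pow_div_factorial_le_exp (r / 8 * v ^ 2) (by positivity) N
              rw [neg_mul, Real.exp_neg, ← div_eq_mul_inv, div_le_iff₀ (exp_pos _)]
              rw [div_le_iff₀ (by positivity)] at this
              have h8 : (r / 8 * v ^ 2) ^ N = (1 / 8) ^ N * r ^ N * (v ^ 2) ^ N := by
                rw [← mul_pow, ← mul_pow]; congr 1; ring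
              rw [h8] at this
              rw [div_div, div_mul_eq_mul_div, le_div_iff₀ (by positivity)]
              linarith
            rw [norm_mul, norm_mul, norm_mul, norm_pow, norm_exp_half_mul_sq]
            calc _ ≤ (exp (-(r / 8) * v ^ 2) * exp (-(r / 8) * v ^ 2)) * ((M * |v|) ^ (2 * N) * M) * M := by
                  gcongr
                  · exact h.norm_le v hv
                  · exact hG v hv
                  · exact h.norm_deriv_le v hv
              _ = M ^ (2 * N) * M * M * ((v ^ 2) ^ N * exp (-(r / 8) * v ^ 2)) * exp (-(r / 8) * v ^ 2) := by
                  rw [mul_pow, pow_mul |v|, sq_abs]; ring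
              _ ≤ _ := by rw [hcdef]; gcongr
          · apply Continuous.intervalIntegrable; fun_prop
      _ ≤ ∫ v : ℝ, c * exp (-(r / 8) * v ^ 2) := by
          rw [intervalIntegral.integral_of_le (by linarith)]
          exact setIntegral_le_integral (hi8.const_mul _)
            (Eventually.of_forall fun s => by positivity)
      _ = B / (√r * r ^ N) := by
          rw [integral_const_mul, integral_gaussian, show π / (r / 8) = 8 * π / r by field_simp,
            Real.sqrt_div (by positivity), hcdef, hB]
          field_simp
  rw [hsplit, add_sub_right_comm, add_div]
  exact (norm_add_le _ _).trans (add_le_add hmain hrem)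

end SaddlePath

/-! ### Integral representation of the central and noncentral beta distributions. -/

section BetaLine

open Filter Topology MeasureTheory

/-- The point `c + i v` of the vertical line `Re u = c`. -/
def vline (c v : ℝ) : ℂ := c + v * Complex.I

/-- The function `u ^ (-p) (1 - u) ^ (-q)` on the vertical line `Re u = c`. -/
noncomputable def betaLine (c p q v : ℝ) : ℂ :=
  vline c v ^ (-p : ℂ) * (1 - vline c v) ^ (-q : ℂ)

@[simp] theorem vline_re (c v : ℝ) : (vline c v).re = c := by simp [vline]

@[simp] theorem vline_im (c v : ℝ) : (vline c v).im = v := by simp [vline]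

theorem hasDerivAt_vline (c v : ℝ) : HasDerivAt (vline c) Complex.I v := by
  have h : HasDerivAt (fun v : ℝ => (v : ℂ) * Complex.I) (1 * Complex.I) v :=
    (hasDerivAt_id v).ofReal_comp.mul_const _
  rw [one_mul] at h
  exact h.const_add (c : ℂ)

theorem continuous_vline (c : ℝ) : Continuous (vline c) := by
  unfold vline; fun_prop

variable {c p q y : ℝ}

theorem vline_mem_slitPlane (hc : 0 < c) (v : ℝ) : vline c v ∈ Complex.slitPlane :=
  Or.inl (by simpa using hc)

theorem one_sub_vline_mem_slitPlane (hc : c < 1) (v : ℝ) : 1 - vline c v ∈ Complex.slitPlane :=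
  Or.inl (by simpa using hc)

theorem vline_ne_zero (hc : 0 < c) (v : ℝ) : vline c v ≠ 0 :=
  Complex.slitPlane_ne_zero (vline_mem_slitPlane hc v)

theorem one_sub_vline_ne_zero (hc : c < 1) (v : ℝ) : 1 - vline c v ≠ 0 :=
  Complex.slitPlane_ne_zero (one_sub_vline_mem_slitPlane hc v)

theorem vline_sub_ne_zero (hy : y ≠ c) (v : ℝ) : vline c v - y ≠ 0 := by
  intro h
  have := congrArg Complex.re h
  simp at this
  exact hy (by linarith)

theorem abs_sub_le_norm_vline_sub (c y v : ℝ) : |c - y| ≤ ‖vline c v - y‖ := by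
  simpa using Complex.abs_re_le_norm (vline c v - y)

theorem norm_vline (c v : ℝ) : ‖vline c v‖ = √(c ^ 2 + v ^ 2) := by
  rw [Complex.norm_eq_sqrt_sq_add_sq, vline_re, vline_im]

theorem norm_one_sub_vline (c v : ℝ) : ‖1 - vline c v‖ = √((1 - c) ^ 2 + v ^ 2) := by
  rw [Complex.norm_eq_sqrt_sq_add_sq]; simp

theorem continuous_betaLine (hc : 0 < c) (hc1 : c < 1) (p q : ℝ) :
    Continuous (betaLine c p q) := by
  have h := continuous_vline c
  exact (h.cpow continuous_const (vline_mem_slitPlane hc)).mul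
    ((continuous_const.sub h).cpow continuous_const (one_sub_vline_mem_slitPlane hc1))

theorem sqrt_sq_add_sq_rpow_neg_le {c : ℝ} (hc : 0 < c) (hc1 : c ≤ 1) (hp : 0 ≤ p) (v : ℝ) :
    √(c ^ 2 + v ^ 2) ^ (-p) ≤ c ^ (-p) * (1 + v ^ 2) ^ (-p / 2) := by
  have h1 : c * √(1 + v ^ 2) ≤ √(c ^ 2 + v ^ 2) := by
    apply Real.le_sqrt_of_sq_le
    rw [mul_pow, Real.sq_sqrt (by positivity)]
    nlinarith [mul_le_of_le_one_left (sq_nonneg v) (pow_le_one₀ hc.le hc1 (n := 2))]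
  have h2 : 0 < √(1 + v ^ 2) := Real.sqrt_pos.2 (by positivity)
  calc √(c ^ 2 + v ^ 2) ^ (-p) ≤ (c * √(1 + v ^ 2)) ^ (-p) :=
        Real.rpow_le_rpow_of_nonpos (by positivity) h1 (by linarith)
    _ = c ^ (-p) * (1 + v ^ 2) ^ (-p / 2) := by
        rw [Real.mul_rpow hc.le h2.le, Real.sqrt_eq_rpow, ← Real.rpow_mul (by positivity)]
        congr 2; ring

theorem norm_betaLine_le (hc : 0 < c) (hc1 : c < 1) (hp : 0 ≤ p) (hq : 0 ≤ q) (v : ℝ) :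
    ‖betaLine c p q v‖ ≤ c ^ (-p) * (1 - c) ^ (-q) * (1 + ‖v‖ ^ 2) ^ (-(p + q) / 2) := by
  rw [betaLine, norm_mul, ← Complex.ofReal_neg, ← Complex.ofReal_neg, Complex.norm_cpow_real,
    Complex.norm_cpow_real, norm_vline, norm_one_sub_vline, Real.norm_eq_abs, sq_abs]
  refine (mul_le_mul (sqrt_sq_add_sq_rpow_neg_le hc hc1.le hp v)
    (sqrt_sq_add_sq_rpow_neg_le (sub_pos.2 hc1) (by linarith) hq v) (by positivity)
    (by positivity)).trans (le_of_eq ?_)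
  rw [show -(p + q) / 2 = -p / 2 + -q / 2 by ring, Real.rpow_add (by positivity)]
  ring

theorem integrable_betaLine (hc : 0 < c) (hc1 : c < 1) (hp : 0 ≤ p) (hq : 0 ≤ q)
    (hpq : 1 < p + q) : Integrable (betaLine c p q) := by
  have h : Integrable fun v : ℝ => (1 + ‖v‖ ^ 2) ^ (-(p + q) / 2) :=
    integrable_rpow_neg_one_add_norm_sq (by simpa using hpq)
  exact (h.const_mul _).mono' (continuous_betaLine hc hc1 p q).aestronglyMeasurable
    (Eventually.of_forall (norm_betaLine_le hc hc1 hp hq))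

theorem integrable_betaLine_mul (hc : 0 < c) (hc1 : c < 1) (hp : 0 ≤ p) (hq : 0 ≤ q)
    (hpq : 1 < p + q) {g : ℝ → ℂ} (hg : Continuous g) {K : ℝ} (hK : ∀ v, ‖g v‖ ≤ K) :
    Integrable fun v => betaLine c p q v * g v :=
  (integrable_betaLine hc hc1 hp hq hpq).mul_bdd (c := K) hg.aestronglyMeasurable (Eventually.of_forall hK)

theorem continuous_inv_vline_sub (hy : y ≠ c) : Continuous fun v => (vline c v - y)⁻¹ :=
  ((continuous_vline c).sub continuous_const).inv₀ (vline_sub_ne_zero hy)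

theorem norm_inv_vline_sub_le (hy : y ≠ c) (v : ℝ) : ‖(vline c v - y)⁻¹‖ ≤ |c - y|⁻¹ := by
  rw [norm_inv]
  exact inv_anti₀ (abs_pos.2 (sub_ne_zero.2 hy.symm)) (abs_sub_le_norm_vline_sub c y v)

theorem hasDerivAt_betaLine (hc : 0 < c) (hc1 : c < 1) (p q v : ℝ) :
    HasDerivAt (betaLine c p q)
      (Complex.I * betaLine c p q v * (-p / vline c v + q / (1 - vline c v))) v := by
  have h := hasDerivAt_vline c v
  have h0 := vline_ne_zero hc v
  have h1 := one_sub_vline_ne_zero hc1 v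
  have e1 := (hasDerivAt_id (vline c v)).cpow_const (c := (-p : ℂ)) (vline_mem_slitPlane hc v)
  have e2 := ((hasDerivAt_id (vline c v)).const_sub 1).cpow_const (c := (-q : ℂ))
    (one_sub_vline_mem_slitPlane hc1 v)
  convert! (e1.mul e2).comp v h using 1
  simp only [id]
  rw [Complex.cpow_sub _ _ h0, Complex.cpow_sub _ _ h1, Complex.cpow_one, Complex.cpow_one, betaLine]
  field_simp

/-- The combination is, up to the factor `I`, the integral of the `v`-derivative of `u ^ (1 - p) (1
- u) ^ (1 - q) / (u - y)`, decomposed into partial fractions at `y`. That function decays like `|v|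
^ (-(p + q - 1))`, hence the integral is zero. -/
theorem integral_betaLine_total_derivative (hc : 0 < c) (hc1 : c < 1) (hp : 0 ≤ p) (hq : 0 ≤ q)
    (hpq : 1 < p + q) (hy : y ≠ c) :
    (p + q - 1 : ℂ) * (∫ v, betaLine c p q v) +
      ((p + q) * y - p) * (∫ v, betaLine c p q v * (vline c v - y)⁻¹) -
      y * (1 - y) * (∫ v, betaLine c p q v * (vline c v - y)⁻¹ ^ 2) = 0 := by
  set T : ℝ → ℂ := fun v => betaLine c p q v * (vline c v * (1 - vline c v) * (vline c v - y)⁻¹)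
    with hT
  set T' : ℝ → ℂ := fun v => Complex.I * ((p + q - 1 : ℂ) * betaLine c p q v +
      ((p + q) * y - p) * (betaLine c p q v * (vline c v - y)⁻¹) -
      y * (1 - y) * (betaLine c p q v * (vline c v - y)⁻¹ ^ 2)) with hT'
  have i0 := integrable_betaLine hc hc1 hp hq hpq
  have i1 := integrable_betaLine_mul hc hc1 hp hq hpq (continuous_inv_vline_sub hy)
    (norm_inv_vline_sub_le hy)
  have i2 : Integrable fun v => betaLine c p q v * (vline c v - y)⁻¹ ^ 2 :=
    integrable_betaLine_mul hc hc1 hp hq hpq ((continuous_inv_vline_sub hy).pow 2)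
    (K := |c - y|⁻¹ ^ 2) (fun v => by
      rw [norm_pow]; exact pow_le_pow_left₀ (norm_nonneg _) (norm_inv_vline_sub_le hy v) 2)
  have hderiv : ∀ v, HasDerivAt T (T' v) v := by
    intro v
    have h := hasDerivAt_vline c v
    have h0 := vline_ne_zero hc v
    have h1 := one_sub_vline_ne_zero hc1 v
    have h2 := vline_sub_ne_zero hy v
    have e := (hasDerivAt_betaLine hc hc1 p q v).mul
      ((h.mul (h.const_sub 1)).mul ((h.sub_const (y : ℂ)).inv h2))
    convert! e using 1
    simp only [hT', Pi.mul_apply, Pi.inv_apply]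
    field_simp
    ring
  have hint : Integrable T' :=
    (((i0.const_mul _).add (i1.const_mul _)).sub (i2.const_mul _)).const_mul _
  have hlim : ∀ l : Filter ℝ, Tendsto (fun v : ℝ => |v|) l atTop → Tendsto T l (𝓝 0) := by
    intro l hl
    set K := c ^ (-p) * (1 - c) ^ (-q) with hK
    have hcy : 0 < |c - y| := abs_pos.2 (sub_ne_zero.2 hy.symm)
    set D := K * (1 * (2 * (1 + (1 + |y|) / |c - y|))) with hD
    have hbound : ∀ v : ℝ, 1 ≤ |v| → ‖T v‖ ≤ D * |v| ^ (-(p + q - 1)) := by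
      intro v hv
      have hv0 : 0 < |v| := by linarith
      have hb := norm_betaLine_le hc hc1 hp hq v
      have hpow : (1 + ‖v‖ ^ 2) ^ (-(p + q) / 2) ≤ |v| ^ (-(p + q)) := by
        have : |v| ^ (-(p + q)) = (|v| ^ 2) ^ (-(p + q) / 2) := by
          rw [← Real.rpow_natCast, ← Real.rpow_mul hv0.le]; congr 1; push_cast; ring
        rw [this, Real.norm_eq_abs]
        exact Real.rpow_le_rpow_of_nonpos (by positivity) (by linarith) (by linarith)
      have n1 : ‖vline c v * (vline c v - y)⁻¹‖ ≤ 1 + (1 + |y|) / |c - y| := by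
        have : vline c v * (vline c v - y)⁻¹ = 1 + y * (vline c v - y)⁻¹ := by
          field_simp [vline_sub_ne_zero hy v]; ring
        rw [this]
        refine (norm_add_le _ _).trans ?_
        rw [norm_one, norm_mul, Complex.norm_real, Real.norm_eq_abs, div_eq_mul_inv]
        gcongr
        · linarith
        · exact norm_inv_vline_sub_le hy v
      have n2 : ‖1 - vline c v‖ ≤ 2 * |v| := by
        rw [norm_one_sub_vline]
        apply Real.sqrt_le_iff.2 ⟨by positivity, ?_⟩
        have : 1 ≤ |v| ^ 2 := one_le_pow₀ hv
        rw [mul_pow, sq_abs] at *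
        nlinarith
      have hTv : T v = betaLine c p q v * ((vline c v * (vline c v - y)⁻¹) * (1 - vline c v)) := by
        simp only [hT]; ring
      rw [hTv, norm_mul, norm_mul]
      calc _ ≤ (K * |v| ^ (-(p + q))) * ((1 + (1 + |y|) / |c - y|) * (2 * |v|)) := by
            refine mul_le_mul (hb.trans ?_) (mul_le_mul n1 n2 (norm_nonneg _) (by positivity))
              (by positivity) ?_
            · have : 0 ≤ 1 - c := by linarith
              gcongr
            · have : 0 ≤ 1 - c := by linarith
              positivity
        _ = D * |v| ^ (-(p + q - 1)) := by
            rw [show -(p + q - 1) = -(p + q) + 1 by ring, Real.rpow_add hv0, Real.rpow_one, hD]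
            ring
    have hz : Tendsto (fun v : ℝ => D * |v| ^ (-(p + q - 1))) l (𝓝 0) := by
      have := ((tendsto_rpow_neg_atTop (y := p + q - 1) (by linarith)).comp hl).const_mul D
      simpa using this
    exact squeeze_zero_norm' ((hl.eventually_ge_atTop 1).mono hbound) hz
  have h := integral_of_hasDerivAt_of_tendsto hderiv hint (hlim _ tendsto_abs_atBot_atTop)
    (hlim _ tendsto_abs_atTop_atTop)
  have i01 : Integrable fun v => (p + q - 1 : ℂ) * betaLine c p q v +
      ((p + q) * y - p) * (betaLine c p q v * (vline c v - y)⁻¹) :=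
    (i0.const_mul _).add (i1.const_mul _)
  rw [sub_zero, hT', integral_const_mul, integral_sub i01
    (i2.const_mul _), integral_add (i0.const_mul _) (i1.const_mul _), integral_const_mul,
    integral_const_mul, integral_const_mul] at h
  exact (mul_eq_zero.1 h).resolve_left Complex.I_ne_zero

theorem hasDerivAt_integral_betaLine_div (hc : 0 < c) (hc1 : c < 1) (hp : 0 ≤ p) (hq : 0 ≤ q)
    (hpq : 1 < p + q) (hy : y ≠ c) :
    HasDerivAt (fun y : ℝ => ∫ v, betaLine c p q v * (vline c v - y)⁻¹)
      (∫ v, betaLine c p q v * (vline c v - y)⁻¹ ^ 2) y := by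
  have hd : 0 < |c - y| := abs_pos.2 (sub_ne_zero.2 hy.symm)
  have hball : ∀ x ∈ Metric.ball y (|c - y| / 2), |c - y| / 2 ≤ |c - x| ∧ x ≠ c := by
    intro x hx
    rw [Metric.mem_ball, Real.dist_eq] at hx
    have h1 : |c - y| ≤ |c - x| + |x - y| := abs_sub_le c x y
    refine ⟨by linarith, ?_⟩
    rintro rfl
    rw [sub_self, abs_zero] at h1; linarith
  have i1 := integrable_betaLine_mul hc hc1 hp hq hpq (continuous_inv_vline_sub hy)
    (norm_inv_vline_sub_le hy)
  have i0 := integrable_betaLine hc hc1 hp hq hpq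
  refine (hasDerivAt_integral_of_dominated_loc_of_deriv_le
    (F := fun (x : ℝ) v => betaLine c p q v * (vline c v - x)⁻¹)
    (F' := fun (x : ℝ) v => betaLine c p q v * (vline c v - x)⁻¹ ^ 2)
    (bound := fun v => ‖betaLine c p q v‖ * ((|c - y| / 2)⁻¹ ^ 2))
    (Metric.ball_mem_nhds y (half_pos hd)) ?_ i1 ?_ ?_ (i0.norm.mul_const _) ?_).2
  · filter_upwards [Metric.ball_mem_nhds y (half_pos hd)] with x hx
    exact ((continuous_betaLine hc hc1 p q).mul
      (continuous_inv_vline_sub (hball x hx).2)).aestronglyMeasurable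
  · exact ((continuous_betaLine hc hc1 p q).mul
      ((continuous_inv_vline_sub hy).pow 2)).aestronglyMeasurable
  · refine Eventually.of_forall fun v x hx => ?_
    rw [norm_mul, norm_pow]
    gcongr
    exact (norm_inv_vline_sub_le (hball x hx).2 v).trans
      (inv_anti₀ (by positivity) (hball x hx).1)
  · refine Eventually.of_forall fun v x hx => ?_
    have h2 := vline_sub_ne_zero (hball x hx).2 v
    have h3 : HasDerivAt (fun x : ℝ => vline c v - (x : ℂ)) (-1) x := by
      simpa using (hasDerivAt_id x).ofReal_comp.const_sub (vline c v)
    convert! (h3.inv h2).const_mul (betaLine c p q v) using 1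
    rw [neg_neg, inv_pow, one_div]

/-- The integral of `u ^ (-p) (1 - u) ^ (-q) / (u - y)` along `Re u = c`, times `y ^ p (1 - y) ^ q`. -/
noncomputable def betaCauchy (c p q y : ℝ) : ℂ :=
  ((y ^ p * (1 - y) ^ q : ℝ) : ℂ) * ∫ v, betaLine c p q v * (vline c v - y)⁻¹

theorem hasDerivAt_betaWeight (p q : ℝ) (hy0 : 0 < y) (hy1 : y < 1) :
    HasDerivAt (fun y : ℝ => y ^ p * (1 - y) ^ q)
      (y ^ (p - 1) * (1 - y) ^ (q - 1) * (p * (1 - y) - q * y)) y := by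
  have h1y : 0 < 1 - y := by linarith
  have h1 := (hasDerivAt_id y).rpow_const (p := p) (Or.inl hy0.ne')
  have h2 := ((hasDerivAt_id y).const_sub 1).rpow_const (p := q) (Or.inl h1y.ne')
  convert! h1.mul h2 using 1
  simp only [id]
  rw [Real.rpow_sub_one hy0.ne', Real.rpow_sub_one h1y.ne']
  field_simp
  ring

/-- By the total derivative relation, the terms with `1 / (u - y)` and `1 / (u - y)²` cancel,
leaving a multiple of the beta density whose coefficient does not depend on `y`. -/
theorem hasDerivAt_betaCauchy (hc : 0 < c) (hc1 : c < 1) (hp : 0 ≤ p) (hq : 0 ≤ q)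
    (hpq : 1 < p + q) (hy : y ≠ c) (hy0 : 0 < y) (hy1 : y < 1) :
    HasDerivAt (betaCauchy c p q)
      ((p + q - 1) * (∫ v, betaLine c p q v) * ((y ^ (p - 1) * (1 - y) ^ (q - 1) : ℝ) : ℂ)) y := by
  have h1y : 0 < 1 - y := by linarith
  convert! (hasDerivAt_betaWeight p q hy0 hy1).ofReal_comp.mul
    (hasDerivAt_integral_betaLine_div hc hc1 hp hq hpq hy) using 1
  have h := integral_betaLine_total_derivative hc hc1 hp hq hpq hy
  have hw : y ^ p * (1 - y) ^ q = y ^ (p - 1) * (1 - y) ^ (q - 1) * (y * (1 - y)) := by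
    rw [Real.rpow_sub_one hy0.ne', Real.rpow_sub_one h1y.ne']
    field_simp
  rw [hw]
  push_cast
  linear_combination ((y ^ (p - 1) : ℝ) : ℂ) * (((1 - y) ^ (q - 1) : ℝ) : ℂ) * h

theorem continuousAt_betaCauchy (hc : 0 < c) (hc1 : c < 1) (hp : 0 < p) (hq : 0 < q)
    (hpq : 1 < p + q) (hy : y ≠ c) : ContinuousAt (betaCauchy c p q) y := by
  have h1 : ContinuousAt (fun y : ℝ => y ^ p * (1 - y) ^ q) y := by
    apply Continuous.continuousAt
    exact (Real.continuous_rpow_const hp.le).mul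
      ((Real.continuous_rpow_const hq.le).comp (continuous_const.sub continuous_id))
  exact (Complex.continuous_ofReal.continuousAt.comp h1).mul
    (hasDerivAt_integral_betaLine_div hc hc1 hp.le hq.le hpq hy).continuousAt

theorem betaDensity_ofReal {t : ℝ} (ht : t ∈ Icc (0 : ℝ) 1) (p q : ℝ) :
    ((t ^ (p - 1) * (1 - t) ^ (q - 1) : ℝ) : ℂ) =
      (t : ℂ) ^ ((p : ℂ) - 1) * (1 - (t : ℂ)) ^ ((q : ℂ) - 1) := by
  rw [Complex.ofReal_mul, Complex.ofReal_cpow ht.1, Complex.ofReal_cpow (sub_nonneg.2 ht.2)]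
  push_cast; rfl

theorem intervalIntegrable_betaDensity (hp : 0 < p) (hq : 0 < q) :
    IntervalIntegrable (fun t : ℝ => t ^ (p - 1) * (1 - t) ^ (q - 1)) volume 0 1 := by
  have h := Complex.betaIntegral_convergent (u := p) (v := q) (by simpa) (by simpa)
  rw [intervalIntegrable_iff_integrableOn_Ioc_of_le zero_le_one] at h ⊢
  have h' : IntegrableOn (fun t : ℝ => ((t : ℂ) ^ ((p : ℂ) - 1) * (1 - (t : ℂ)) ^ ((q : ℂ) - 1)).re)
    (Ioc 0 1) := Integrable.re h
  refine h'.congr_fun (fun t ht => ?_) measurableSet_Ioc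
  have := betaDensity_ofReal (Ioc_subset_Icc_self ht) p q
  simp only [← this]
  exact Complex.ofReal_re _

theorem integral_betaDensity (hp : 0 < p) (hq : 0 < q) :
    ∫ t in (0 : ℝ)..1, t ^ (p - 1) * (1 - t) ^ (q - 1) = ProbabilityTheory.beta p q := by
  rw [ProbabilityTheory.beta_eq_betaIntegralReal p q hp hq, Complex.betaIntegral]
  have : ∫ t in (0 : ℝ)..1, (t : ℂ) ^ ((p : ℂ) - 1) * (1 - (t : ℂ)) ^ ((q : ℂ) - 1) =
      ∫ t in (0 : ℝ)..1, ((t ^ (p - 1) * (1 - t) ^ (q - 1) : ℝ) : ℂ) := by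
    apply intervalIntegral.integral_congr
    intro t ht
    rw [uIcc_of_le zero_le_one] at ht
    exact (betaDensity_ofReal ht p q).symm
  rw [this, intervalIntegral.integral_ofReal, Complex.ofReal_re]

theorem intervalIntegrable_betaDensity_of_mem (hp : 0 < p) (hq : 0 < q) {a b : ℝ}
    (ha : a ∈ Icc (0 : ℝ) 1) (hb : b ∈ Icc (0 : ℝ) 1) :
    IntervalIntegrable (fun t : ℝ => t ^ (p - 1) * (1 - t) ^ (q - 1)) volume a b := by
  apply (intervalIntegrable_betaDensity hp hq).mono_set
  rw [uIcc_of_le zero_le_one]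
  exact uIcc_subset_Icc ha hb

theorem betaCauchy_sub (hc : 0 < c) (hc1 : c < 1) (hp : 0 < p) (hq : 0 < q)
    (hpq : 1 < p + q) {a b : ℝ} (ha : 0 ≤ a) (hab : a ≤ b) (hb : b ≤ 1) (h : c ∉ Icc a b) :
    betaCauchy c p q b - betaCauchy c p q a = (p + q - 1) * (∫ v, betaLine c p q v) *
      ((∫ t in a..b, t ^ (p - 1) * (1 - t) ^ (q - 1) : ℝ) : ℂ) := by
  have hne : ∀ t ∈ Icc a b, t ≠ c := fun t ht h' => h (h' ▸ ht)
  have hi : IntervalIntegrable (fun t : ℝ => ((t ^ (p - 1) * (1 - t) ^ (q - 1) : ℝ) : ℂ))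
      volume a b := by
    have h := intervalIntegrable_betaDensity_of_mem hp hq ⟨ha, hab.trans hb⟩ ⟨ha.trans hab, hb⟩
    exact ⟨Integrable.ofReal h.1, Integrable.ofReal h.2⟩
  rw [← intervalIntegral.integral_ofReal, ← intervalIntegral.integral_const_mul]
  refine (intervalIntegral.integral_eq_sub_of_hasDerivAt_of_le hab ?_ ?_ (hi.const_mul _)).symm
  · exact fun t ht => (continuousAt_betaCauchy hc hc1 hp hq hpq (hne t ht)).continuousWithinAt
  · exact fun t ht => hasDerivAt_betaCauchy hc hc1 hp.le hq.le hpq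
      (hne t (Ioo_subset_Icc_self ht)) (ha.trans_lt ht.1) (ht.2.trans_le hb)

theorem betaCauchy_zero (hp : 0 < p) : betaCauchy c p q 0 = 0 := by
  simp [betaCauchy, Real.zero_rpow hp.ne']

theorem betaCauchy_one (hq : 0 < q) : betaCauchy c p q 1 = 0 := by
  simp [betaCauchy, Real.zero_rpow hq.ne']

/-- The kernel is `2π` times the Poisson kernel, an approximate identity; `v = ε s` followed by
dominated convergence makes this precise. -/
theorem tendsto_poisson_betaLine (hc : 0 < c) (hc1 : c < 1) (hp : 0 ≤ p) (hq : 0 ≤ q) :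
    Tendsto (fun ε : ℝ => ∫ v, betaLine c p q v * (2 * ε / (ε ^ 2 + v ^ 2) : ℝ)) (𝓝[>] 0)
      (𝓝 (2 * π * betaLine c p q 0)) := by
  have hsub : ∀ ε : ℝ, 0 < ε → ∫ v, betaLine c p q v * (2 * ε / (ε ^ 2 + v ^ 2) : ℝ) =
      ∫ s, betaLine c p q (ε * s) * ((2 * (1 + s ^ 2)⁻¹ : ℝ) : ℂ) := by
    intro ε hε
    have h := Measure.integral_comp_mul_left
      (fun v => betaLine c p q v * (2 * ε / (ε ^ 2 + v ^ 2) : ℝ)) ε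
    rw [abs_of_pos (inv_pos.2 hε)] at h
    have h2 := congrArg (fun z : ℂ => ε • z) h
    simp only [smul_smul, mul_inv_cancel₀ hε.ne', one_smul] at h2
    rw [← h2, ← integral_smul]
    congr 1; ext s
    have : (2 * (1 + s ^ 2)⁻¹ : ℝ) = ε * (2 * ε / (ε ^ 2 + (ε * s) ^ 2)) := by
      have : (1 + s ^ 2) ≠ 0 := by positivity
      rw [mul_pow, ← mul_one_add]
      field_simp
    rw [this, Complex.ofReal_mul, Complex.real_smul]
    ring
  have hev : (fun ε : ℝ => ∫ s, betaLine c p q (ε * s) * ((2 * (1 + s ^ 2)⁻¹ : ℝ) : ℂ)) =ᶠ[𝓝[>] 0]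
      fun ε : ℝ => ∫ v, betaLine c p q v * (2 * ε / (ε ^ 2 + v ^ 2) : ℝ) := by
    filter_upwards [self_mem_nhdsWithin] with ε hε using (hsub ε hε).symm
  refine Tendsto.congr' hev ?_
  have hcont := continuous_betaLine hc hc1 p q
  have hi : Integrable fun s : ℝ => 2 * (1 + s ^ 2)⁻¹ := integrable_inv_one_add_sq.const_mul 2
  have hlim : 2 * π * betaLine c p q 0 =
      ∫ s : ℝ, betaLine c p q 0 * ((2 * (1 + s ^ 2)⁻¹ : ℝ) : ℂ) := by
    rw [integral_const_mul, integral_complex_ofReal, integral_const_mul, integral_univ_inv_one_add_sq]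
    push_cast; ring
  rw [hlim]
  have h1c : 0 ≤ 1 - c := by linarith
  set K := c ^ (-p) * (1 - c) ^ (-q) with hK
  have hK0 : 0 ≤ K := by positivity
  have hKb : ∀ v, ‖betaLine c p q v‖ ≤ K := fun v => by
    refine (norm_betaLine_le hc hc1 hp hq v).trans (mul_le_of_le_one_right hK0 ?_)
    exact Real.rpow_le_one_of_one_le_of_nonpos (by nlinarith [sq_nonneg ‖v‖]) (by linarith)
  apply tendsto_integral_filter_of_dominated_convergence
    (bound := fun s : ℝ => K * (2 * (1 + s ^ 2)⁻¹))
  · refine Eventually.of_forall fun ε => ?_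
    have h1 : Continuous fun s : ℝ => betaLine c p q (ε * s) :=
      hcont.comp (continuous_const.mul continuous_id)
    exact h1.aestronglyMeasurable.mul hi.ofReal.aestronglyMeasurable
  · refine Eventually.of_forall fun ε => Eventually.of_forall fun s => ?_
    rw [norm_mul, Complex.norm_real, Real.norm_of_nonneg (by positivity)]
    gcongr
    exact hKb _
  · exact hi.const_mul K
  · refine Eventually.of_forall fun s => ?_
    apply Tendsto.mul_const
    have h1 : Tendsto (fun ε : ℝ => ε * s) (𝓝[>] 0) (𝓝 0) := by
      have : Tendsto (fun ε : ℝ => ε * s) (𝓝 0) (𝓝 (0 * s)) :=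
        tendsto_id.mul_const s
      rw [zero_mul] at this
      exact this.mono_left nhdsWithin_le_nhds
    exact (hcont.tendsto 0).comp h1

/-- The distance from `c + ε` to the line is `ε`, so `ε / |u - c - ε| ≤ 1` dominates, while the
quotient tends to `0` for every `v ≠ 0`. -/
theorem tendsto_mul_integral_betaLine_div (hc : 0 < c) (hc1 : c < 1) (hp : 0 ≤ p) (hq : 0 ≤ q)
    (hpq : 1 < p + q) :
    Tendsto (fun ε : ℝ => (ε : ℂ) * ∫ v, betaLine c p q v * (vline c v - (c + ε : ℝ))⁻¹) (𝓝[>] 0)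
      (𝓝 0) := by
  have i0 := integrable_betaLine hc hc1 hp hq hpq
  have hval : ∀ (ε v : ℝ), vline c v - (c + ε : ℝ) = v * Complex.I - ε := by
    intro ε v; unfold vline; push_cast; ring
  have h0 : (0 : ℂ) = ∫ v : ℝ, (0 : ℂ) := by simp
  rw [h0]
  simp only [← integral_const_mul]
  apply tendsto_integral_filter_of_dominated_convergence (bound := fun v => ‖betaLine c p q v‖)
  · filter_upwards [self_mem_nhdsWithin] with ε hε
    have hε : 0 < ε := hε
    exact (continuous_const.mul ((continuous_betaLine hc hc1 p q).mul
      (continuous_inv_vline_sub (y := c + ε) (by linarith)))).aestronglyMeasurable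
  · filter_upwards [self_mem_nhdsWithin] with ε hε
    have hε : 0 < ε := hε
    refine Eventually.of_forall fun v => ?_
    have h1 := norm_inv_vline_sub_le (c := c) (y := c + ε) (by linarith) v
    rw [sub_add_cancel_left, abs_neg, abs_of_pos hε] at h1
    rw [norm_mul, norm_mul, Complex.norm_real, Real.norm_of_nonneg hε.le]
    calc _ ≤ ε * (‖betaLine c p q v‖ * ε⁻¹) := by gcongr
      _ = _ := by field_simp
  · exact i0.norm
  · have hne : ∀ᵐ v : ℝ, v ≠ 0 := by
      simp [ae_iff]
    filter_upwards [hne] with v hv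
    have hv' : (v : ℂ) * Complex.I - (0 : ℝ) ≠ 0 := by
      simp [hv]
    have h1 : Tendsto (fun ε : ℝ => (ε : ℂ) * (betaLine c p q v * (v * Complex.I - ε)⁻¹)) (𝓝 0)
        (𝓝 (((0 : ℝ) : ℂ) * (betaLine c p q v * (v * Complex.I - (0 : ℝ))⁻¹))) := by
      have hc : Tendsto (fun ε : ℝ => (ε : ℂ)) (𝓝 0) (𝓝 ((0 : ℝ) : ℂ)) :=
        Complex.continuous_ofReal.tendsto 0
      exact hc.mul (((tendsto_const_nhds.sub hc).inv₀ hv').const_mul _)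
    simp only [hval]
    simpa using h1.mono_left nhdsWithin_le_nhds

theorem betaWeight_mul_betaLine_zero (hc : 0 < c) (hc1 : c < 1) (p q : ℝ) :
    ((c ^ p * (1 - c) ^ q : ℝ) : ℂ) * betaLine c p q 0 = 1 := by
  have h1 : 0 < 1 - c := by linarith
  have hv : vline c 0 = c := by simp [vline]
  rw [betaLine, hv, ← Complex.ofReal_one, ← Complex.ofReal_sub, ← Complex.ofReal_neg,
    ← Complex.ofReal_neg, ← Complex.ofReal_cpow hc.le, ← Complex.ofReal_cpow h1.le,
    ← Complex.ofReal_mul, ← Complex.ofReal_mul, Real.rpow_neg hc.le, Real.rpow_neg h1.le]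
  congr 1
  have := (Real.rpow_pos_of_pos hc p).ne'
  have := (Real.rpow_pos_of_pos h1 q).ne'
  field_simp

/-- With weight `g` and integrals `J₋`, `J₊` at `c ∓ ε`, the difference is `g(c - ε) (J₋ - J₊) +
(g(c - ε) - g(c + ε)) J₊`. The first term carries the Poisson kernel; the second is a convergent
difference quotient times `ε J₊ → 0`. -/
theorem tendsto_betaCauchy_jump (hc : 0 < c) (hc1 : c < 1) (hp : 0 ≤ p) (hq : 0 ≤ q)
    (hpq : 1 < p + q) :
    Tendsto (fun ε : ℝ => betaCauchy c p q (c - ε) - betaCauchy c p q (c + ε)) (𝓝[>] 0)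
      (𝓝 (2 * π)) := by
  set g : ℝ → ℝ := fun y => y ^ p * (1 - y) ^ q with hg
  have hgd : HasDerivAt g _ c := hasDerivAt_betaWeight p q hc hc1
  set g' := c ^ (p - 1) * (1 - c) ^ (q - 1) * (p * (1 - c) - q * c)
  have hadd : HasDerivAt (fun ε : ℝ => g (c + ε)) g' 0 := by
    have h : HasDerivAt g g' (c + 0) := by rwa [add_zero]
    exact h.comp_const_add c 0
  have hsub : HasDerivAt (fun ε : ℝ => g (c - ε)) (-g') 0 := by
    have h : HasDerivAt g g' (c - 0) := by rwa [sub_zero]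
    exact h.comp_const_sub c 0
  have hquot : Tendsto (fun ε : ℝ => (g (c - ε) - g (c + ε)) / ε) (𝓝[>] 0) (𝓝 (-g' - g')) := by
    have h := (hsub.sub hadd).tendsto_slope_zero_right
    refine h.congr fun ε => ?_
    simp [div_eq_inv_mul]
  have hgc : Tendsto (fun ε : ℝ => g (c - ε)) (𝓝[>] 0) (𝓝 (g c)) := by
    have := hsub.continuousAt.tendsto
    rw [sub_zero] at this
    exact this.mono_left nhdsWithin_le_nhds
  have e1 := (Complex.continuous_ofReal.tendsto _).comp hgc
  have e2 := (Complex.continuous_ofReal.tendsto _).comp hquot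
  have hlim := (e1.mul (tendsto_poisson_betaLine hc hc1 hp hq)).add
    (e2.mul (tendsto_mul_integral_betaLine_div hc hc1 hp hq hpq))
  have hval : ((g c : ℝ) : ℂ) * (2 * π * betaLine c p q 0) + ((-g' - g' : ℝ) : ℂ) * 0 = 2 * π := by
    linear_combination (2 * π : ℂ) * betaWeight_mul_betaLine_zero hc hc1 p q
  rw [hval] at hlim
  refine hlim.congr' ?_
  filter_upwards [self_mem_nhdsWithin] with ε hε
  have hε : 0 < ε := hε
  have hε' : (ε : ℂ) ≠ 0 := by exact_mod_cast hε.ne'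
  have j1 := integrable_betaLine_mul hc hc1 hp hq hpq (continuous_inv_vline_sub
    (y := c - ε) (c := c) (by linarith)) (norm_inv_vline_sub_le (by linarith))
  have j2 := integrable_betaLine_mul hc hc1 hp hq hpq (continuous_inv_vline_sub
    (y := c + ε) (c := c) (by linarith)) (norm_inv_vline_sub_le (by linarith))
  have hP : ∫ v, betaLine c p q v * (2 * ε / (ε ^ 2 + v ^ 2) : ℝ) =
      (∫ v, betaLine c p q v * (vline c v - (c - ε : ℝ))⁻¹) -
      ∫ v, betaLine c p q v * (vline c v - (c + ε : ℝ))⁻¹ := by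
    rw [← integral_sub j1 j2]
    congr 1; ext v
    have n1 := vline_sub_ne_zero (c := c) (y := c - ε) (by linarith) v
    have n2 := vline_sub_ne_zero (c := c) (y := c + ε) (by linarith) v
    have n3 : ((ε ^ 2 + v ^ 2 : ℝ) : ℂ) ≠ 0 := by
      exact_mod_cast (by positivity : ε ^ 2 + v ^ 2 ≠ 0)
    rw [← mul_sub]
    congr 1
    have hprod : (vline c v - (c - ε : ℝ)) * (vline c v - (c + ε : ℝ)) =
        -((ε ^ 2 + v ^ 2 : ℝ) : ℂ) := by
      unfold vline; push_cast
      linear_combination (v : ℂ) ^ 2 * Complex.I_sq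
    rw [inv_sub_inv n1 n2, hprod, Complex.ofReal_div, div_neg, ← neg_div]
    congr 1
    push_cast; ring
  simp only [Function.comp_apply]
  rw [hP, betaCauchy, betaCauchy]
  simp only [hg]
  push_cast
  field_simp
  ring

/-- `betaCauchy` vanishes at `0` and `1`, so its increments over `[0, c - ε]` and `[c + ε, 1]` add
up to the jump across `c`. As `ε → 0` the two pieces of the density fill the whole beta integral. -/
theorem betaCauchy_normalization (hc : 0 < c) (hc1 : c < 1) (hp : 0 < p) (hq : 0 < q)
    (hpq : 1 < p + q) :
    (p + q - 1) * (∫ v, betaLine c p q v) * (ProbabilityTheory.beta p q : ℂ) = 2 * π := by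
  set A : ℂ := (p + q - 1) * (∫ v, betaLine c p q v) with hA
  set b : ℝ → ℝ := fun t => t ^ (p - 1) * (1 - t) ^ (q - 1) with hb
  have hbi : ∀ {x z : ℝ}, x ∈ Icc (0 : ℝ) 1 → z ∈ Icc (0 : ℝ) 1 → IntervalIntegrable b volume x z :=
    fun hx hz => intervalIntegrable_betaDensity_of_mem hp hq hx hz
  have hev : ∀ᶠ ε : ℝ in 𝓝[>] 0, 0 < ε ∧ ε < c ∧ ε < 1 - c := by
    filter_upwards [Ioo_mem_nhdsGT (lt_min hc (sub_pos.2 hc1))] with ε hε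
    exact ⟨hε.1, hε.2.trans_le (min_le_left _ _), hε.2.trans_le (min_le_right _ _)⟩
  have hcont : ContinuousOn (fun x => ∫ t in (0 : ℝ)..x, b t) (Icc 0 1) := by
    have h := hbi (x := 0) (z := 1) (by simp) (by simp)
    have := intervalIntegral.continuousOn_primitive_interval (a := 0) (b := 1) (f := b) (μ := volume)
      (by rw [uIcc_of_le zero_le_one]
          exact ((intervalIntegrable_iff_integrableOn_Icc_of_le zero_le_one).1 h))
    rwa [uIcc_of_le zero_le_one] at this
  have hcat : ContinuousAt (fun x => ∫ t in (0 : ℝ)..x, b t) c :=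
    hcont.continuousAt (Icc_mem_nhds hc hc1)
  have t1 : Tendsto (fun ε : ℝ => ∫ t in (0 : ℝ)..(c - ε), b t) (𝓝[>] 0)
      (𝓝 (∫ t in (0 : ℝ)..c, b t)) := by
    have h : Tendsto (fun ε : ℝ => c - ε) (𝓝[>] 0) (𝓝 c) := by
      have : Tendsto (fun ε : ℝ => c - ε) (𝓝 0) (𝓝 (c - 0)) := tendsto_const_nhds.sub tendsto_id
      rw [sub_zero] at this
      exact this.mono_left nhdsWithin_le_nhds
    exact hcat.tendsto.comp h
  have t2 : Tendsto (fun ε : ℝ => ∫ t in (0 : ℝ)..(c + ε), b t) (𝓝[>] 0)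
      (𝓝 (∫ t in (0 : ℝ)..c, b t)) := by
    have h : Tendsto (fun ε : ℝ => c + ε) (𝓝[>] 0) (𝓝 c) := by
      have : Tendsto (fun ε : ℝ => c + ε) (𝓝 0) (𝓝 (c + 0)) := tendsto_const_nhds.add tendsto_id
      rw [add_zero] at this
      exact this.mono_left nhdsWithin_le_nhds
    exact hcat.tendsto.comp h
  have t3 : Tendsto (fun ε : ℝ => A * (((∫ t in (0 : ℝ)..(c - ε), b t) +
      ((∫ t in (0 : ℝ)..1, b t) - ∫ t in (0 : ℝ)..(c + ε), b t) : ℝ) : ℂ)) (𝓝[>] 0)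
      (𝓝 (A * (ProbabilityTheory.beta p q : ℂ))) := by
    have h := t1.add ((tendsto_const_nhds (x := ∫ t in (0 : ℝ)..1, b t)).sub t2)
    have h' := ((Complex.continuous_ofReal.tendsto _).comp h).const_mul A
    rw [add_sub_cancel] at h'
    rw [← integral_betaDensity hp hq]
    exact h'
  refine tendsto_nhds_unique t3 ((tendsto_betaCauchy_jump hc hc1 hp.le hq.le hpq).congr' ?_)
  filter_upwards [hev] with ε ⟨h0, h1, h2⟩
  have s1 := betaCauchy_sub hc hc1 hp hq hpq (a := 0) (b := c - ε) le_rfl (by linarith)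
    (by linarith) (fun h => by linarith [h.2])
  have s2 := betaCauchy_sub hc hc1 hp hq hpq (a := c + ε) (b := 1) (by linarith) (by linarith)
    le_rfl (fun h => by linarith [h.1])
  rw [betaCauchy_zero hp, sub_zero] at s1
  rw [betaCauchy_one hq, zero_sub] at s2
  have s3 : (∫ t in (0 : ℝ)..1, b t) - ∫ t in (0 : ℝ)..(c + ε), b t = ∫ t in (c + ε)..1, b t :=
    intervalIntegral.integral_interval_sub_left (hbi (by simp) (by simp))
      (hbi (by simp) ⟨by linarith, by linarith⟩)
  rw [s3, s1, sub_eq_add_neg, s2]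
  push_cast
  ring

theorem centralBeta_eq_integral (hc : 0 < c) (hc1 : c < 1) (hp : 0 < p) (hq : 0 < q)
    (hpq : 1 < p + q) (hy : 0 ≤ y) (hyc : y < c) :
    (centralBeta p q y : ℂ) = ((y ^ p * (1 - y) ^ q : ℝ) : ℂ) / (2 * π) *
      ∫ v, betaLine c p q v * (vline c v - y)⁻¹ := by
  have h1 := betaCauchy_normalization hc hc1 hp hq hpq
  have h2 := betaCauchy_sub hc hc1 hp hq hpq (a := 0) (b := y) le_rfl hy (by linarith)
    (fun h => by linarith [h.2])
  rw [betaCauchy_zero hp, sub_zero, betaCauchy] at h2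
  have hb : (ProbabilityTheory.beta p q : ℂ) ≠ 0 := by
    exact_mod_cast (ProbabilityTheory.beta_pos hp hq).ne'
  have hpi : (π : ℂ) ≠ 0 := by exact_mod_cast pi_ne_zero
  rw [centralBeta, div_mul_eq_mul_div, h2, Complex.ofReal_div, ← h1]
  have hA : (p + q - 1) * (∫ v, betaLine c p q v) ≠ 0 := by
    intro h; rw [h, zero_mul] at h1
    exact hpi (by simpa using h1.symm)
  exact (mul_div_mul_left _ _ hA).symm

theorem betaLine_add_nat (hc : 0 < c) (p q v : ℝ) (j : ℕ) :
    betaLine c (p + j) q v = betaLine c p q v * (vline c v)⁻¹ ^ j := by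
  have h0 := vline_ne_zero hc v
  rw [betaLine, betaLine, show (-((p + j : ℝ) : ℂ)) = -(p : ℂ) - (j : ℂ) by push_cast; ring,
    Complex.cpow_sub _ _ h0, Complex.cpow_natCast, inv_pow]
  ring

/-- The `j`-th summand contributes `(x y / (2 u)) ^ j / j!` under the integral. On the line `|u| ≥
c`, so the series of integrals converges absolutely and sums to the exponential. -/
theorem noncentralBeta_eq_integral {x : ℝ} (hc : 0 < c) (hc1 : c < 1) (hp : 0 < p) (hq : 0 < q)
    (hpq : 1 < p + q) (hy : 0 ≤ y) (hyc : y < c) (hx : 0 ≤ x) :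
    (noncentralBeta p q x y : ℂ) = ((exp (-x / 2) * y ^ p * (1 - y) ^ q : ℝ) : ℂ) / (2 * π) *
      ∫ v, betaLine c p q v * Complex.exp ((x * y / 2 : ℝ) / vline c v) * (vline c v - y)⁻¹ := by
  set F : ℕ → ℝ → ℂ := fun j v => betaLine c p q v *
    ((((x * y / 2 : ℝ) / vline c v) ^ j / (j.factorial : ℂ)) * (vline c v - y)⁻¹) with hF
  have hne : y ≠ c := hyc.ne
  have hinv : ∀ v, ‖(vline c v)⁻¹‖ ≤ c⁻¹ := fun v => by
    have := norm_inv_vline_sub_le (c := c) (y := 0) hc.ne v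
    simpa [abs_of_pos hc] using this
  have hg : ∀ j v, ‖(((x * y / 2 : ℝ) : ℂ) / vline c v) ^ j / (j.factorial : ℂ)‖ ≤
      (x * y / 2 * c⁻¹) ^ j / j.factorial := by
    intro j v
    rw [norm_div, norm_pow, div_eq_mul_inv _ (vline c v), norm_mul, Complex.norm_natCast,
      Complex.norm_real, Real.norm_of_nonneg (by positivity)]
    gcongr
    exact hinv v
  have hcontv : ∀ j, Continuous fun v => ((((x * y / 2 : ℝ) : ℂ) / vline c v) ^ j / (j.factorial : ℂ)) :=
    fun j => ((continuous_const.div (continuous_vline c) (vline_ne_zero hc)).pow j).div_const _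
  have hFi : ∀ j, Integrable (F j) := fun j =>
    integrable_betaLine_mul hc hc1 hp.le hq.le hpq
      ((hcontv j).mul (continuous_inv_vline_sub hne))
      (K := (x * y / 2 * c⁻¹) ^ j / j.factorial * |c - y|⁻¹) (fun v => by
        rw [norm_mul]
        exact mul_le_mul (hg j v) (norm_inv_vline_sub_le hne v) (norm_nonneg _) (by positivity))
  have i0 := integrable_betaLine hc hc1 hp.le hq.le hpq
  have hsum : Summable fun j => ∫ v, ‖F j v‖ := by
    refine Summable.of_nonneg_of_le (fun j => integral_nonneg fun v => norm_nonneg _) (fun j => ?_)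
      ((Real.summable_pow_div_factorial (x * y / 2 * c⁻¹)).mul_left
        ((∫ v, ‖betaLine c p q v‖) * |c - y|⁻¹))
    calc ∫ v, ‖F j v‖ ≤ ∫ v, ‖betaLine c p q v‖ * ((x * y / 2 * c⁻¹) ^ j / j.factorial * |c - y|⁻¹) := by
          refine integral_mono (hFi j).norm (i0.norm.mul_const _) fun v => ?_
          simp only [hF]
          rw [norm_mul, norm_mul]
          gcongr
          · exact hg j v
          · exact norm_inv_vline_sub_le hne v
      _ = _ := by rw [integral_mul_const]; ring
  have hs := (hasSum_integral_of_summable_integral_norm hFi hsum).tsum_eq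
  have hexp : ∀ v, ∑' j, F j v = betaLine c p q v * Complex.exp ((x * y / 2 : ℝ) / vline c v) *
      (vline c v - y)⁻¹ := by
    intro v
    simp only [hF]
    rw [tsum_mul_left, tsum_mul_right, Complex.exp_eq_exp_ℂ, NormedSpace.exp_eq_tsum_div, mul_assoc]
  simp only [hexp] at hs
  rw [← hs, noncentralBeta, Complex.ofReal_mul, Complex.ofReal_tsum, ← tsum_mul_left, ← tsum_mul_left]
  refine tsum_congr fun j => ?_
  have hj : (0 : ℝ) ≤ j := Nat.cast_nonneg j
  rw [Complex.ofReal_mul, centralBeta_eq_integral hc hc1 (by positivity) hq (by linarith) hy hyc]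
  have hFj : ∫ v, F j v = ((x * y / 2 : ℝ) : ℂ) ^ j / (j.factorial : ℂ) *
      ∫ v, betaLine c (p + j) q v * (vline c v - y)⁻¹ := by
    rw [← integral_const_mul]
    congr 1; ext v
    simp only [hF]
    rw [betaLine_add_nat hc, div_pow, inv_pow]
    ring
  rw [hFj, Real.rpow_add_of_nonneg hy hp.le hj, Real.rpow_natCast]
  push_cast
  ring

end BetaLine

/-! ### The complex phase near the saddle: square root, uniformizing variable, expansion. -/

section ComplexPhase

open Filter Topology Metric

/-- The phase function in the variable `u = 1 / t`. -/
noncomputable def phaseC (α β ξ : ℝ) (u : ℂ) : ℂ :=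
  -α * Complex.log u - β * Complex.log (1 - u) + ξ / u

/-- The divided difference of the derivative of `phaseC` at a saddle point `a`. -/
noncomputable def phaseK (α β ξ a : ℝ) (u : ℂ) : ℂ :=
  α * (u * a)⁻¹ + β * ((1 - u) * (1 - a : ℝ))⁻¹ + ξ * ((u + a) / (u ^ 2 * a ^ 2))

/-- The parameters of a saddle point `a ∈ (0, 1)` of `phaseC α β ξ`, with a radius `ρ` small
compared with the distance of `a` to the singular points `0` and `1`. -/
structure IsSaddleAt (α β ξ a ρ : ℝ) : Prop where
  α_nonneg : 0 ≤ α
  β_nonneg : 0 ≤ β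
  add_eq_one : α + β = 1
  ξ_nonneg : 0 ≤ ξ
  ρ_pos : 0 < ρ
  ρ_le : 8 * ρ ≤ a
  ρ_le' : 8 * ρ ≤ 1 - a
  eq_zero : -α / a + β / (1 - a) - ξ / a ^ 2 = 0

/-- Here `Re z ≥ 7a/8` and `|z|² ≤ (9² + 1²) a² / 64`. The lemma serves both singular points, with
`z = u` and with `z = 1 - u`. -/
theorem half_le_re_inv_mul {z : ℂ} {a : ℝ} (ha : 0 < a) (ha1 : a ≤ 1) (hz : ‖z - a‖ ≤ a / 8) :
    1 / 2 ≤ ((z * a)⁻¹).re := by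
  have h1 := (Complex.abs_re_le_norm (z - a)).trans hz
  have h2 := (Complex.abs_im_le_norm (z - a)).trans hz
  simp only [Complex.sub_re, Complex.ofReal_re, Complex.sub_im, Complex.ofReal_im, sub_zero] at h1 h2
  rw [abs_le] at h1 h2
  have hn : 0 < z.re * z.re + z.im * z.im := by nlinarith
  rw [Complex.inv_re, Complex.normSq_apply]
  simp only [Complex.mul_re, Complex.ofReal_re, Complex.ofReal_im, mul_zero, sub_zero,
    Complex.mul_im, zero_add]
  rw [show z.re * a * (z.re * a) + z.im * a * (z.im * a) =
    a * a * (z.re * z.re + z.im * z.im) by ring, le_div_iff₀ (by positivity)]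
  have h3 : z.re * z.re + z.im * z.im ≤ 82 / 64 * a ^ 2 := by nlinarith
  have h4 : a * a ≤ 1 := by nlinarith
  have h5 : a * a * (z.re * z.re + z.im * z.im) ≤ 82 / 64 * a ^ 2 :=
    (mul_le_of_le_one_left hn.le h4).trans h3
  nlinarith

theorem re_add_div_sq_nonneg {z : ℂ} {a : ℝ} (ha : 0 < a) (hz : ‖z - a‖ ≤ a / 8) :
    0 ≤ ((z + a) / (z ^ 2 * a ^ 2)).re := by
  have h1 := (Complex.abs_re_le_norm (z - a)).trans hz
  have h2 := (Complex.abs_im_le_norm (z - a)).trans hz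
  simp only [Complex.sub_re, Complex.ofReal_re, Complex.sub_im, Complex.ofReal_im, sub_zero] at h1 h2
  rw [abs_le] at h1 h2
  have hz0 : z ≠ 0 := by rintro rfl; simp at h1; linarith
  have ha0 : (a : ℂ) ≠ 0 := by exact_mod_cast ha.ne'
  have : (z + a) / (z ^ 2 * a ^ 2) = ((1 / a ^ 2 : ℝ) : ℂ) * z⁻¹ + ((1 / a : ℝ) : ℂ) * (z ^ 2)⁻¹ := by
    push_cast; field_simp
  rw [this, Complex.add_re, Complex.re_ofReal_mul, Complex.re_ofReal_mul, Complex.inv_re,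
    Complex.inv_re]
  have h3 : 0 ≤ (z ^ 2).re := by rw [sq, Complex.mul_re]; nlinarith
  have h4 : 0 ≤ z.re := by linarith
  have := Complex.normSq_nonneg z
  have := Complex.normSq_nonneg (z ^ 2)
  positivity

theorem norm_lower_of_near {z : ℂ} {a : ℝ} (hz : ‖z - a‖ ≤ a / 8) (ha : 0 < a) :
    7 / 8 * a ≤ ‖z‖ ∧ ‖z‖ ≤ 9 / 8 * a := by
  have h1 : ‖(a : ℂ)‖ = a := by rw [Complex.norm_real, norm_of_nonneg ha.le]
  have h2 := norm_sub_norm_le (a : ℂ) z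
  have h3 := norm_sub_norm_le z (a : ℂ)
  rw [norm_sub_rev] at h2
  constructor <;> linarith

theorem norm_inv_mul_le {z : ℂ} {a b : ℝ} (hb : 0 < b) (hba : b ≤ a) (hz : ‖z - a‖ ≤ a / 8) :
    ‖(z * a)⁻¹‖ ≤ 2 / b ^ 2 := by
  have ha : 0 < a := by linarith
  obtain ⟨h1, -⟩ := norm_lower_of_near hz ha
  rw [norm_inv, norm_mul, Complex.norm_real, norm_of_nonneg ha.le, ← one_div,
    div_le_div_iff₀ (by nlinarith) (by positivity)]
  nlinarith [mul_le_mul hba hba hb.le ha.le]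

theorem norm_add_div_sq_le {z : ℂ} {a b : ℝ} (hb : 0 < b) (hba : b ≤ a) (hz : ‖z - a‖ ≤ a / 8) :
    ‖(z + a) / (z ^ 2 * a ^ 2)‖ ≤ 3 / b ^ 3 := by
  have ha : 0 < a := by linarith
  obtain ⟨h1, h2⟩ := norm_lower_of_near hz ha
  rw [norm_div, norm_mul, norm_pow, norm_pow, Complex.norm_real, norm_of_nonneg ha.le]
  have h3 : ‖z + a‖ ≤ 17 / 8 * a := by
    refine (norm_add_le _ _).trans ?_
    rw [Complex.norm_real, norm_of_nonneg ha.le]; linarith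
  have h4 : (7 / 8 * a) ^ 2 ≤ ‖z‖ ^ 2 := pow_le_pow_left₀ (by positivity) h1 2
  calc _ ≤ 17 / 8 * a / ((7 / 8 * a) ^ 2 * a ^ 2) := by gcongr
    _ = (17 * 8 / 49) / a ^ 3 := by field_simp; norm_num
    _ ≤ 3 / b ^ 3 := by gcongr; norm_num

namespace IsSaddleAt

variable {α β ξ a ρ : ℝ}

theorem pos (h : IsSaddleAt α β ξ a ρ) : 0 < a := by linarith [h.ρ_pos, h.ρ_le]

theorem lt_one (h : IsSaddleAt α β ξ a ρ) : a < 1 := by linarith [h.ρ_pos, h.ρ_le']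

theorem near (h : IsSaddleAt α β ξ a ρ) {u : ℂ} (hu : u ∈ ball (a : ℂ) ρ) : ‖u - a‖ ≤ a / 8 := by
  rw [mem_ball, dist_eq_norm] at hu
  linarith [h.ρ_le]

theorem near' (h : IsSaddleAt α β ξ a ρ) {u : ℂ} (hu : u ∈ ball (a : ℂ) ρ) :
    ‖(1 - u) - (1 - a : ℝ)‖ ≤ (1 - a) / 8 := by
  rw [mem_ball, dist_eq_norm] at hu
  have : (1 - u) - (1 - a : ℝ) = -(u - a) := by push_cast; ring
  rw [this, norm_neg]
  linarith [h.ρ_le']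

theorem mem_slitPlane (h : IsSaddleAt α β ξ a ρ) {u : ℂ} (hu : u ∈ ball (a : ℂ) ρ) :
    u ∈ Complex.slitPlane ∧ 1 - u ∈ Complex.slitPlane := by
  have h1 := (Complex.abs_re_le_norm (u - a)).trans (h.near hu)
  have h2 := (Complex.abs_re_le_norm _).trans (h.near' hu)
  simp only [Complex.sub_re, Complex.ofReal_re, Complex.one_re] at h1 h2
  rw [abs_le] at h1 h2
  have := h.pos
  have := h.lt_one
  refine ⟨Or.inl (by linarith), Or.inl ?_⟩
  simp only [Complex.sub_re, Complex.one_re]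
  linarith

theorem hasDerivAt_phaseC (h : IsSaddleAt α β ξ a ρ) {u : ℂ} (h1 : u ∈ Complex.slitPlane)
    (h2 : 1 - u ∈ Complex.slitPlane) :
    HasDerivAt (phaseC α β ξ) ((u - a) * phaseK α β ξ a u) u := by
  have hu := Complex.slitPlane_ne_zero h1
  have hu1 := Complex.slitPlane_ne_zero h2
  have e1 := (Complex.hasDerivAt_log h1).const_mul (-α : ℂ)
  have e2 := (((hasDerivAt_id u).const_sub 1).clog h2).const_mul (β : ℂ)
  have e3 := (hasDerivAt_inv hu).const_mul (ξ : ℂ)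
  have ha : (a : ℂ) ≠ 0 := by exact_mod_cast h.pos.ne'
  have ha1 : (1 - a : ℂ) ≠ 0 := by exact_mod_cast (sub_pos.2 h.lt_one).ne'
  have hz : (-α / a + β / (1 - a) - ξ / a ^ 2 : ℂ) = 0 := by exact_mod_cast h.eq_zero
  convert! (e1.sub e2).add e3 using 1
  rw [phaseK]
  push_cast
  simp only [id]
  -- Subtracting the vanishing derivative at `a` turns the derivative at `u` into a difference,
  -- which contains the factor `u - a`.
  have : ∀ x y : ℂ, x = y + (-α / a + β / (1 - a) - ξ / a ^ 2 : ℂ) * (-1) → x = y := by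
    intro x y hxy; rw [hxy, hz]; ring
  apply this
  field_simp
  ring

/-- The first two terms average to at least `1/2` because `α + β = 1`, and the `ξ` term has
nonnegative real part. The bound is free of all parameters, which makes the square root below
uniform. -/
theorem half_le_re_phaseK (h : IsSaddleAt α β ξ a ρ) {u : ℂ} (hu : u ∈ ball (a : ℂ) ρ) :
    1 / 2 ≤ (phaseK α β ξ a u).re := by
  have h1 := half_le_re_inv_mul h.pos h.lt_one.le (h.near hu)
  have h2 := half_le_re_inv_mul (sub_pos.2 h.lt_one) (by linarith [h.pos]) (h.near' hu)
  have h3 := re_add_div_sq_nonneg h.pos (h.near hu)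
  rw [phaseK, Complex.add_re, Complex.add_re, Complex.re_ofReal_mul, Complex.re_ofReal_mul,
    Complex.re_ofReal_mul]
  have e1 := mul_le_mul_of_nonneg_left h1 h.α_nonneg
  have e2 := mul_le_mul_of_nonneg_left h2 h.β_nonneg
  have e3 := mul_nonneg h.ξ_nonneg h3
  have := h.add_eq_one
  linarith

theorem norm_phaseK_le (h : IsSaddleAt α β ξ a ρ) {b X : ℝ} (hb : 0 < b) (hba : b ≤ a)
    (hba' : b ≤ 1 - a) (hX : ξ ≤ X) {u : ℂ} (hu : u ∈ ball (a : ℂ) ρ) :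
    ‖phaseK α β ξ a u‖ ≤ 2 / b ^ 2 + 3 * X / b ^ 3 := by
  have h1 := norm_inv_mul_le hb hba (h.near hu)
  have h2 := norm_inv_mul_le hb hba' (h.near' hu)
  have h3 := norm_add_div_sq_le hb hba (h.near hu)
  have hα : ‖(α : ℂ)‖ = α := by rw [Complex.norm_real, norm_of_nonneg h.α_nonneg]
  have hβ : ‖(β : ℂ)‖ = β := by rw [Complex.norm_real, norm_of_nonneg h.β_nonneg]
  have hξ : ‖(ξ : ℂ)‖ = ξ := by rw [Complex.norm_real, norm_of_nonneg h.ξ_nonneg]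
  have e1 := mul_le_mul_of_nonneg_left h1 h.α_nonneg
  have e2 := mul_le_mul_of_nonneg_left h2 h.β_nonneg
  have e3 := mul_le_mul_of_nonneg_left h3 h.ξ_nonneg
  have e4 : ξ * (3 / b ^ 3) ≤ X * (3 / b ^ 3) := by gcongr
  have e5 : α * (2 / b ^ 2) + β * (2 / b ^ 2) = 2 / b ^ 2 := by
    rw [← add_mul, h.add_eq_one, one_mul]
  have e6 : 3 * X / b ^ 3 = X * (3 / b ^ 3) := by ring
  refine (norm_add₃_le).trans ?_
  rw [norm_mul, norm_mul, norm_mul, hα, hβ, hξ]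
  linarith

theorem differentiableOn_phaseC (h : IsSaddleAt α β ξ a ρ) :
    DifferentiableOn ℂ (phaseC α β ξ) (ball a ρ) := fun _ hu =>
  (h.hasDerivAt_phaseC (h.mem_slitPlane hu).1
    (h.mem_slitPlane hu).2).differentiableAt.differentiableWithinAt

end IsSaddleAt

/-- The quotient equals the integral of `s K(c + s (u - c))` over `s ∈ [0, 1]`; the proof uses the
equivalent monotonicity in `s`. -/
theorem half_mul_le_re_divided_difference {f K : ℂ → ℂ} {c : ℂ} {R m : ℝ}
    (hf : ∀ u ∈ ball c R, HasDerivAt f ((u - c) * K u) u) (hK : ∀ u ∈ ball c R, m ≤ (K u).re)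
    {u : ℂ} (hu : u ∈ ball c R) (hne : u ≠ c) : m / 2 ≤ ((f u - f c) / (u - c) ^ 2).re := by
  set z := u - c with hz
  have hz0 : z ≠ 0 := sub_ne_zero.2 hne
  have hmem : ∀ s ∈ Icc (0 : ℝ) 1, c + s * z ∈ ball c R := by
    intro s hs
    rw [mem_ball, dist_eq_norm, add_sub_cancel_left, norm_mul, Complex.norm_real,
      norm_of_nonneg hs.1]
    rw [mem_ball, dist_eq_norm] at hu
    exact (mul_le_of_le_one_left (norm_nonneg _) hs.2).trans_lt hu
  have hd : ∀ s ∈ Icc (0 : ℝ) 1, HasDerivAt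
      (fun s : ℝ => ((f (c + s * z) - f c) / z ^ 2).re - m * s ^ 2 / 2)
      (s * ((K (c + s * z)).re - m)) s := by
    intro s hs
    have e1 : HasDerivAt (fun s : ℂ => (f (c + s * z) - f c) / z ^ 2) (s * K (c + s * z)) s := by
      have e0 : HasDerivAt (fun s : ℂ => c + s * z) z s := by
        simpa using ((hasDerivAt_id (s : ℂ)).mul_const z).const_add c
      have := (((hf _ (hmem s hs)).comp (s : ℂ) e0).sub_const (f c)).div_const (z ^ 2)
      convert! this using 1
      rw [add_sub_cancel_left]
      field_simp
    have e2 := e1.real_of_complex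
    have e3 : HasDerivAt (fun s : ℝ => m * s ^ 2 / 2) (m * s) s := by
      have := ((hasDerivAt_pow 2 s).const_mul m).div_const 2
      convert! this using 1
      norm_num; ring
    convert! e2.sub e3 using 1
    rw [Complex.re_ofReal_mul]; ring
  have hmono : MonotoneOn (fun s : ℝ => ((f (c + s * z) - f c) / z ^ 2).re - m * s ^ 2 / 2)
      (Icc 0 1) := by
    apply monotoneOn_of_deriv_nonneg (convex_Icc 0 1)
    · exact fun s hs => (hd s hs).continuousAt.continuousWithinAt
    · exact fun s hs => (hd s (interior_subset hs)).differentiableAt.differentiableWithinAt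
    · intro s hs
      have hs := interior_subset hs
      rw [(hd s hs).deriv]
      exact mul_nonneg hs.1 (sub_nonneg.2 (hK _ (hmem s hs)))
  have := hmono (left_mem_Icc.2 zero_le_one) (right_mem_Icc.2 zero_le_one) zero_le_one
  simp only [Complex.ofReal_zero, zero_mul, add_zero, sub_self, zero_div, Complex.zero_re,
    Complex.ofReal_one, one_mul] at this
  rw [show c + z = u by rw [hz]; ring] at this
  linarith

theorem norm_divided_difference_le {f K : ℂ → ℂ} {c : ℂ} {R M : ℝ}
    (hf : ∀ u ∈ ball c R, HasDerivAt f ((u - c) * K u) u) (hK : ∀ u ∈ ball c R, ‖K u‖ ≤ M)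
    {u : ℂ} (hu : u ∈ ball c R) (hne : u ≠ c) : ‖(f u - f c) / (u - c) ^ 2‖ ≤ M := by
  have hR : 0 < R := pos_of_mem_ball hu
  have hseg : segment ℝ c u ⊆ ball c R :=
    (convex_ball c R).segment_subset (mem_ball_self hR) hu
  have h := (convex_segment (𝕜 := ℝ) c u).norm_image_sub_le_of_norm_hasDerivWithin_le
    (C := ‖u - c‖ * M)
    (fun z hz => (hf z (hseg hz)).hasDerivWithinAt) (fun z hz => by
      rw [norm_mul]
      have hz' := norm_sub_le_of_mem_segment hz
      gcongr
      exact hK z (hseg hz)) (left_mem_segment _ _ _) (right_mem_segment _ _ _)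
  have hpos : 0 < ‖u - c‖ := norm_pos_iff.2 (sub_ne_zero.2 hne)
  rw [norm_div, norm_pow, div_le_iff₀ (by positivity)]
  refine h.trans (le_of_eq (by ring))

theorem re_cpow_half_pos {z : ℂ} (hz : 0 < z.re) : 0 < (z ^ (1 / 2 : ℂ)).re := by
  have hz0 : z ≠ 0 := by rintro rfl; simp at hz
  rw [Complex.cpow_def_of_ne_zero hz0, Complex.exp_re]
  have him : (Complex.log z * (1 / 2)).im = z.arg / 2 := by
    rw [show (1 / 2 : ℂ) = ((1 / 2 : ℝ) : ℂ) by push_cast; ring, mul_comm, Complex.im_ofReal_mul,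
      Complex.log_im]; ring
  rw [him]
  have h1 := Complex.neg_pi_lt_arg z
  have h2 := Complex.arg_lt_pi_iff.2 (Or.inl hz.le)
  exact mul_pos (Real.exp_pos _) (cos_pos_of_mem_Ioo ⟨by linarith, by linarith⟩)

theorem cpow_half_sq (z : ℂ) : (z ^ (1 / 2 : ℂ)) ^ 2 = z := by
  rw [← Complex.cpow_nat_mul]; norm_num

/-- The second divided difference of the phase at the saddle point. -/
noncomputable def saddleH (α β ξ a : ℝ) : ℂ → ℂ :=
  dslope (dslope (phaseC α β ξ) a) a

/-- The square root of twice the second divided difference of the phase at the saddle point. -/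
noncomputable def saddleS (α β ξ a : ℝ) (u : ℂ) : ℂ :=
  (2 * saddleH α β ξ a u) ^ (1 / 2 : ℂ)

/-- The uniformizing variable: `saddleW ^ 2 / 2` is the phase minus its value at the saddle. -/
noncomputable def saddleW (α β ξ a : ℝ) (u : ℂ) : ℂ :=
  (u - a) * saddleS α β ξ a u

namespace IsSaddleAt

variable {α β ξ a ρ M : ℝ}

theorem center_mem (h : IsSaddleAt α β ξ a ρ) : (a : ℂ) ∈ ball (a : ℂ) ρ := mem_ball_self h.ρ_pos

theorem hasDerivAt_phaseC' (h : IsSaddleAt α β ξ a ρ) : ∀ u ∈ ball (a : ℂ) ρ,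
    HasDerivAt (phaseC α β ξ) ((u - a) * phaseK α β ξ a u) u := fun _ hu =>
  h.hasDerivAt_phaseC (h.mem_slitPlane hu).1 (h.mem_slitPlane hu).2

theorem differentiableOn_saddleH (h : IsSaddleAt α β ξ a ρ) :
    DifferentiableOn ℂ (saddleH α β ξ a) (ball a ρ) := by
  have hn : ball (a : ℂ) ρ ∈ 𝓝 (a : ℂ) := ball_mem_nhds _ h.ρ_pos
  exact (Complex.differentiableOn_dslope hn).2
    ((Complex.differentiableOn_dslope hn).2 h.differentiableOn_phaseC)

theorem sq_mul_saddleH (h : IsSaddleAt α β ξ a ρ) (u : ℂ) :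
    (u - a) ^ 2 * saddleH α β ξ a u = phaseC α β ξ u - phaseC α β ξ a := by
  have h1 := sub_smul_dslope (phaseC α β ξ) (a : ℂ) u
  have h2 := sub_smul_dslope (dslope (phaseC α β ξ) a) (a : ℂ) u
  have h3 : dslope (phaseC α β ξ) a a = 0 := by
    rw [dslope_same, (h.hasDerivAt_phaseC' a h.center_mem).deriv, sub_self, zero_mul]
  rw [h3, sub_zero] at h2
  rw [← h1, ← h2, smul_eq_mul, smul_eq_mul, saddleH]
  ring

theorem saddleH_of_ne (h : IsSaddleAt α β ξ a ρ) {u : ℂ} (hne : u ≠ a) :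
    saddleH α β ξ a u = (phaseC α β ξ u - phaseC α β ξ a) / (u - a) ^ 2 := by
  rw [← h.sq_mul_saddleH u, mul_div_cancel_left₀ _ (pow_ne_zero 2 (sub_ne_zero.2 hne))]

theorem tendsto_punctured {f : ℂ → ℂ} (h : IsSaddleAt α β ξ a ρ)
    (hf : DifferentiableOn ℂ f (ball a ρ)) : Tendsto f (𝓝[≠] (a : ℂ)) (𝓝 (f a)) :=
  ((hf.differentiableAt (ball_mem_nhds _ h.ρ_pos)).continuousAt.tendsto).mono_left nhdsWithin_le_nhds

theorem eventually_punctured (h : IsSaddleAt α β ξ a ρ) :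
    ∀ᶠ u in 𝓝[≠] (a : ℂ), u ∈ ball (a : ℂ) ρ ∧ u ≠ a := by
  filter_upwards [nhdsWithin_le_nhds (ball_mem_nhds (a : ℂ) h.ρ_pos), self_mem_nhdsWithin] with u h1 h2
  exact ⟨h1, h2⟩

theorem quarter_le_re_saddleH (h : IsSaddleAt α β ξ a ρ) {u : ℂ} (hu : u ∈ ball (a : ℂ) ρ) :
    1 / 4 ≤ (saddleH α β ξ a u).re := by
  have key : ∀ u ∈ ball (a : ℂ) ρ, u ≠ a → 1 / 4 ≤ (saddleH α β ξ a u).re := by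
    intro u hu hne
    have := half_mul_le_re_divided_difference h.hasDerivAt_phaseC'
      (fun z hz => h.half_le_re_phaseK hz) hu hne
    rw [h.saddleH_of_ne hne]
    linarith
  by_cases hne : u = a
  · subst hne
    refine ge_of_tendsto ((Complex.continuous_re.tendsto _).comp
      (h.tendsto_punctured h.differentiableOn_saddleH)) ?_
    filter_upwards [h.eventually_punctured] with z hz using key z hz.1 hz.2
  · exact key u hu hne

theorem norm_saddleH_le (h : IsSaddleAt α β ξ a ρ) (hM : ∀ u ∈ ball (a : ℂ) ρ, ‖phaseK α β ξ a u‖ ≤ M)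
    {u : ℂ} (hu : u ∈ ball (a : ℂ) ρ) : ‖saddleH α β ξ a u‖ ≤ M := by
  have key : ∀ u ∈ ball (a : ℂ) ρ, u ≠ a → ‖saddleH α β ξ a u‖ ≤ M := by
    intro u hu hne
    rw [h.saddleH_of_ne hne]
    exact norm_divided_difference_le h.hasDerivAt_phaseC' hM hu hne
  by_cases hne : u = a
  · subst hne
    refine le_of_tendsto ((h.tendsto_punctured h.differentiableOn_saddleH).norm) ?_
    filter_upwards [h.eventually_punctured] with z hz using key z hz.1 hz.2
  · exact key u hu hne

theorem re_two_mul_saddleH_pos (h : IsSaddleAt α β ξ a ρ) {u : ℂ} (hu : u ∈ ball (a : ℂ) ρ) :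
    0 < (2 * saddleH α β ξ a u).re := by
  have := h.quarter_le_re_saddleH hu
  simp; linarith

theorem saddleS_sq (α β ξ a : ℝ) (u : ℂ) : saddleS α β ξ a u ^ 2 = 2 * saddleH α β ξ a u :=
  cpow_half_sq _

theorem re_saddleS_pos (h : IsSaddleAt α β ξ a ρ) {u : ℂ} (hu : u ∈ ball (a : ℂ) ρ) :
    0 < (saddleS α β ξ a u).re := re_cpow_half_pos (h.re_two_mul_saddleH_pos hu)

theorem half_le_norm_saddleS (h : IsSaddleAt α β ξ a ρ) {u : ℂ} (hu : u ∈ ball (a : ℂ) ρ) :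
    1 / 2 ≤ ‖saddleS α β ξ a u‖ := by
  have h1 := (h.quarter_le_re_saddleH hu).trans (Complex.re_le_norm _)
  have h2 := congrArg norm (saddleS_sq α β ξ a u)
  rw [norm_pow, norm_mul, Complex.norm_ofNat] at h2
  nlinarith [norm_nonneg (saddleS α β ξ a u)]

theorem saddleS_ne_zero (h : IsSaddleAt α β ξ a ρ) {u : ℂ} (hu : u ∈ ball (a : ℂ) ρ) :
    saddleS α β ξ a u ≠ 0 := by
  rw [← norm_pos_iff]; linarith [h.half_le_norm_saddleS hu]

theorem norm_saddleS_le (h : IsSaddleAt α β ξ a ρ) (hM : ∀ u ∈ ball (a : ℂ) ρ, ‖phaseK α β ξ a u‖ ≤ M)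
    {u : ℂ} (hu : u ∈ ball (a : ℂ) ρ) : ‖saddleS α β ξ a u‖ ≤ 2 * M := by
  have h1 := h.norm_saddleH_le hM hu
  have h2 := congrArg norm (saddleS_sq α β ξ a u)
  have h3 := ((h.half_le_re_phaseK hu).trans (Complex.re_le_norm _)).trans (hM u hu)
  rw [norm_pow, norm_mul, Complex.norm_ofNat] at h2
  nlinarith [norm_nonneg (saddleS α β ξ a u)]

theorem differentiableOn_saddleS (h : IsSaddleAt α β ξ a ρ) :
    DifferentiableOn ℂ (saddleS α β ξ a) (ball a ρ) :=
  (h.differentiableOn_saddleH.const_mul 2).cpow_const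
    (fun _ hu => Or.inl (h.re_two_mul_saddleH_pos hu))

theorem differentiableOn_saddleW (h : IsSaddleAt α β ξ a ρ) :
    DifferentiableOn ℂ (saddleW α β ξ a) (ball a ρ) :=
  (differentiableOn_id.sub_const _).mul h.differentiableOn_saddleS

theorem saddleW_sq (h : IsSaddleAt α β ξ a ρ) (u : ℂ) :
    saddleW α β ξ a u ^ 2 / 2 = phaseC α β ξ u - phaseC α β ξ a := by
  rw [saddleW, mul_pow, saddleS_sq, ← h.sq_mul_saddleH]; ring

theorem differentiableOn_deriv_saddleW (h : IsSaddleAt α β ξ a ρ) :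
    DifferentiableOn ℂ (deriv (saddleW α β ξ a)) (ball a ρ) :=
  h.differentiableOn_saddleW.deriv isOpen_ball

theorem differentiableOn_phaseK (h : IsSaddleAt α β ξ a ρ) :
    DifferentiableOn ℂ (phaseK α β ξ a) (ball a ρ) := by
  intro u hu
  have hu0 := Complex.slitPlane_ne_zero (h.mem_slitPlane hu).1
  have hu1 := Complex.slitPlane_ne_zero (h.mem_slitPlane hu).2
  have ha : (a : ℂ) ≠ 0 := by exact_mod_cast h.pos.ne'
  have ha1 : ((1 - a : ℝ) : ℂ) ≠ 0 := by exact_mod_cast (sub_pos.2 h.lt_one).ne'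
  have e1 := mul_ne_zero hu0 ha
  have e2 := mul_ne_zero hu1 ha1
  have e3 := mul_ne_zero (pow_ne_zero 2 hu0) (pow_ne_zero 2 ha)
  unfold phaseK
  apply DifferentiableAt.differentiableWithinAt
  fun_prop (disch := assumption)

/-- Differentiating `W² / 2 = φ - φ(a)` gives `W W' = (u - a) K`; cancel `u - a`, then pass to the
limit at `u = a`. -/
theorem saddleS_mul_deriv_saddleW (h : IsSaddleAt α β ξ a ρ) {u : ℂ} (hu : u ∈ ball (a : ℂ) ρ) :
    saddleS α β ξ a u * deriv (saddleW α β ξ a) u = phaseK α β ξ a u := by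
  have key : ∀ u ∈ ball (a : ℂ) ρ, u ≠ a →
      saddleS α β ξ a u * deriv (saddleW α β ξ a) u = phaseK α β ξ a u := by
    intro u hu hne
    have h1 := (h.differentiableOn_saddleW.differentiableAt (isOpen_ball.mem_nhds hu)).hasDerivAt
    have h2 := (h1.pow 2).div_const 2
    have h3 := (h.hasDerivAt_phaseC' u hu).sub_const (phaseC α β ξ a)
    have h4 : (fun u => (saddleW α β ξ a ^ 2) u / 2) = fun u => phaseC α β ξ u - phaseC α β ξ a := by
      funext z; exact h.saddleW_sq z
    rw [h4] at h2
    have h5 := h2.unique h3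
    have hz : u - a ≠ 0 := sub_ne_zero.2 hne
    apply mul_left_cancel₀ hz
    rw [← h5, saddleW]
    norm_num
    ring
  by_cases hne : u = a
  · subst hne
    refine tendsto_nhds_unique_of_eventuallyEq
      ((h.tendsto_punctured h.differentiableOn_saddleS).mul
        (h.tendsto_punctured h.differentiableOn_deriv_saddleW))
      (h.tendsto_punctured h.differentiableOn_phaseK) ?_
    filter_upwards [h.eventually_punctured] with z hz using key z hz.1 hz.2
  · exact key u hu hne

theorem norm_deriv_saddleW_le (h : IsSaddleAt α β ξ a ρ)
    (hM : ∀ u ∈ ball (a : ℂ) ρ, ‖phaseK α β ξ a u‖ ≤ M) {u : ℂ} (hu : u ∈ ball (a : ℂ) ρ) :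
    ‖deriv (saddleW α β ξ a) u‖ ≤ 2 * M := by
  have h1 := congrArg norm (h.saddleS_mul_deriv_saddleW hu)
  have h2 := h.half_le_norm_saddleS hu
  rw [norm_mul] at h1
  nlinarith [hM u hu, norm_nonneg (deriv (saddleW α β ξ a) u)]

theorem phaseK_ne_zero (h : IsSaddleAt α β ξ a ρ) {u : ℂ} (hu : u ∈ ball (a : ℂ) ρ) :
    phaseK α β ξ a u ≠ 0 := by
  intro h0
  have := h.half_le_re_phaseK hu
  rw [h0] at this; norm_num at this

/-- For `0 < b ≤ 1`, `|b + i v| ≥ b √(1 + v²)`; apply this with `b = a` and `b = 1 - a`, weighted by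
`α + β = 1`. The real part of `ξ / u` is largest at `v = 0`. The bound holds on the whole line, so
the vertical line itself serves as descent path. -/
theorem re_phaseC_sub_le (h : IsSaddleAt α β ξ a ρ) (v : ℝ) :
    (phaseC α β ξ (vline a v) - phaseC α β ξ a).re ≤ -(log (1 + v ^ 2) / 2) := by
  have h0 := h.pos
  have h1 : 0 < 1 - a := sub_pos.2 h.lt_one
  have hlog : ∀ b : ℝ, 0 < b → b ≤ 1 → log b + log (1 + v ^ 2) / 2 ≤ log √(b ^ 2 + v ^ 2) := by
    intro b hb hb1
    have : log b + log (1 + v ^ 2) / 2 = log √(b ^ 2 * (1 + v ^ 2)) := by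
      rw [Real.log_sqrt (by positivity), Real.log_mul (by positivity) (by positivity), Real.log_pow]
      push_cast; ring
    rw [this]
    apply Real.log_le_log (Real.sqrt_pos.2 (by positivity))
    apply Real.sqrt_le_sqrt
    nlinarith [mul_le_of_le_one_left (sq_nonneg v) (pow_le_one₀ hb.le hb1 (n := 2))]
  have e1 := hlog a h0 h.lt_one.le
  have e2 := hlog (1 - a) h1 (by linarith)
  have r1 : ∀ (z : ℂ), (phaseC α β ξ z).re = -α * log ‖z‖ - β * log ‖1 - z‖ + ξ * (z.re / Complex.normSq z) := by
    intro z
    rw [phaseC, Complex.add_re, Complex.sub_re, ← Complex.ofReal_neg, Complex.re_ofReal_mul,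
      Complex.re_ofReal_mul, div_eq_mul_inv, Complex.re_ofReal_mul, Complex.inv_re,
      Complex.log_re, Complex.log_re]
  have n1 : ‖(1 : ℂ) - a‖ = 1 - a := by
    rw [← Complex.ofReal_one, ← Complex.ofReal_sub, Complex.norm_real, norm_of_nonneg h1.le]
  have e3 : a / (a * a + v * v) ≤ a / (a * a) := by
    gcongr; nlinarith
  rw [Complex.sub_re, r1, r1, norm_vline, norm_one_sub_vline, n1, Complex.norm_real,
    norm_of_nonneg h0.le, Complex.normSq_apply, Complex.normSq_apply, vline_re, vline_im,
    Complex.ofReal_re, Complex.ofReal_im, mul_zero, add_zero]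
  have m1 := mul_le_mul_of_nonneg_left e1 h.α_nonneg
  have m2 := mul_le_mul_of_nonneg_left e2 h.β_nonneg
  have m3 := mul_le_mul_of_nonneg_left e3 h.ξ_nonneg
  have : α * (log (1 + v ^ 2) / 2) + β * (log (1 + v ^ 2) / 2) = log (1 + v ^ 2) / 2 := by
    rw [← add_mul, h.add_eq_one, one_mul]
  linarith

theorem vline_mem_ball {v : ℝ} (hv : |v| < ρ) : vline a v ∈ ball (a : ℂ) ρ := by
  rw [mem_ball, dist_eq_norm]
  have : vline a v - a = v * Complex.I := by unfold vline; ring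
  rw [this, norm_mul, Complex.norm_I, mul_one, Complex.norm_real]
  exact hv

theorem vline_mem_ball' (h : IsSaddleAt α β ξ a ρ) {v : ℝ} (hv : v ∈ Icc (-(ρ / 2)) (ρ / 2)) :
    vline a v ∈ ball (a : ℂ) ρ :=
  vline_mem_ball ((abs_le.2 hv).trans_lt (half_lt_self h.ρ_pos))

/-- The descent bound gives `Re W² ≤ -log (1 + v²) ≤ -v² / 2` for `|v| ≤ 1`, and `W = i v S` with
`Re S > 0` fixes the half planes of the endpoints. -/
theorem isSaddlePath (h : IsSaddleAt α β ξ a ρ)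
    (hM : ∀ u ∈ ball (a : ℂ) ρ, ‖phaseK α β ξ a u‖ ≤ M) :
    IsSaddlePath (ρ / 2) (2 * M) (fun v => saddleW α β ξ a (vline a v))
      (fun v => deriv (saddleW α β ξ a) (vline a v) * Complex.I) where
  hasDerivAt v hv :=
    (h.differentiableOn_saddleW.differentiableAt
      (isOpen_ball.mem_nhds (h.vline_mem_ball' hv))).hasDerivAt.comp v (hasDerivAt_vline a v)
  continuousOn := by
    refine ContinuousOn.mul ?_ continuousOn_const
    exact h.differentiableOn_deriv_saddleW.continuousOn.comp (continuous_vline a).continuousOn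
      (fun v hv => h.vline_mem_ball' hv)
  re_sq_le v hv := by
    have h1 := h.re_phaseC_sub_le v
    rw [← h.saddleW_sq] at h1
    have hv1 : v ^ 2 ≤ 1 := by
      have := h.ρ_le; have := h.lt_one
      rw [sq_le_one_iff_abs_le_one]
      exact (abs_le.2 hv).trans (by linarith)
    have h2 := Real.one_sub_inv_le_log_of_pos (show 0 < 1 + v ^ 2 by positivity)
    have h3 : v ^ 2 / 2 ≤ 1 - (1 + v ^ 2)⁻¹ := by
      have : 1 - (1 + v ^ 2)⁻¹ = v ^ 2 / (1 + v ^ 2) := by field_simp; ring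
      rw [this]
      gcongr; linarith
    rw [Complex.div_ofNat_re] at h1
    linarith
  norm_le v hv := by
    have h1 := h.norm_saddleS_le hM (h.vline_mem_ball' hv)
    have : vline a v - a = v * Complex.I := by unfold vline; ring
    rw [saddleW, this, norm_mul, norm_mul, Complex.norm_I, mul_one, Complex.norm_real, norm_eq_abs,
      mul_comm]
    gcongr
  norm_deriv_le v hv := by
    rw [norm_mul, Complex.norm_I, mul_one]
    exact h.norm_deriv_saddleW_le hM (h.vline_mem_ball' hv)
  im_pos := by
    have hρ := h.ρ_pos
    have h1 := h.re_saddleS_pos (h.vline_mem_ball' (v := ρ / 2) ⟨by linarith, le_rfl⟩)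
    have : vline a (ρ / 2) - a = (ρ / 2 : ℝ) * Complex.I := by unfold vline; ring
    rw [saddleW, this, mul_assoc, Complex.im_ofReal_mul, Complex.I_mul_im]
    positivity
  im_neg := by
    have hρ := h.ρ_pos
    have h1 := h.re_saddleS_pos (h.vline_mem_ball' (v := -(ρ / 2)) ⟨le_rfl, by linarith⟩)
    have : vline a (-(ρ / 2)) - a = (-(ρ / 2) : ℝ) * Complex.I := by unfold vline; ring
    rw [saddleW, this, mul_assoc, Complex.im_ofReal_mul, Complex.I_mul_im]
    have : 0 < ρ / 2 * (saddleS α β ξ a (vline a (-(ρ / 2)))).re := by positivity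
    linarith

end IsSaddleAt

/-- The functions obtained from `G` by repeatedly subtracting the value at `a` and dividing by
`(u - a) S(u)`. Their values at `a` are the coefficients of the expansion of `G` in powers of
`(u - a) S(u)`. -/
noncomputable def reducedSeq (S G : ℂ → ℂ) (a : ℂ) : ℕ → ℂ → ℂ
  | 0 => G
  | k + 1 => fun u => dslope (reducedSeq S G a k) a u / S u

theorem differentiableOn_reducedSeq {S G : ℂ → ℂ} {a : ℂ} {ρ : ℝ} (hρ : 0 < ρ)
    (hS : DifferentiableOn ℂ S (ball a ρ)) (hG : DifferentiableOn ℂ G (ball a ρ))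
    (hS0 : ∀ u ∈ ball a ρ, S u ≠ 0) (k : ℕ) :
    DifferentiableOn ℂ (reducedSeq S G a k) (ball a ρ) := by
  induction k with
  | zero => exact hG
  | succ k ih =>
    exact ((Complex.differentiableOn_dslope (ball_mem_nhds a hρ)).2 ih).div hS hS0

/-- By the Schwarz lemma a divided difference costs a factor `2 / ρ`, and dividing by `S` costs
another `2`. Both the coefficients and the remainder are thereby bounded uniformly. -/
theorem norm_reducedSeq_le {S G : ℂ → ℂ} {a : ℂ} {ρ M : ℝ} (hρ : 0 < ρ)
    (hS : DifferentiableOn ℂ S (ball a ρ)) (hG : DifferentiableOn ℂ G (ball a ρ))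
    (hS0 : ∀ u ∈ ball a ρ, 1 / 2 ≤ ‖S u‖) (hM : ∀ u ∈ ball a ρ, ‖G u‖ ≤ M) (k : ℕ) :
    ∀ u ∈ ball a ρ, ‖reducedSeq S G a k u‖ ≤ M * (4 / ρ) ^ k := by
  have hS0' : ∀ u ∈ ball a ρ, S u ≠ 0 := fun u hu => by
    rw [← norm_pos_iff]; linarith [hS0 u hu]
  induction k with
  | zero => simpa [reducedSeq] using hM
  | succ k ih =>
    intro u hu
    have h1 : MapsTo (reducedSeq S G a k) (ball a ρ)
        (closedBall (reducedSeq S G a k a) (2 * (M * (4 / ρ) ^ k))) := by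
      intro z hz
      rw [mem_closedBall, dist_eq_norm]
      refine (norm_sub_le _ _).trans ?_
      linarith [ih z hz, ih a (mem_ball_self hρ)]
    have h2 := Complex.norm_dslope_le_div_of_mapsTo_ball
      (differentiableOn_reducedSeq hρ hS hG hS0' k) h1 hu
    have h3 := hS0 u hu
    rw [reducedSeq, norm_div, div_le_iff₀ (by linarith)]
    refine h2.trans ?_
    have h4 : 0 ≤ M * (4 / ρ) ^ (k + 1) := by
      have := (norm_nonneg _).trans (hM a (mem_ball_self hρ))
      positivity
    calc _ = M * (4 / ρ) ^ (k + 1) * (1 / 2) := by rw [pow_succ]; field_simp; ring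
      _ ≤ _ := by gcongr

theorem reducedSeq_expansion {S G : ℂ → ℂ} {a u : ℂ} (hS0 : S u ≠ 0) (n : ℕ) :
    G u = ∑ k ∈ Finset.range n, reducedSeq S G a k a * ((u - a) * S u) ^ k +
      ((u - a) * S u) ^ n * reducedSeq S G a n u := by
  induction n with
  | zero => simp [reducedSeq]
  | succ n ih =>
    have h1 : reducedSeq S G a n u = reducedSeq S G a n a +
        ((u - a) * S u) * reducedSeq S G a (n + 1) u := by
      have := sub_smul_dslope (reducedSeq S G a n) a u
      rw [smul_eq_mul] at this
      rw [reducedSeq, mul_assoc, mul_div_cancel₀ _ hS0, this]; ring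
    rw [Finset.sum_range_succ]
    conv_lhs => rw [ih, h1]
    ring

end ComplexPhase

/-! ### Uniform asymptotics of the integral over the vertical line. -/

section SaddleIntegral

open Filter Topology Metric MeasureTheory

/-- The function `1 / ((u - y) W'(u))`, where `W` is the uniformizing variable `saddleW`. -/
noncomputable def saddleG (α β ξ a y : ℝ) (u : ℂ) : ℂ :=
  saddleS α β ξ a u / (phaseK α β ξ a u * (u - y))

/-- The coefficients of the expansion of `saddleG` in powers of `saddleW`. -/
noncomputable def saddleCoeff (α β ξ a y : ℝ) (k : ℕ) : ℂ :=
  reducedSeq (saddleS α β ξ a) (saddleG α β ξ a y) a k a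

theorem sum_range_two_mul_gaussMoment (r : ℝ) (c : ℕ → ℂ) (N : ℕ) :
    ∑ k ∈ Finset.range (2 * N), c k * gaussMoment r k = Complex.I * √(2 * π / r) *
      ∑ k ∈ Finset.range N, c (2 * k) *
        (((-1) ^ k * (2 ^ k * (ascPochhammer ℝ k).eval (1 / 2)) / r ^ k : ℝ) : ℂ) := by
  induction N with
  | zero => simp
  | succ N ih =>
    rw [show 2 * (N + 1) = 2 * N + 1 + 1 by ring, Finset.sum_range_succ, Finset.sum_range_succ, ih,
      Finset.sum_range_succ, gaussMoment_odd, gaussMoment_even]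
    ring

namespace IsSaddleAt

variable {α β ξ a ρ M y b : ℝ}

theorem half_le_norm_sub (_h : IsSaddleAt α β ξ a ρ) (hb : 2 * ρ ≤ b) (hy : b ≤ a - y) {u : ℂ}
    (hu : u ∈ ball (a : ℂ) ρ) : b / 2 ≤ ‖u - y‖ := by
  rw [mem_ball, dist_eq_norm] at hu
  have h1 := norm_sub_norm_le ((a - y : ℝ) : ℂ) (-(u - a))
  rw [show ((a - y : ℝ) : ℂ) - -(u - a) = u - y by push_cast; ring, norm_neg,
    Complex.norm_real, norm_eq_abs] at h1
  have h2 := le_abs_self (a - y)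
  linarith

theorem sub_ne_zero_of_mem (h : IsSaddleAt α β ξ a ρ) (hb : 2 * ρ ≤ b) (hy : b ≤ a - y) {u : ℂ}
    (hu : u ∈ ball (a : ℂ) ρ) : u - y ≠ 0 := by
  rw [← norm_pos_iff]; linarith [h.half_le_norm_sub hb hy hu, h.ρ_pos]

theorem differentiableOn_saddleG (h : IsSaddleAt α β ξ a ρ) (hb : 2 * ρ ≤ b) (hy : b ≤ a - y) :
    DifferentiableOn ℂ (saddleG α β ξ a y) (ball a ρ) :=
  h.differentiableOn_saddleS.div (h.differentiableOn_phaseK.mul (differentiableOn_id.sub_const _))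
    fun _ hu => mul_ne_zero (h.phaseK_ne_zero hu) (h.sub_ne_zero_of_mem hb hy hu)

theorem norm_saddleG_le (h : IsSaddleAt α β ξ a ρ) (hM : ∀ u ∈ ball (a : ℂ) ρ, ‖phaseK α β ξ a u‖ ≤ M)
    (hb : 2 * ρ ≤ b) (hy : b ≤ a - y) {u : ℂ} (hu : u ∈ ball (a : ℂ) ρ) :
    ‖saddleG α β ξ a y u‖ ≤ 8 * M / b := by
  have h1 := h.norm_saddleS_le hM hu
  have h2 := h.half_le_norm_sub hb hy hu
  have h3 := (h.half_le_re_phaseK hu).trans (Complex.re_le_norm _)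
  have hb0 : 0 < b := by linarith [h.ρ_pos]
  have hM0 : 0 ≤ M := (norm_nonneg _).trans (hM u hu)
  rw [saddleG, norm_div, norm_mul]
  calc _ ≤ 2 * M / (1 / 2 * (b / 2)) := by gcongr
    _ = 8 * M / b := by field_simp; ring

theorem saddleG_mul_deriv (h : IsSaddleAt α β ξ a ρ) (hb : 2 * ρ ≤ b) (hy : b ≤ a - y) {u : ℂ}
    (hu : u ∈ ball (a : ℂ) ρ) : saddleG α β ξ a y u * deriv (saddleW α β ξ a) u = (u - y)⁻¹ := by
  have h1 := h.saddleS_mul_deriv_saddleW hu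
  have h2 := h.phaseK_ne_zero hu
  have h3 := h.sub_ne_zero_of_mem hb hy hu
  rw [saddleG, div_mul_eq_mul_div, h1]
  field_simp

theorem norm_exp_phaseC_le (h : IsSaddleAt α β ξ a ρ) {r : ℝ} (hr : 0 ≤ r) (v : ℝ) :
    ‖Complex.exp (r * (phaseC α β ξ (vline a v) - phaseC α β ξ a))‖ ≤
      exp (-(r / 2 * log (1 + v ^ 2))) := by
  rw [Complex.norm_exp, exp_le_exp, Complex.re_ofReal_mul]
  nlinarith [mul_le_mul_of_nonneg_left (h.re_phaseC_sub_le v) hr]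

theorem continuous_phaseC_vline (h : IsSaddleAt α β ξ a ρ) :
    Continuous fun v => phaseC α β ξ (vline a v) := by
  rw [continuous_iff_continuousAt]
  intro v
  exact (h.hasDerivAt_phaseC (vline_mem_slitPlane h.pos v)
    (one_sub_vline_mem_slitPlane h.lt_one v)).continuousAt.comp (continuous_vline a).continuousAt

end IsSaddleAt

/-- Split `(1 + v²) ^ (-r/2)` as `(1 + v²)⁻¹ (1 + v²) ^ (1 - r/2)`: the first factor is integrable
and the second is maximal at `|v| = ρ` in the tail, whence the extra `exp (log (1 + ρ²))`. -/
theorem norm_tail_integral_le {F : ℝ → ℂ} {r b ρ : ℝ} (hr : 2 ≤ r) (hb : 0 < b) (hρ : 0 < ρ)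
    (hF : Continuous F) (hle : ∀ v, ‖F v‖ ≤ exp (-(r / 2 * log (1 + v ^ 2))) * b⁻¹) :
    ‖(∫ v, F v) - ∫ v in (-ρ)..ρ, F v‖ ≤
      π / b * exp (log (1 + ρ ^ 2)) * exp (-(r * (log (1 + ρ ^ 2) / 2))) := by
  set η := log (1 + ρ ^ 2) with hη
  have hlog : ∀ v : ℝ, 0 ≤ log (1 + v ^ 2) := fun v => Real.log_nonneg (by nlinarith [sq_nonneg v])
  have hinv : ∀ v : ℝ, exp (-log (1 + v ^ 2)) = (1 + v ^ 2)⁻¹ := fun v => by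
    rw [Real.exp_neg, Real.exp_log (by positivity)]
  have hFi : Integrable F := by
    refine (integrable_inv_one_add_sq.mul_const b⁻¹).mono' hF.aestronglyMeasurable
      (Eventually.of_forall fun v => (hle v).trans ?_)
    rw [← hinv]
    gcongr
    nlinarith [hlog v]
  have hsplit := integral_add_compl (measurableSet_Ioc (a := -ρ) (b := ρ)) hFi
  rw [intervalIntegral.integral_of_le (by linarith), ← hsplit, add_sub_cancel_left]
  set c := exp η * exp (-(r * (η / 2))) * b⁻¹ with hc
  have hc0 : 0 ≤ c := by positivity
  have hgi : Integrable fun v : ℝ => c * (1 + v ^ 2)⁻¹ := integrable_inv_one_add_sq.const_mul c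
  calc ‖∫ v in (Ioc (-ρ) ρ)ᶜ, F v‖ ≤ ∫ v in (Ioc (-ρ) ρ)ᶜ, c * (1 + v ^ 2)⁻¹ := by
        apply norm_integral_le_of_norm_le hgi.integrableOn
        filter_upwards [ae_restrict_mem measurableSet_Ioc.compl] with v hv
        have hv2 : ρ ^ 2 ≤ v ^ 2 := by
          rw [mem_compl_iff, mem_Ioc, not_and_or, not_lt, not_le] at hv
          rcases hv with hv | hv <;> nlinarith
        have hηv : η ≤ log (1 + v ^ 2) := Real.log_le_log (by positivity) (by linarith)
        refine (hle v).trans ?_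
        rw [← hinv, hc, mul_right_comm, ← exp_add, ← exp_add]
        gcongr
        nlinarith
    _ ≤ ∫ v : ℝ, c * (1 + v ^ 2)⁻¹ :=
        setIntegral_le_integral hgi (Eventually.of_forall fun v => by positivity)
    _ = _ := by
        rw [integral_const_mul, integral_univ_inv_one_add_sq, hc]
        ring

theorem exists_norm_saddle_integral_sub_le {b X : ℝ} (hb : 0 < b) (hX : 0 ≤ X) (N : ℕ) :
    ∃ C, 0 ≤ C ∧ ∀ r : ℝ, 2 ≤ r → ∀ α β ξ a y : ℝ, IsSaddleAt α β ξ a (b / 8) → ξ ≤ X →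
      b ≤ a → b ≤ 1 - a → b ≤ a - y →
      ‖(∫ v, Complex.exp (r * (phaseC α β ξ (vline a v) - phaseC α β ξ a)) * (vline a v - y)⁻¹) -
        √(2 * π / r) * ∑ k ∈ Finset.range N, saddleCoeff α β ξ a y (2 * k) *
        (((-1) ^ k * (2 ^ k * (ascPochhammer ℝ k).eval (1 / 2)) / r ^ k : ℝ) : ℂ)‖ ≤
      C / (√r * r ^ N) := by
  set M₁ := 2 / b ^ 2 + 3 * X / b ^ 3 with hM₁
  have hM₁0 : 0 ≤ M₁ := by positivity
  set B : ℕ → ℝ := fun k => 8 * M₁ / b * (4 / (b / 8)) ^ k with hB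
  have hB0 : ∀ k, 0 ≤ B k := fun k => by positivity
  -- A single constant that dominates the path bounds as well as all coefficients and the remainder
  -- up to index `2N`.
  set M := 2 * M₁ + ∑ k ∈ Finset.range (2 * N + 1), B k with hM
  have hM0 : 0 ≤ M := add_nonneg (by positivity) (Finset.sum_nonneg fun k _ => hB0 k)
  have hBM : ∀ k ≤ 2 * N, B k ≤ M := fun k hk => by
    have := Finset.single_le_sum (f := B) (fun k _ => hB0 k)
      (Finset.mem_range.2 (Nat.lt_succ_of_le hk))
    linarith
  have hρ : 0 < b / 8 / 2 := by positivity
  obtain ⟨C, hC0, hC⟩ := exists_norm_saddlePath_integral_sub_le hρ hM0 N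
  set η := log (1 + (b / 8 / 2) ^ 2) with hη
  have hη0 : 0 < η := Real.log_pos (by nlinarith [pow_pos hρ 2])
  set D := π / b * exp η * (((N + 1).factorial : ℝ) / (η / 2) ^ (N + 1)) with hD
  refine ⟨C + D, by positivity, fun r hr α β ξ a y h hξ hba hba' hy => ?_⟩
  have hr0 : 0 < r := by linarith
  have hK : ∀ u ∈ ball (a : ℂ) (b / 8), ‖phaseK α β ξ a u‖ ≤ M₁ := fun u hu =>
    h.norm_phaseK_le hb hba hba' hξ hu
  have hb2 : 2 * (b / 8) ≤ b := by linarith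
  have hpath₁ := h.isSaddlePath hK
  have hpath : IsSaddlePath (b / 8 / 2) M (fun v => saddleW α β ξ a (vline a v))
      (fun v => deriv (saddleW α β ξ a) (vline a v) * Complex.I) :=
    { hpath₁ with
      norm_le := fun v hv => (hpath₁.norm_le v hv).trans (by
        gcongr
        linarith [Finset.sum_nonneg (s := Finset.range (2 * N + 1)) fun k _ => hB0 k])
      norm_deriv_le := fun v hv => (hpath₁.norm_deriv_le v hv).trans (by
        linarith [Finset.sum_nonneg (s := Finset.range (2 * N + 1)) fun k _ => hB0 k]) }
  have hred := norm_reducedSeq_le h.ρ_pos h.differentiableOn_saddleS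
    (h.differentiableOn_saddleG hb2 hy) (fun u hu => h.half_le_norm_saddleS hu)
    (fun u hu => h.norm_saddleG_le hK hb2 hy hu)
  have hredc := (differentiableOn_reducedSeq h.ρ_pos h.differentiableOn_saddleS
    (h.differentiableOn_saddleG hb2 hy) (fun u hu => h.saddleS_ne_zero hu) (2 * N)).continuousOn
  have hloc := hC r (by linarith) _ _ hpath (saddleCoeff α β ξ a y)
    (fun v => reducedSeq (saddleS α β ξ a) (saddleG α β ξ a y) a (2 * N) (vline a v))
    (fun k hk => (hred k a h.center_mem).trans (hBM k hk.le))
    (hredc.comp (continuous_vline a).continuousOn (fun v hv => h.vline_mem_ball' hv))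
    (fun v hv => (hred (2 * N) _ (h.vline_mem_ball' hv)).trans (hBM _ le_rfl))
  set F : ℝ → ℂ := fun v => Complex.exp (r * (phaseC α β ξ (vline a v) - phaseC α β ξ a)) *
    (vline a v - y)⁻¹ with hF
  have hya : y ≠ a := by intro h'; rw [h'] at hy; linarith
  have hFc : Continuous F := by
    have := h.continuous_phaseC_vline
    have := continuous_inv_vline_sub hya
    simp only [hF]
    fun_prop
  have hFle : ∀ v, ‖F v‖ ≤ exp (-(r / 2 * log (1 + v ^ 2))) * b⁻¹ := by
    intro v
    simp only [hF]
    rw [norm_mul]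
    gcongr
    · exact h.norm_exp_phaseC_le hr0.le v
    · exact (norm_inv_vline_sub_le hya v).trans (inv_anti₀ hb (hy.trans (le_abs_self _)))
  have htail := norm_tail_integral_le hr hb hρ hFc hFle
  -- The factor `I` comes from `du = I dv`; it cancels the one in the moments on the imaginary axis.
  have hlocF : Complex.I * ∫ v in (-(b / 8 / 2))..(b / 8 / 2), F v =
      ∫ v in (-(b / 8 / 2))..(b / 8 / 2), Complex.exp (r * saddleW α β ξ a (vline a v) ^ 2 / 2) *
        (∑ k ∈ Finset.range (2 * N), saddleCoeff α β ξ a y k * saddleW α β ξ a (vline a v) ^ k +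
          saddleW α β ξ a (vline a v) ^ (2 * N) *
            reducedSeq (saddleS α β ξ a) (saddleG α β ξ a y) a (2 * N) (vline a v)) *
        (deriv (saddleW α β ξ a) (vline a v) * Complex.I) := by
    rw [← intervalIntegral.integral_const_mul]
    apply intervalIntegral.integral_congr
    intro v hv
    rw [uIcc_of_le (by linarith)] at hv
    have hu := h.vline_mem_ball' hv
    have e1 := reducedSeq_expansion (G := saddleG α β ξ a y) (a := (a : ℂ)) (h.saddleS_ne_zero hu) (2 * N)
    have e2 := h.saddleG_mul_deriv hb2 hy hu
    have e3 := h.saddleW_sq (vline a v)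
    simp only [hF]
    rw [← e2, e1, ← e3, ← mul_div_assoc]
    simp only [saddleCoeff, saddleW]
    ring
  rw [← hlocF, sum_range_two_mul_gaussMoment, mul_assoc, ← mul_sub, norm_mul, Complex.norm_I,
    one_mul] at hloc
  have hexp : exp (-(r * (η / 2))) ≤ ((N + 1).factorial : ℝ) / (η / 2) ^ (N + 1) / (√r * r ^ N) := by
    refine (exp_neg_mul_le_inv_pow (by positivity) hr0 (N + 1)).trans ?_
    gcongr
    rw [pow_succ, mul_comm (r ^ N)]
    gcongr
    exact Real.sqrt_le_iff.2 ⟨hr0.le, by nlinarith⟩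
  have htail' : ‖(∫ v, F v) - ∫ v in (-(b / 8 / 2))..(b / 8 / 2), F v‖ ≤ D / (√r * r ^ N) := by
    refine htail.trans ?_
    rw [hD, mul_div_assoc]
    gcongr
  calc _ = ‖((∫ v, F v) - ∫ v in (-(b / 8 / 2))..(b / 8 / 2), F v) +
        ((∫ v in (-(b / 8 / 2))..(b / 8 / 2), F v) - √(2 * π / r) * ∑ k ∈ Finset.range N,
          saddleCoeff α β ξ a y (2 * k) *
        (((-1) ^ k * (2 ^ k * (ascPochhammer ℝ k).eval (1 / 2)) / r ^ k : ℝ) : ℂ))‖ := by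
        congr 1; ring
    _ ≤ D / (√r * r ^ N) + C / (√r * r ^ N) := (norm_add_le _ _).trans (add_le_add htail' hloc)
    _ = _ := by rw [← add_div, add_comm]

end SaddleIntegral

/-! ### Real analyticity of `w` and its inverse; the `f_k` as complex coefficients. -/

section Amplitude

open Filter Topology Metric

variable {θ ξ : ℝ}

theorem isSaddleAt_inv_saddle (hθ : θ ∈ Ioo 0 (π / 2)) (hξ : 0 ≤ ξ) {ρ : ℝ} (hρ : 0 < ρ)
    (h1 : 8 * ρ ≤ (saddle θ ξ)⁻¹) (h2 : 8 * ρ ≤ 1 - (saddle θ ξ)⁻¹) :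
    IsSaddleAt (cos θ ^ 2) (sin θ ^ 2) ξ (saddle θ ξ)⁻¹ ρ where
  α_nonneg := sq_nonneg _
  β_nonneg := sq_nonneg _
  add_eq_one := cos_sq_add_sin_sq θ
  ξ_nonneg := hξ
  ρ_pos := hρ
  ρ_le := h1
  ρ_le' := h2
  eq_zero := by
    obtain ⟨h1, h2⟩ := saddle_spec hθ hξ
    have h0 : saddle θ ξ ≠ 0 := by positivity
    have h3 : saddle θ ξ - 1 ≠ 0 := sub_ne_zero.2 h1.ne'
    have h4 : 1 - (saddle θ ξ)⁻¹ = (saddle θ ξ - 1) / saddle θ ξ := by field_simp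
    rw [h4, sin_sq]
    field_simp
    linear_combination -saddle θ ξ * h2

theorem exists_isSaddleAt (hθ : θ ∈ Ioo 0 (π / 2)) (hξ : 0 ≤ ξ) :
    ∃ ρ, IsSaddleAt (cos θ ^ 2) (sin θ ^ 2) ξ (saddle θ ξ)⁻¹ ρ := by
  have h1 := one_lt_saddle hθ hξ
  have h2 : 0 < (saddle θ ξ)⁻¹ := by positivity
  have h3 : (saddle θ ξ)⁻¹ < 1 := inv_lt_one_of_one_lt₀ h1
  refine ⟨min (saddle θ ξ)⁻¹ (1 - (saddle θ ξ)⁻¹) / 8, isSaddleAt_inv_saddle hθ hξ ?_ ?_ ?_⟩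
  · have := lt_min h2 (sub_pos.2 h3); positivity
  · rw [mul_div_cancel₀ _ (by norm_num)]; exact min_le_left _ _
  · rw [mul_div_cancel₀ _ (by norm_num)]; exact min_le_right _ _

theorem phaseC_inv {t : ℝ} (ht : 1 < t) :
    phaseC (cos θ ^ 2) (sin θ ^ 2) ξ ((t : ℂ)⁻¹) = phase θ ξ t := by
  have h0 : 0 < t := by linarith
  have h1 : 0 < t - 1 := by linarith
  have h2 : (1 : ℂ) - (t : ℂ)⁻¹ = (((t - 1) / t : ℝ) : ℂ) := by
    have : (t : ℂ) ≠ 0 := by exact_mod_cast h0.ne'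
    push_cast; field_simp
  rw [phaseC, h2, ← Complex.ofReal_inv, ← Complex.ofReal_log (by positivity),
    ← Complex.ofReal_log (by positivity), Real.log_inv, Real.log_div h1.ne' h0.ne', phase]
  push_cast
  have : (cos θ : ℂ) ^ 2 + (sin θ : ℂ) ^ 2 = 1 := by exact_mod_cast cos_sq_add_sin_sq θ
  rw [Complex.ofReal_cos, Complex.ofReal_sin] at *
  rw [div_inv_eq_mul]
  linear_combination (Real.log t : ℂ) * this

/-- The squares agree; since `W = (1/t - 1/t₀) S` with `Re S > 0`, the sign is opposite to that of
`t - t₀`. -/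
theorem saddleW_inv {ρ : ℝ} (hθ : θ ∈ Ioo 0 (π / 2)) (hξ : 0 ≤ ξ)
    (h : IsSaddleAt (cos θ ^ 2) (sin θ ^ 2) ξ (saddle θ ξ)⁻¹ ρ) {t : ℝ} (ht : 1 < t)
    (hu : (t : ℂ)⁻¹ ∈ ball (((saddle θ ξ)⁻¹ : ℝ) : ℂ) ρ) :
    saddleW (cos θ ^ 2) (sin θ ^ 2) ξ (saddle θ ξ)⁻¹ ((t : ℂ)⁻¹) = -(wOf θ ξ t : ℂ) := by
  have h1 := one_lt_saddle hθ hξ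
  have hsq := h.saddleW_sq ((t : ℂ)⁻¹)
  rw [phaseC_inv ht, Complex.ofReal_inv, phaseC_inv h1] at hsq
  have hw := wOf_sq hθ hξ ht
  have hsq' : saddleW (cos θ ^ 2) (sin θ ^ 2) ξ (saddle θ ξ)⁻¹ ((t : ℂ)⁻¹) ^ 2 =
      (-(wOf θ ξ t : ℂ)) ^ 2 := by
    rw [neg_sq, ← Complex.ofReal_pow, hw]
    push_cast
    linear_combination 2 * hsq
  have hS := h.re_saddleS_pos hu
  have hre : (saddleW (cos θ ^ 2) (sin θ ^ 2) ξ (saddle θ ξ)⁻¹ ((t : ℂ)⁻¹)).re =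
      (t⁻¹ - (saddle θ ξ)⁻¹) *
        (saddleS (cos θ ^ 2) (sin θ ^ 2) ξ (saddle θ ξ)⁻¹ ((t : ℂ)⁻¹)).re := by
    rw [saddleW, ← Complex.ofReal_inv, ← Complex.ofReal_sub, Complex.re_ofReal_mul]
  rcases sq_eq_sq_iff_eq_or_eq_neg.1 hsq' with e | e
  · exact e
  · rw [neg_neg] at e
    rw [e, Complex.ofReal_re] at hre
    rcases lt_trichotomy t (saddle θ ξ) with h' | h' | h'
    · have := wOf_neg hθ hξ ht h'
      have h3 : (saddle θ ξ)⁻¹ < t⁻¹ := (inv_lt_inv₀ (by linarith) (by linarith)).2 h'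
      have := mul_pos (sub_pos.2 h3) hS
      linarith
    · rw [e, h', wOf_saddle]; simp
    · have := wOf_pos hθ hξ h'
      have h3 : t⁻¹ < (saddle θ ξ)⁻¹ := (inv_lt_inv₀ (by linarith) (by linarith)).2 h'
      have := mul_neg_of_neg_of_pos (sub_neg.2 h3) hS
      linarith

theorem eventually_inv_mem_ball {ρ : ℝ} (hθ : θ ∈ Ioo 0 (π / 2)) (hξ : 0 ≤ ξ) (hρ : 0 < ρ) :
    ∀ᶠ t : ℝ in 𝓝 (saddle θ ξ), 1 < t ∧ (t : ℂ)⁻¹ ∈ ball (((saddle θ ξ)⁻¹ : ℝ) : ℂ) ρ := by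
  have h1 := one_lt_saddle hθ hξ
  have h0 : (saddle θ ξ : ℂ) ≠ 0 := by exact_mod_cast (by linarith : saddle θ ξ ≠ 0)
  have hc : Tendsto (fun t : ℝ => (t : ℂ)⁻¹) (𝓝 (saddle θ ξ)) (𝓝 (((saddle θ ξ)⁻¹ : ℝ) : ℂ)) := by
    rw [Complex.ofReal_inv]
    exact (Complex.continuous_ofReal.tendsto _).inv₀ h0
  exact (lt_mem_nhds h1).and (hc (ball_mem_nhds _ hρ))

theorem hasDerivAt_wOf {ρ : ℝ} (hθ : θ ∈ Ioo 0 (π / 2)) (hξ : 0 ≤ ξ)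
    (h : IsSaddleAt (cos θ ^ 2) (sin θ ^ 2) ξ (saddle θ ξ)⁻¹ ρ) {t : ℝ}
    (ht : ∀ᶠ t : ℝ in 𝓝 t, 1 < t ∧ (t : ℂ)⁻¹ ∈ ball (((saddle θ ξ)⁻¹ : ℝ) : ℂ) ρ) :
    ∃ D : ℝ, HasDerivAt (wOf θ ξ) D t ∧ (D : ℂ) =
      deriv (saddleW (cos θ ^ 2) (sin θ ^ 2) ξ (saddle θ ξ)⁻¹) ((t : ℂ)⁻¹) / (t : ℂ) ^ 2 := by
  obtain ⟨h1, hu⟩ := ht.self_of_nhds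
  have h0 : (t : ℂ) ≠ 0 := by exact_mod_cast (by linarith : t ≠ 0)
  set W := saddleW (cos θ ^ 2) (sin θ ^ 2) ξ (saddle θ ξ)⁻¹ with hW
  have e1 := (h.differentiableOn_saddleW.differentiableAt (isOpen_ball.mem_nhds hu)).hasDerivAt
  have e2 : HasDerivAt (fun z : ℂ => -W z⁻¹) (deriv W ((t : ℂ)⁻¹) / (t : ℂ) ^ 2) (t : ℂ) := by
    convert! (e1.comp (t : ℂ) (hasDerivAt_inv h0)).neg using 1
    ring
  have e3 := e2.real_of_complex
  have e4 := e2.comp_ofReal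
  have hev : (fun t : ℝ => -W (t : ℂ)⁻¹) =ᶠ[𝓝 t] fun t : ℝ => (wOf θ ξ t : ℂ) := by
    filter_upwards [ht] with s hs
    rw [hW, saddleW_inv hθ hξ h hs.1 hs.2, neg_neg]
  have e5 : HasDerivAt (wOf θ ξ) (deriv W ((t : ℂ)⁻¹) / (t : ℂ) ^ 2).re t := by
    refine e3.congr_of_eventuallyEq ?_
    filter_upwards [hev] with s hs
    rw [hs, Complex.ofReal_re]
  refine ⟨_, e5, ?_⟩
  have e6 := e4.congr_of_eventuallyEq hev.symm
  exact e5.ofReal_comp.unique e6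

theorem analyticAt_wOf (hθ : θ ∈ Ioo 0 (π / 2)) (hξ : 0 ≤ ξ) :
    AnalyticAt ℝ (wOf θ ξ) (saddle θ ξ) := by
  obtain ⟨ρ, h⟩ := exists_isSaddleAt hθ hξ
  have hev := eventually_inv_mem_ball hθ hξ h.ρ_pos
  obtain ⟨h1, hu⟩ := hev.self_of_nhds
  have h0 : (saddle θ ξ : ℂ) ≠ 0 := by exact_mod_cast (by linarith : saddle θ ξ ≠ 0)
  set W := saddleW (cos θ ^ 2) (sin θ ^ 2) ξ (saddle θ ξ)⁻¹ with hW
  have e1 : AnalyticAt ℂ W ((saddle θ ξ : ℂ)⁻¹) :=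
    h.differentiableOn_saddleW.analyticAt (isOpen_ball.mem_nhds hu)
  have e2 : AnalyticAt ℂ (fun z : ℂ => W z⁻¹) (saddle θ ξ : ℂ) := by
    have hi : AnalyticAt ℂ (fun z : ℂ => z⁻¹) (saddle θ ξ : ℂ) := analyticAt_inv h0
    exact e1.comp hi
  have e3 : AnalyticAt ℝ (fun z : ℂ => W z⁻¹) (Complex.ofRealCLM (saddle θ ξ)) := e2.restrictScalars
  have e4 : AnalyticAt ℝ (fun t : ℝ => -(W (t : ℂ)⁻¹).re) (saddle θ ξ) :=
    ((Complex.reCLM.analyticAt _).comp (e3.comp (Complex.ofRealCLM.analyticAt (saddle θ ξ)))).neg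
  refine e4.congr ?_
  filter_upwards [hev] with s hs
  rw [hW, saddleW_inv hθ hξ h hs.1 hs.2, Complex.neg_re, neg_neg, Complex.ofReal_re]

theorem deriv_wOf_saddle_pos (hθ : θ ∈ Ioo 0 (π / 2)) (hξ : 0 ≤ ξ) :
    0 < deriv (wOf θ ξ) (saddle θ ξ) := by
  obtain ⟨ρ, h⟩ := exists_isSaddleAt hθ hξ
  have hev := eventually_inv_mem_ball hθ hξ h.ρ_pos
  have h1 := one_lt_saddle hθ hξ
  obtain ⟨D, hD, hD'⟩ := hasDerivAt_wOf hθ hξ h hev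
  rw [hD.deriv]
  have hS : DifferentiableAt ℂ _ _ := h.differentiableOn_saddleS.differentiableAt
    (ball_mem_nhds _ h.ρ_pos)
  have e := ((hasDerivAt_id (((saddle θ ξ)⁻¹ : ℝ) : ℂ)).sub_const (((saddle θ ξ)⁻¹ : ℝ) : ℂ)).mul
    hS.hasDerivAt
  have hd : deriv (saddleW (cos θ ^ 2) (sin θ ^ 2) ξ (saddle θ ξ)⁻¹) (((saddle θ ξ)⁻¹ : ℝ) : ℂ) =
      saddleS (cos θ ^ 2) (sin θ ^ 2) ξ (saddle θ ξ)⁻¹ (((saddle θ ξ)⁻¹ : ℝ) : ℂ) := by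
    refine HasDerivAt.deriv ?_
    convert! e using 1
    simp
  rw [← Complex.ofReal_inv, hd] at hD'
  have hpos := h.re_saddleS_pos h.center_mem
  have : D = (saddleS (cos θ ^ 2) (sin θ ^ 2) ξ (saddle θ ξ)⁻¹ (((saddle θ ξ)⁻¹ : ℝ) : ℂ)).re /
      saddle θ ξ ^ 2 := by
    have := congrArg Complex.re hD'
    rwa [← Complex.ofReal_pow, Complex.div_ofReal_re, Complex.ofReal_re] at this
  rw [this]
  positivity

theorem tOf_wOf (hθ : θ ∈ Ioo 0 (π / 2)) (hξ : 0 ≤ ξ) {t : ℝ} (ht : 1 < t) :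
    tOf θ ξ (wOf θ ξ t) = t :=
  (bijOn_wOf hθ hξ).invOn_invFunOn.1 ht

theorem wOf_tOf (hθ : θ ∈ Ioo 0 (π / 2)) (hξ : 0 ≤ ξ) (w : ℝ) : wOf θ ξ (tOf θ ξ w) = w :=
  (bijOn_wOf hθ hξ).invOn_invFunOn.2 (mem_univ w)

theorem one_lt_tOf (hθ : θ ∈ Ioo 0 (π / 2)) (hξ : 0 ≤ ξ) (w : ℝ) : 1 < tOf θ ξ w :=
  (bijOn_wOf hθ hξ).surjOn.mapsTo_invFunOn (mem_univ w)

theorem tOf_zero (hθ : θ ∈ Ioo 0 (π / 2)) (hξ : 0 ≤ ξ) : tOf θ ξ 0 = saddle θ ξ := by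
  rw [← wOf_saddle θ ξ, tOf_wOf hθ hξ (one_lt_saddle hθ hξ)]

theorem eventually_tOf_wOf (hθ : θ ∈ Ioo 0 (π / 2)) (hξ : 0 ≤ ξ) {t : ℝ} (ht : 1 < t) :
    ∀ᶠ s in 𝓝 t, tOf θ ξ (wOf θ ξ s) = s := by
  filter_upwards [lt_mem_nhds ht] with s hs using tOf_wOf hθ hξ hs

theorem analyticAt_tOf (hθ : θ ∈ Ioo 0 (π / 2)) (hξ : 0 ≤ ξ) : AnalyticAt ℝ (tOf θ ξ) 0 := by
  have h := (analyticAt_comp_iff_of_deriv_ne_zero (g := tOf θ ξ) (analyticAt_wOf hθ hξ)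
    (deriv_wOf_saddle_pos hθ hξ).ne').1
    (analyticAt_id.congr ((eventually_tOf_wOf hθ hξ (one_lt_saddle hθ hξ)).mono fun _ hs => hs.symm))
  rwa [wOf_saddle] at h

theorem deriv_tOf_mul_deriv_wOf (hθ : θ ∈ Ioo 0 (π / 2)) (hξ : 0 ≤ ξ) {t D : ℝ} (ht : 1 < t)
    (hD : HasDerivAt (wOf θ ξ) D t) (hd : DifferentiableAt ℝ (tOf θ ξ) (wOf θ ξ t)) :
    deriv (tOf θ ξ) (wOf θ ξ t) * D = 1 :=
  ((hd.hasDerivAt.comp t hD).congr_of_eventuallyEq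
    ((eventually_tOf_wOf hθ hξ ht).mono fun _ hs => hs.symm)).unique (hasDerivAt_id t)

theorem analyticAt_amplitude (hθ : θ ∈ Ioo 0 (π / 2)) (hξ : 0 ≤ ξ) {y : ℝ}
    (hy : y * saddle θ ξ < 1) : AnalyticAt ℝ (amplitude θ ξ y) 0 := by
  have hT := analyticAt_tOf hθ hξ
  have h1 := one_lt_saddle hθ hξ
  have hne : tOf θ ξ 0 * (1 - y * tOf θ ξ 0) ≠ 0 := by
    rw [tOf_zero hθ hξ]
    exact mul_ne_zero (by linarith) (by linarith)
  exact (analyticAt_const.div (hT.mul (analyticAt_const.sub (analyticAt_const.mul hT))) hne).mul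
    hT.deriv

/-- From `w(t) = -W(1/t)` one gets `dw/dt = W'(u) / t²` with `u = 1/t`, so `f = t / ((1 - y t)
W'(u)) = 1 / ((u - y) W'(u))`. -/
theorem eventually_amplitude_wOf {ρ y b : ℝ} (hθ : θ ∈ Ioo 0 (π / 2)) (hξ : 0 ≤ ξ)
    (h : IsSaddleAt (cos θ ^ 2) (sin θ ^ 2) ξ (saddle θ ξ)⁻¹ ρ) (hb : 2 * ρ ≤ b)
    (hy : b ≤ (saddle θ ξ)⁻¹ - y) :
    ∀ᶠ t : ℝ in 𝓝 (saddle θ ξ), (amplitude θ ξ y (wOf θ ξ t) : ℂ) =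
      saddleG (cos θ ^ 2) (sin θ ^ 2) ξ (saddle θ ξ)⁻¹ y (t : ℂ)⁻¹ := by
  have hev := eventually_inv_mem_ball hθ hξ h.ρ_pos
  have hwc := (analyticAt_wOf hθ hξ).continuousAt.tendsto
  rw [wOf_saddle] at hwc
  filter_upwards [hev.eventually_nhds, hwc.eventually (analyticAt_tOf hθ hξ).eventually_analyticAt]
    with t ht hta
  obtain ⟨h1, hu⟩ := ht.self_of_nhds
  obtain ⟨D, hD, hD'⟩ := hasDerivAt_wOf hθ hξ h ht
  have hmul := deriv_tOf_mul_deriv_wOf hθ hξ h1 hD hta.differentiableAt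
  have hG := h.saddleG_mul_deriv hb hy hu
  have hy0 := h.sub_ne_zero_of_mem hb hy hu
  have h0 : (t : ℂ) ≠ 0 := by exact_mod_cast (by linarith : t ≠ 0)
  have hty : (1 : ℂ) - y * t ≠ 0 := by
    intro h'
    apply hy0
    field_simp
    linear_combination h'
  have hmulC : ((deriv (tOf θ ξ) (wOf θ ξ t) : ℝ) : ℂ) * D = 1 := by exact_mod_cast hmul
  have hDne : (D : ℂ) ≠ 0 := right_ne_zero_of_mul_eq_one hmulC
  rw [amplitude, tOf_wOf hθ hξ h1]
  push_cast
  apply mul_right_cancel₀ hDne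
  rw [mul_assoc, hmulC, hD', ← mul_div_assoc, hG]
  field_simp

/-- Both sides iterate "subtract the central value and divide by the variable"; the variables are
`w` and `W = -w`, so each round contributes a sign. -/
theorem eventually_iterate_dslope_amplitude {ρ y b : ℝ} (hθ : θ ∈ Ioo 0 (π / 2)) (hξ : 0 ≤ ξ)
    (h : IsSaddleAt (cos θ ^ 2) (sin θ ^ 2) ξ (saddle θ ξ)⁻¹ ρ) (hb : 2 * ρ ≤ b)
    (hy : b ≤ (saddle θ ξ)⁻¹ - y) (hyt : y * saddle θ ξ < 1) (k : ℕ) :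
    ∀ᶠ t : ℝ in 𝓝 (saddle θ ξ),
      ((((Function.swap dslope 0)^[k] (amplitude θ ξ y)) (wOf θ ξ t) : ℝ) : ℂ) =
      (-1) ^ k * reducedSeq (saddleS (cos θ ^ 2) (sin θ ^ 2) ξ (saddle θ ξ)⁻¹)
        (saddleG (cos θ ^ 2) (sin θ ^ 2) ξ (saddle θ ξ)⁻¹ y) ((saddle θ ξ)⁻¹ : ℝ) k (t : ℂ)⁻¹ := by
  set S := saddleS (cos θ ^ 2) (sin θ ^ 2) ξ (saddle θ ξ)⁻¹ with hS
  set G := saddleG (cos θ ^ 2) (sin θ ^ 2) ξ (saddle θ ξ)⁻¹ y with hG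
  have hp := (analyticAt_amplitude hθ hξ hyt).hasFPowerSeriesAt
  induction k with
  | zero =>
    filter_upwards [eventually_amplitude_wOf hθ hξ h hb hy] with t ht
    simpa [reducedSeq] using ht
  | succ k ih =>
    have h1 := one_lt_saddle hθ hξ
    have h0 : (saddle θ ξ : ℂ) ≠ 0 := by exact_mod_cast (by linarith : saddle θ ξ ≠ 0)
    have hev := eventually_inv_mem_ball hθ hξ h.ρ_pos
    have hwc := (analyticAt_wOf hθ hξ).continuousAt
    have c1 : ContinuousAt (fun t : ℝ => ((((Function.swap dslope 0)^[k + 1] (amplitude θ ξ y))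
        (wOf θ ξ t) : ℝ) : ℂ)) (saddle θ ξ) := by
      have := (hp.has_fpower_series_iterate_dslope_fslope (k + 1)).continuousAt
      apply Complex.continuous_ofReal.continuousAt.comp
      apply ContinuousAt.comp (g := (Function.swap dslope 0)^[k + 1] (amplitude θ ξ y))
        (f := wOf θ ξ) _ hwc
      rw [wOf_saddle]; exact this
    have c2 : ContinuousAt (fun t : ℝ => (-1) ^ (k + 1) * reducedSeq S G ((saddle θ ξ)⁻¹ : ℝ) (k + 1)
        (t : ℂ)⁻¹) (saddle θ ξ) := by
      have := (differentiableOn_reducedSeq h.ρ_pos h.differentiableOn_saddleS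
        (h.differentiableOn_saddleG hb hy) (fun u hu => h.saddleS_ne_zero hu) (k + 1)).differentiableAt
        (isOpen_ball.mem_nhds hev.self_of_nhds.2)
      apply continuousAt_const.mul
      apply ContinuousAt.comp (g := reducedSeq S G ((saddle θ ξ)⁻¹ : ℝ) (k + 1))
        (f := fun t : ℝ => (t : ℂ)⁻¹) this.continuousAt
      exact Complex.continuous_ofReal.continuousAt.inv₀ h0
    -- The quotients can be compared only off the saddle point; continuity of both sides supplies
    -- the value there.
    refine (c1.eventuallyEq_nhds_iff_eventuallyEq_nhdsNE c2).1 ?_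
    have ih0 := ih.self_of_nhds
    filter_upwards [nhdsWithin_le_nhds ih, nhdsWithin_le_nhds hev, self_mem_nhdsWithin]
      with t ht ⟨ht1, hu⟩ hne
    have hne : t ≠ saddle θ ξ := hne
    have hw : wOf θ ξ t ≠ 0 := by
      intro hw0
      rw [← wOf_saddle θ ξ] at hw0
      exact hne (injOn_wOf hθ hξ ht1 h1 hw0)
    have hu0 : (t : ℂ)⁻¹ ≠ (((saddle θ ξ)⁻¹ : ℝ) : ℂ) := by
      intro h'
      rw [Complex.ofReal_inv, inv_inj] at h'
      exact hne (by exact_mod_cast h')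
    have hW := saddleW_inv hθ hξ h ht1 hu
    rw [saddleW, ← hS] at hW
    rw [wOf_saddle] at ih0
    rw [Function.iterate_succ_apply', reducedSeq]
    change ((dslope ((Function.swap dslope 0)^[k] (amplitude θ ξ y)) 0 (wOf θ ξ t) : ℝ) : ℂ) = _
    beta_reduce
    rw [dslope_of_ne _ hw, dslope_of_ne _ hu0, slope_def_field, slope_def_field, sub_zero,
      div_div, hW, Complex.ofReal_div, Complex.ofReal_sub, ht, ih0, pow_succ]
    simp only [Complex.ofReal_inv, div_neg]
    ring

/-- The `k`-fold iterated `dslope` of an analytic function at the center is its `k`-th Taylor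
coefficient. For the even indices that enter the expansion the sign disappears. -/
theorem fCoeff_eq_saddleCoeff {ρ y b : ℝ} (hθ : θ ∈ Ioo 0 (π / 2)) (hξ : 0 ≤ ξ)
    (h : IsSaddleAt (cos θ ^ 2) (sin θ ^ 2) ξ (saddle θ ξ)⁻¹ ρ) (hb : 2 * ρ ≤ b)
    (hy : b ≤ (saddle θ ξ)⁻¹ - y) (hyt : y * saddle θ ξ < 1) (k : ℕ) :
    (fCoeff θ ξ y k : ℂ) =
      (-1) ^ k * saddleCoeff (cos θ ^ 2) (sin θ ^ 2) ξ (saddle θ ξ)⁻¹ y k := by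
  have h1 := (eventually_iterate_dslope_amplitude hθ hξ h hb hy hyt k).self_of_nhds
  rw [wOf_saddle, ← Complex.ofReal_inv] at h1
  rw [saddleCoeff, ← h1]
  have hp := (analyticAt_amplitude hθ hξ hyt).hasFPowerSeriesAt
  have h2 := (hp.has_fpower_series_iterate_dslope_fslope k).coeff_zero 1
  have h3 := FormalMultilinearSeries.coeff_iterate_fslope (p := FormalMultilinearSeries.ofScalars ℝ
    fun n => iteratedDeriv n (amplitude θ ξ y) 0 / (n.factorial : ℝ)) k 0
  rw [zero_add, FormalMultilinearSeries.coeff_ofScalars] at h3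
  rw [← h2]
  exact congrArg _ h3.symm

theorem exists_hasSum_amplitude (hθ : θ ∈ Ioo 0 (π / 2)) (hξ : 0 ≤ ξ) {y : ℝ}
    (hy : y * saddle θ ξ < 1) : ∃ ρ : ℝ, 0 < ρ ∧ ∀ w : ℝ, |w| < ρ →
      HasSum (fun k : ℕ => fCoeff θ ξ y k * w ^ k) (amplitude θ ξ y w) := by
  have hp := hasFPowerSeriesAt_iff.1 (analyticAt_amplitude hθ hξ hy).hasFPowerSeriesAt
  obtain ⟨ρ, hρ, h⟩ := Metric.eventually_nhds_iff.1 hp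
  refine ⟨ρ, hρ, fun w hw => ?_⟩
  have := h (y := w) (by simpa [Real.dist_eq] using hw)
  simpa [fCoeff, mul_comm, FormalMultilinearSeries.coeff_ofScalars] using this

end Amplitude

/-! ### Closed forms of `f₀` and `f₂`. -/

section ExplicitCoefficients

open Filter Topology

variable {θ ξ : ℝ}

theorem hasDerivAt_div_sub_pow (c a : ℝ) (n : ℕ) {t : ℝ} (ht : t - a ≠ 0) :
    HasDerivAt (fun t : ℝ => c / (t - a) ^ n) (-(n * c) / (t - a) ^ (n + 1)) t := by
  have h := (((hasDerivAt_id t).sub_const a).pow n).inv (pow_ne_zero n ht)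
  convert! h.const_mul c using 1
  rcases n with _ | n
  · simp
  · simp only [Nat.add_sub_cancel, id, Pi.pow_apply]
    field_simp
    ring

/-- The `k`th derivative of `phase`, for `k = n + 1 ≥ 1`, up to the contribution of `ξ t`. -/
noncomputable def phaseD (θ : ℝ) (n : ℕ) (t : ℝ) : ℝ :=
  (-1) ^ n * n.factorial / t ^ (n + 1) - sin θ ^ 2 * ((-1) ^ n * n.factorial) / (t - 1) ^ (n + 1)

theorem hasDerivAt_phaseD (θ : ℝ) (n : ℕ) {t : ℝ} (ht : 1 < t) :
    HasDerivAt (phaseD θ n) (phaseD θ (n + 1) t) t := by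
  have h0 : t - 0 ≠ 0 := by linarith
  have h1 := hasDerivAt_div_sub_pow ((-1) ^ n * n.factorial) 0 (n + 1) h0
  have h2 := hasDerivAt_div_sub_pow (sin θ ^ 2 * ((-1) ^ n * n.factorial)) 1 (n + 1)
    (sub_ne_zero.2 ht.ne')
  simp only [sub_zero] at h1
  convert! h1.sub h2 using 1
  rw [phaseD, Nat.factorial_succ]
  push_cast
  ring

theorem hasDerivAt_phase_phaseD (θ ξ : ℝ) {t : ℝ} (ht : 1 < t) :
    HasDerivAt (phase θ ξ) (phaseD θ 0 t + ξ) t := by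
  convert! hasDerivAt_phase θ ξ ht using 1
  simp [phaseD]

theorem iteratedDeriv_phase (θ ξ : ℝ) (n : ℕ) {t : ℝ} (ht : 1 < t) :
    iteratedDeriv (n + 2) (phase θ ξ) t = phaseD θ (n + 1) t := by
  induction n generalizing t with
  | zero =>
    rw [iteratedDeriv_succ, iteratedDeriv_one]
    have : deriv (phase θ ξ) =ᶠ[𝓝 t] fun t => phaseD θ 0 t + ξ := by
      filter_upwards [lt_mem_nhds ht] with s hs using (hasDerivAt_phase_phaseD θ ξ hs).deriv
    rw [this.deriv_eq]
    exact ((hasDerivAt_phaseD θ 0 ht).add_const ξ).deriv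
  | succ n ih =>
    rw [show n + 1 + 2 = (n + 2) + 1 by ring, iteratedDeriv_succ]
    have : iteratedDeriv (n + 2) (phase θ ξ) =ᶠ[𝓝 t] phaseD θ (n + 1) := by
      filter_upwards [lt_mem_nhds ht] with s hs using ih hs
    rw [this.deriv_eq]
    exact (hasDerivAt_phaseD θ (n + 1) ht).deriv

theorem phaseDeriv_eq (hθ : θ ∈ Ioo 0 (π / 2)) (hξ : 0 ≤ ξ) (n : ℕ) :
    phaseDeriv θ ξ (n + 2) = phaseD θ (n + 1) (saddle θ ξ) :=
  iteratedDeriv_phase θ ξ n (one_lt_saddle hθ hξ)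

/-- The relations between the first derivatives at `0` of the inverse substitution and the
derivatives of the phase at the saddle point. -/
theorem deriv_tOf_relations (hθ : θ ∈ Ioo 0 (π / 2)) (hξ : 0 ≤ ξ) {a b c φ₂ φ₃ φ₄ : ℝ}
    (ha : a = deriv (tOf θ ξ) 0) (hb : b = deriv (deriv (tOf θ ξ)) 0)
    (hc : c = deriv (deriv (deriv (tOf θ ξ))) 0) (h₂ : φ₂ = phaseDeriv θ ξ 2)
    (h₃ : φ₃ = phaseDeriv θ ξ 3) (h₄ : φ₄ = phaseDeriv θ ξ 4) :
    φ₂ * a ^ 2 = 1 ∧ φ₃ * a ^ 3 + 3 * φ₂ * a * b = 0 ∧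
      φ₄ * a ^ 4 + 6 * φ₃ * a ^ 2 * b + φ₂ * (3 * b ^ 2 + 4 * a * c) = 0 := by
  set T := tOf θ ξ with hT
  have hTa := analyticAt_tOf hθ hξ
  have e0 := hTa.eventually_analyticAt
  have d0 : ∀ᶠ w in 𝓝 (0 : ℝ), HasDerivAt T (deriv T w) w :=
    e0.mono fun w hw => hw.differentiableAt.hasDerivAt
  have d1 : ∀ᶠ w in 𝓝 (0 : ℝ), HasDerivAt (deriv T) (deriv (deriv T) w) w :=
    e0.mono fun w hw => hw.deriv.differentiableAt.hasDerivAt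
  have d2 : ∀ᶠ w in 𝓝 (0 : ℝ), HasDerivAt (deriv (deriv T)) (deriv (deriv (deriv T)) w) w :=
    e0.mono fun w hw => hw.deriv.deriv.differentiableAt.hasDerivAt
  have d3 : HasDerivAt (deriv (deriv (deriv T))) (deriv (deriv (deriv (deriv T))) 0) 0 :=
    hTa.deriv.deriv.deriv.differentiableAt.hasDerivAt
  have hT1 : ∀ w, 1 < T w := one_lt_tOf hθ hξ
  have hφ : ∀ n w, HasDerivAt T (deriv T w) w →
      HasDerivAt (fun w => phaseD θ n (T w)) (phaseD θ (n + 1) (T w) * deriv T w) w :=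
    fun n w hw => (hasDerivAt_phaseD θ n (hT1 w)).comp w hw
  -- `E1` to `E4` are the successive derivatives of `φ(T(w)) = w² / 2 + φ(t₀)`. The first three hold
  -- near `0` so that they can be differentiated again.
  have E1 : ∀ᶠ w in 𝓝 (0 : ℝ), (phaseD θ 0 (T w) + ξ) * deriv T w = w := by
    filter_upwards [d0] with w hw
    have h1 := (hasDerivAt_phase_phaseD θ ξ (hT1 w)).comp w hw
    have h2 : phase θ ξ ∘ T = fun w => w ^ 2 / 2 + phase θ ξ (saddle θ ξ) := by
      funext w
      have := wOf_sq hθ hξ (hT1 w)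
      rw [hT, wOf_tOf hθ hξ] at this
      simp only [Function.comp_apply]
      linarith
    rw [h2] at h1
    have h3 : HasDerivAt (fun w : ℝ => w ^ 2 / 2 + phase θ ξ (saddle θ ξ)) w w := by
      convert! ((hasDerivAt_pow 2 w).div_const 2).add_const (phase θ ξ (saddle θ ξ)) using 1
      norm_num
    exact h1.unique h3
  have E2 : ∀ᶠ w in 𝓝 (0 : ℝ), phaseD θ 1 (T w) * deriv T w ^ 2 +
      (phaseD θ 0 (T w) + ξ) * deriv (deriv T) w = 1 := by
    filter_upwards [E1.eventually_nhds, d0, d1] with w hE h0 h1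
    have := ((((hφ 0 w h0).add_const ξ).mul h1).congr_of_eventuallyEq
      (hE.mono fun _ h => h.symm)).unique (hasDerivAt_id w)
    rw [← this]; ring
  have E3 : ∀ᶠ w in 𝓝 (0 : ℝ), phaseD θ 2 (T w) * deriv T w ^ 3 +
      3 * phaseD θ 1 (T w) * deriv T w * deriv (deriv T) w +
      (phaseD θ 0 (T w) + ξ) * deriv (deriv (deriv T)) w = 0 := by
    filter_upwards [E2.eventually_nhds, d0, d1, d2] with w hE h0 h1 h2
    have := ((((hφ 1 w h0).mul (h1.pow 2)).add (((hφ 0 w h0).add_const ξ).mul h2)).congr_of_eventuallyEq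
      (hE.mono fun _ h => h.symm)).unique (hasDerivAt_const w 1)
    rw [← this]
    simp only [Pi.pow_apply]
    push_cast
    ring
  have E4 : phaseD θ 3 (T 0) * deriv T 0 ^ 4 +
      6 * phaseD θ 2 (T 0) * deriv T 0 ^ 2 * deriv (deriv T) 0 +
      phaseD θ 1 (T 0) * (3 * deriv (deriv T) 0 ^ 2 + 4 * deriv T 0 * deriv (deriv (deriv T)) 0) +
      (phaseD θ 0 (T 0) + ξ) * deriv (deriv (deriv (deriv T))) 0 = 0 := by
    have h0 := d0.self_of_nhds
    have h1 := d1.self_of_nhds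
    have h2 := d2.self_of_nhds
    have := (((((hφ 2 0 h0).mul (h1.pow 3)).add ((((hφ 1 0 h0).const_mul 3).mul h1).mul h2)).add
      (((hφ 0 0 h0).add_const ξ).mul d3)).congr_of_eventuallyEq
      ((E3.mono fun w h => by simpa using h.symm))).unique (hasDerivAt_const 0 0)
    refine Eq.trans ?_ this
    simp only [Pi.pow_apply, Pi.mul_apply]
    push_cast
    ring
  have hT0 : T 0 = saddle θ ξ := tOf_zero hθ hξ
  -- The vanishing of `φ'(t₀)` removes the highest derivative of `T` from each relation, so the
  -- system is triangular.
  have hz : phaseD θ 0 (T 0) + ξ = 0 := by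
    rw [hT0]
    exact (hasDerivAt_phase_phaseD θ ξ (one_lt_saddle hθ hξ)).unique (hasDerivAt_phase_saddle hθ hξ)
  have E2' := E2.self_of_nhds
  have E3' := E3.self_of_nhds
  rw [hz, zero_mul, add_zero, hT0] at E2' E3' E4
  rw [phaseDeriv_eq hθ hξ 0] at h₂
  rw [phaseDeriv_eq hθ hξ 1] at h₃
  rw [phaseDeriv_eq hθ hξ 2] at h₄
  subst ha hb hc h₂ h₃ h₄
  exact ⟨E2', E3', E4⟩

theorem deriv_tOf_zero_pos (hθ : θ ∈ Ioo 0 (π / 2)) (hξ : 0 ≤ ξ) : 0 < deriv (tOf θ ξ) 0 := by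
  have h1 := deriv_tOf_mul_deriv_wOf hθ hξ (one_lt_saddle hθ hξ)
    (analyticAt_wOf hθ hξ).differentiableAt.hasDerivAt
    (by rw [wOf_saddle]; exact (analyticAt_tOf hθ hξ).differentiableAt)
  rw [wOf_saddle] at h1
  exact pos_of_mul_pos_left (h1 ▸ one_pos) (deriv_wOf_saddle_pos hθ hξ).le

theorem phaseDeriv_two_pos (hθ : θ ∈ Ioo 0 (π / 2)) (hξ : 0 ≤ ξ) : 0 < phaseDeriv θ ξ 2 := by
  obtain ⟨h, -, -⟩ := deriv_tOf_relations hθ hξ rfl rfl rfl rfl rfl rfl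
  exact pos_of_mul_pos_left (h ▸ one_pos) (sq_nonneg _)

theorem deriv_tOf_zero (hθ : θ ∈ Ioo 0 (π / 2)) (hξ : 0 ≤ ξ) :
    deriv (tOf θ ξ) 0 = 1 / √(phaseDeriv θ ξ 2) := by
  obtain ⟨h, -, -⟩ := deriv_tOf_relations hθ hξ rfl rfl rfl rfl rfl rfl
  have h2 := phaseDeriv_two_pos hθ hξ
  have h3 := deriv_tOf_zero_pos hθ hξ
  rw [eq_div_iff (Real.sqrt_pos.2 h2).ne']
  rw [← Real.sqrt_sq h3.le, ← Real.sqrt_mul (sq_nonneg _), mul_comm, h, Real.sqrt_one]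

theorem fCoeff_zero (hθ : θ ∈ Ioo 0 (π / 2)) (hξ : 0 ≤ ξ) (y : ℝ) :
    fCoeff θ ξ y 0 = 1 / √(phaseDeriv θ ξ 2) / (saddle θ ξ * (1 - y * saddle θ ξ)) := by
  rw [fCoeff, iteratedDeriv_zero, amplitude, tOf_zero hθ hξ, deriv_tOf_zero hθ hξ]
  simp only [Nat.factorial_zero, Nat.cast_one, div_one]
  ring

theorem fCoeff_zero' (hθ : θ ∈ Ioo 0 (π / 2)) (hξ : 0 ≤ ξ) (y : ℝ) :
    fCoeff θ ξ y 0 = (saddle θ ξ - 1) / ((1 - y * saddle θ ξ) *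
      √(sin θ ^ 2 * saddle θ ξ ^ 2 - (saddle θ ξ - 1) ^ 2)) := by
  have h1 := one_lt_saddle hθ hξ
  have h0 : 0 < saddle θ ξ := by linarith
  have h2 : 0 < saddle θ ξ - 1 := by linarith
  have hpos := phaseDeriv_two_pos hθ hξ
  have h3 : sin θ ^ 2 * saddle θ ξ ^ 2 - (saddle θ ξ - 1) ^ 2 =
      (saddle θ ξ * (saddle θ ξ - 1)) ^ 2 * phaseDeriv θ ξ 2 := by
    rw [phaseDeriv_eq hθ hξ 0, phaseD]
    norm_num
    field_simp
    ring
  have h4 : 0 < √(phaseDeriv θ ξ 2) := Real.sqrt_pos.2 hpos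
  rw [h3, Real.sqrt_mul (sq_nonneg _), Real.sqrt_sq (by positivity), fCoeff_zero hθ hξ]
  field_simp

/-- The amplitude is `h(T) T'` with `h(t) = 1 / (t (1 - y t))`, and the value is `h'' a³ + 3 h' a b
+ h c` at `t₀`. -/
theorem iteratedDeriv_two_amplitude (hθ : θ ∈ Ioo 0 (π / 2)) (hξ : 0 ≤ ξ) {y a b c t₀ : ℝ}
    (ha : a = deriv (tOf θ ξ) 0) (hb : b = deriv (deriv (tOf θ ξ)) 0)
    (hc : c = deriv (deriv (deriv (tOf θ ξ))) 0) (ht : t₀ = saddle θ ξ) (hy : y * t₀ < 1) :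
    iteratedDeriv 2 (amplitude θ ξ y) 0 =
      (2 * (1 - 2 * y * t₀) ^ 2 / (t₀ * (1 - y * t₀)) ^ 3 + 2 * y / (t₀ * (1 - y * t₀)) ^ 2) * a ^ 3 +
      3 * (-(1 - 2 * y * t₀) / (t₀ * (1 - y * t₀)) ^ 2) * a * b + 1 / (t₀ * (1 - y * t₀)) * c := by
  set T := tOf θ ξ with hT
  have hTa := analyticAt_tOf hθ hξ
  have e0 := hTa.eventually_analyticAt
  have d0 : ∀ᶠ w in 𝓝 (0 : ℝ), HasDerivAt T (deriv T w) w :=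
    e0.mono fun w hw => hw.differentiableAt.hasDerivAt
  have d1 : ∀ᶠ w in 𝓝 (0 : ℝ), HasDerivAt (deriv T) (deriv (deriv T) w) w :=
    e0.mono fun w hw => hw.deriv.differentiableAt.hasDerivAt
  have d2 := hTa.deriv.deriv.differentiableAt.hasDerivAt
  have hT0 : T 0 = t₀ := by rw [ht]; exact tOf_zero hθ hξ
  have hT1 : ∀ w, 1 < T w := one_lt_tOf hθ hξ
  have hne : ∀ᶠ w in 𝓝 (0 : ℝ), T w * (1 - y * T w) ≠ 0 := by
    have : ∀ᶠ w in 𝓝 (0 : ℝ), y * T w < 1 := by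
      have h : Tendsto (fun w => y * T w) (𝓝 0) (𝓝 (y * T 0)) :=
        (hTa.continuousAt.const_mul y).tendsto
      exact h.eventually (gt_mem_nhds (by rw [hT0]; exact hy))
    filter_upwards [this] with w hw
    exact mul_ne_zero (by linarith [hT1 w]) (by linarith)
  have dh : ∀ w, HasDerivAt T (deriv T w) w →
      HasDerivAt (fun w => T w * (1 - y * T w)) ((1 - 2 * y * T w) * deriv T w) w := by
    intro w hw
    convert! hw.mul ((hw.const_mul y).const_sub 1) using 1
    ring
  have A1 : deriv (amplitude θ ξ y) =ᶠ[𝓝 0] fun w =>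
      -((1 - 2 * y * T w) * deriv T w) / (T w * (1 - y * T w)) ^ 2 * deriv T w +
        (T w * (1 - y * T w))⁻¹ * deriv (deriv T) w := by
    filter_upwards [d0, d1, hne] with w h0 h1 hn
    have := ((dh w h0).inv hn).mul h1
    have hfun : amplitude θ ξ y = (fun w => T w * (1 - y * T w))⁻¹ * deriv T := by
      funext s
      simp [amplitude, hT]
    rw [hfun]
    exact this.deriv
  rw [iteratedDeriv_succ, iteratedDeriv_one, A1.deriv_eq]
  have h0 := d0.self_of_nhds
  have h1 := d1.self_of_nhds
  have hn := hne.self_of_nhds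
  have D1 : HasDerivAt (fun w => (1 - 2 * y * T w) * deriv T w)
      (-(2 * y * deriv T 0) * deriv T 0 + (1 - 2 * y * T 0) * deriv (deriv T) 0) 0 :=
    ((h0.const_mul (2 * y)).const_sub 1).mul h1
  have D := (((D1.neg).div ((dh 0 h0).pow 2) (pow_ne_zero 2 hn)).mul h1).add
    (((dh 0 h0).inv hn).mul d2)
  refine D.deriv.trans ?_
  simp only [Pi.pow_apply, Pi.neg_apply, Pi.inv_apply, Pi.div_apply]
  rw [hT0] at hn ⊢
  rw [← ha, ← hb, ← hc]
  have hn1 := left_ne_zero_of_mul hn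
  have hn2 := right_ne_zero_of_mul hn
  field_simp
  ring

theorem fCoeff_two (hθ : θ ∈ Ioo 0 (π / 2)) (hξ : 0 ≤ ξ) {y t₀ φ₂ φ₃ φ₄ : ℝ}
    (ht : t₀ = saddle θ ξ) (hy : y * t₀ < 1) (h₂ : φ₂ = phaseDeriv θ ξ 2)
    (h₃ : φ₃ = phaseDeriv θ ξ 3) (h₄ : φ₄ = phaseDeriv θ ξ 4) :
    fCoeff θ ξ y 2 =
      1 / (24 * φ₂ ^ (7 / 2 : ℝ) * t₀ ^ 3 * (1 - y * t₀) ^ 3) *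
        (24 * φ₂ ^ 2 + 12 * φ₂ * (φ₃ - 6 * y * φ₂) * t₀ +
          (72 * φ₂ ^ 2 * y ^ 2 + 5 * φ₃ ^ 2 - 36 * φ₃ * y * φ₂ - 3 * φ₄ * φ₂) * t₀ ^ 2 +
          2 * y * (12 * φ₃ * y * φ₂ + 3 * φ₄ * φ₂ - 5 * φ₃ ^ 2) * t₀ ^ 3 +
          y ^ 2 * (5 * φ₃ ^ 2 - 3 * φ₄ * φ₂) * t₀ ^ 4) := by
  obtain ⟨a, ha⟩ : ∃ a, a = deriv (tOf θ ξ) 0 := ⟨_, rfl⟩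
  obtain ⟨b, hb⟩ : ∃ b, b = deriv (deriv (tOf θ ξ)) 0 := ⟨_, rfl⟩
  obtain ⟨c, hc⟩ : ∃ c, c = deriv (deriv (deriv (tOf θ ξ))) 0 := ⟨_, rfl⟩
  obtain ⟨-, r2, r3⟩ := deriv_tOf_relations hθ hξ ha hb hc h₂ h₃ h₄
  have hpos : 0 < φ₂ := h₂ ▸ phaseDeriv_two_pos hθ hξ
  have has : a = 1 / √φ₂ := by rw [ha, h₂, deriv_tOf_zero hθ hξ]
  rw [fCoeff, iteratedDeriv_two_amplitude hθ hξ ha hb hc ht hy]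
  have h72 : φ₂ ^ (7 / 2 : ℝ) = √φ₂ ^ 7 := by
    rw [Real.sqrt_eq_rpow, ← Real.rpow_mul_natCast hpos.le]; norm_num
  rw [h72]
  have hs : 0 < √φ₂ := Real.sqrt_pos.2 hpos
  have hs2 : φ₂ = √φ₂ ^ 2 := (Real.sq_sqrt hpos.le).symm
  have h1 := one_lt_saddle hθ hξ
  rw [← ht] at h1
  have ht0 : t₀ ≠ 0 := by linarith
  have hyt : 1 - y * t₀ ≠ 0 := by linarith
  clear ha hb hc h₂ h₃ h₄ ht h72
  -- With `φ₂ = s²` and `a = 1 / s`, the relations give `b` and `c` as rational functions of `s`,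
  -- `φ₃`, `φ₄`, and the claim becomes a rational identity.
  generalize √φ₂ = s at *
  subst hs2 has
  have hs0 := hs.ne'
  have hb' : b = -φ₃ / (3 * s ^ 4) := by
    field_simp at r2 ⊢
    linear_combination r2
  subst hb'
  have hc' : c = -(φ₄ / s ^ 4 + 6 * φ₃ / s ^ 2 * (-φ₃ / (3 * s ^ 4)) +
      3 * s ^ 2 * (-φ₃ / (3 * s ^ 4)) ^ 2) / (4 * s) := by
    field_simp at r3 ⊢
    linear_combination r3
  subst hc'
  simp only [Nat.factorial]
  push_cast
  field_simp
  ring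

end ExplicitCoefficients

/-! ### Uniform parameter bounds and the final expansion. -/

section Asymptotics

open MeasureTheory

variable {θ ξ : ℝ}

theorem betaLine_mul_exp_eq {a : ℝ} (ha : 0 < a) (ha1 : a < 1) (r α β ξ v : ℝ) :
    betaLine a (r * α) (r * β) v * Complex.exp ((r * ξ : ℝ) / vline a v) =
      Complex.exp (r * phaseC α β ξ (vline a v)) := by
  rw [betaLine, Complex.cpow_def_of_ne_zero (vline_ne_zero ha v),
    Complex.cpow_def_of_ne_zero (one_sub_vline_ne_zero ha1 v), ← Complex.exp_add, ← Complex.exp_add,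
    phaseC]
  congr 1
  push_cast
  ring

theorem noncentralBeta_eq_prefactor_mul {r p q x y : ℝ} (hθ : θ ∈ Ioo 0 (π / 2)) (hξ : 0 ≤ ξ)
    (hr : 1 < r) (hp : p = r * cos θ ^ 2) (hq : q = r * sin θ ^ 2) (hx : 0 ≤ x)
    (hxy : x * y / 2 = r * ξ) (hy : 0 ≤ y) (hya : y < (saddle θ ξ)⁻¹) :
    (noncentralBeta p q x y : ℂ) = prefactor p q x y θ ξ * ((√(2 * π / r))⁻¹ *
      ∫ v, Complex.exp (r * (phaseC (cos θ ^ 2) (sin θ ^ 2) ξ (vline (saddle θ ξ)⁻¹ v) -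
        phaseC (cos θ ^ 2) (sin θ ^ 2) ξ ((saddle θ ξ)⁻¹ : ℝ))) *
          (vline (saddle θ ξ)⁻¹ v - y)⁻¹) := by
  have h1 := one_lt_saddle hθ hξ
  have ha : 0 < (saddle θ ξ)⁻¹ := by positivity
  have ha1 : (saddle θ ξ)⁻¹ < 1 := inv_lt_one_of_one_lt₀ h1
  have hr0 : 0 < r := by linarith
  have hp0 : 0 < p := hp ▸ mul_pos hr0 (cos_sq_pos_of_mem hθ)
  have hq0 : 0 < q := hq ▸ mul_pos hr0 (sin_sq_pos_of_mem hθ)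
  have hpq : p + q = r := by rw [hp, hq, ← mul_add, cos_sq_add_sin_sq, mul_one]
  rw [noncentralBeta_eq_integral ha ha1 hp0 hq0 (by linarith) hy hya hx, hxy]
  have hint : ∀ v, betaLine (saddle θ ξ)⁻¹ p q v *
      Complex.exp ((r * ξ : ℝ) / vline (saddle θ ξ)⁻¹ v) * (vline (saddle θ ξ)⁻¹ v - y)⁻¹ =
      (exp (r * phase θ ξ (saddle θ ξ)) : ℝ) *
      (Complex.exp (r * (phaseC (cos θ ^ 2) (sin θ ^ 2) ξ (vline (saddle θ ξ)⁻¹ v) -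
        phaseC (cos θ ^ 2) (sin θ ^ 2) ξ ((saddle θ ξ)⁻¹ : ℝ))) *
          (vline (saddle θ ξ)⁻¹ v - y)⁻¹) := by
    intro v
    rw [hp, hq, betaLine_mul_exp_eq ha ha1, Complex.ofReal_inv, phaseC_inv h1, ← mul_assoc,
      Complex.ofReal_exp, ← Complex.exp_add]
    congr 2
    push_cast
    ring
  simp only [hint]
  rw [integral_const_mul]
  generalize (∫ v, Complex.exp (r * (phaseC (cos θ ^ 2) (sin θ ^ 2) ξ (vline (saddle θ ξ)⁻¹ v) -
        phaseC (cos θ ^ 2) (sin θ ^ 2) ξ ((saddle θ ξ)⁻¹ : ℝ))) *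
          (vline (saddle θ ξ)⁻¹ v - y)⁻¹) = I
  rw [prefactor, hpq, exp_add]
  -- This splits the `2π` of the integral representation between the prefactor and the leading
  -- Gaussian moment.
  have hs : √(2 * π * r) * √(2 * π / r) = 2 * π := by
    rw [← Real.sqrt_mul (by positivity), show 2 * π * r * (2 * π / r) = (2 * π) ^ 2 by field_simp,
      Real.sqrt_sq (by positivity)]
  have hs' : (2 * π : ℂ) = (√(2 * π * r) : ℂ) * (√(2 * π / r) : ℂ) := by exact_mod_cast hs.symm
  rw [hs']
  push_cast
  field_simp

/-- The saddle equation reads `ξ t₀ (t₀ - 1) + cos² θ t₀ = 1` with both summands nonnegative, so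
each is at most `1`. -/
theorem saddle_bounds {δ₁ δ₂ : ℝ} (hθ : θ ∈ Ioo 0 (π / 2)) (hξ : 0 ≤ ξ) (hδ₁ : 0 < δ₁)
    (hθ₁ : θ ∈ Icc δ₁ (π / 2 - δ₁)) (hδ₂ : 0 < δ₂) (hs : 1 + δ₂ ≤ saddle θ ξ) :
    sin δ₁ ^ 2 ≤ (saddle θ ξ)⁻¹ ∧ δ₂ / (1 + δ₂) ≤ 1 - (saddle θ ξ)⁻¹ ∧ ξ ≤ 1 / δ₂ := by
  obtain ⟨h1, h2⟩ := saddle_spec hθ hξ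
  have h0 : 0 < saddle θ ξ := by linarith
  have hsin : 0 < sin δ₁ := sin_pos_of_pos_of_lt_pi hδ₁ (by linarith [hθ₁.1, hθ₁.2, pi_pos])
  have hcos : sin δ₁ ≤ cos θ := by
    rw [← cos_pi_div_two_sub]
    exact cos_le_cos_of_nonneg_of_le_pi hθ.1.le (by linarith [pi_pos]) hθ₁.2
  have hc2 : sin δ₁ ^ 2 ≤ cos θ ^ 2 := pow_le_pow_left₀ hsin.le hcos 2
  refine ⟨?_, ?_, ?_⟩
  · rw [le_inv_comm₀ (by positivity) h0, inv_eq_one_div, le_div_iff₀ (by positivity)]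
    nlinarith [mul_nonneg hξ (mul_nonneg h0.le (sub_nonneg.2 h1.le)),
      mul_le_mul_of_nonneg_left hc2 h0.le]
  · have h3 : (saddle θ ξ)⁻¹ ≤ (1 + δ₂)⁻¹ := inv_anti₀ (by positivity) hs
    have h4 : δ₂ / (1 + δ₂) = 1 - (1 + δ₂)⁻¹ := by field_simp; ring
    linarith
  · rw [le_div_iff₀ hδ₂]
    have h3 : δ₂ ≤ saddle θ ξ * (saddle θ ξ - 1) := by nlinarith
    nlinarith [mul_le_mul_of_nonneg_left h3 hξ, mul_nonneg (sq_nonneg (cos θ)) h0.le]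

theorem partialSeries_eq {ρ y b : ℝ} (hθ : θ ∈ Ioo 0 (π / 2)) (hξ : 0 ≤ ξ)
    (h : IsSaddleAt (cos θ ^ 2) (sin θ ^ 2) ξ (saddle θ ξ)⁻¹ ρ) (hb : 2 * ρ ≤ b)
    (hy : b ≤ (saddle θ ξ)⁻¹ - y) (hyt : y * saddle θ ξ < 1) (r : ℝ) (N : ℕ) :
    (partialSeries θ ξ y r N : ℂ) = ∑ k ∈ Finset.range N,
      saddleCoeff (cos θ ^ 2) (sin θ ^ 2) ξ (saddle θ ξ)⁻¹ y (2 * k) *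
        (((-1) ^ k * (2 ^ k * (ascPochhammer ℝ k).eval (1 / 2)) / r ^ k : ℝ) : ℂ) := by
  rw [partialSeries, Complex.ofReal_sum]
  refine Finset.sum_congr rfl fun k _ => ?_
  have := fCoeff_eq_saddleCoeff hθ hξ h hb hy hyt (2 * k)
  rw [pow_mul, neg_one_sq, one_pow, one_mul] at this
  rw [← this]
  push_cast
  ring

theorem exists_uniform_expansion {δ₁ δ₂ δ₃ : ℝ} (hδ₁ : 0 < δ₁) (hδ₂ : 0 < δ₂) (hδ₃ : 0 < δ₃)
    (N : ℕ) : ∃ C R : ℝ, 0 < R ∧ ∀ r θ p q x y ξ : ℝ, R ≤ r → θ ∈ Icc δ₁ (π / 2 - δ₁) →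
      p = r * cos θ ^ 2 → q = r * sin θ ^ 2 → 0 ≤ x → x * y / 2 = r * ξ →
      1 + δ₂ ≤ saddle θ ξ → y ∈ Icc 0 (yTransition p q x - δ₃) →
      |noncentralBeta p q x y - prefactor p q x y θ ξ * partialSeries θ ξ y r N| ≤
        C * prefactor p q x y θ ξ / r ^ N := by
  -- If `δ₁ > π / 4` no `θ` is admissible; otherwise `sin δ₁ > 0`.
  by_cases hδ : π / 2 - δ₁ < δ₁
  · refine ⟨0, 1, one_pos, fun r θ p q x y ξ _ hθ => ?_⟩
    linarith [hθ.1, hθ.2]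
  rw [not_lt] at hδ
  have hsin : 0 < sin δ₁ := sin_pos_of_pos_of_lt_pi hδ₁ (by linarith [pi_pos])
  -- The three entries bound `a`, `1 - a` and `a - y = (1 - y t₀) a` from below, where `a = 1 / t₀`.
  set b := min (min (sin δ₁ ^ 2) (δ₂ / (1 + δ₂))) (δ₃ * sin δ₁ ^ 2) with hb
  have hb0 : 0 < b := lt_min (lt_min (by positivity) (by positivity)) (by positivity)
  have hb1 : b ≤ sin δ₁ ^ 2 := (min_le_left _ _).trans (min_le_left _ _)
  have hb2 : b ≤ δ₂ / (1 + δ₂) := (min_le_left _ _).trans (min_le_right _ _)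
  have hb3 : b ≤ δ₃ * sin δ₁ ^ 2 := min_le_right _ _
  obtain ⟨C, hC0, hC⟩ := exists_norm_saddle_integral_sub_le hb0 (X := 1 / δ₂) (by positivity) N
  refine ⟨C / √(2 * π), 2, two_pos, fun r θ p q x y ξ hr hθ₁ hp hq hx hxy hs hy => ?_⟩
  have hr0 : 0 < r := by linarith
  have hθ : θ ∈ Ioo 0 (π / 2) := ⟨by linarith [hθ₁.1], by linarith [hθ₁.2]⟩
  have hξ : 0 ≤ ξ := by
    have : 0 ≤ r * ξ := by rw [← hxy]; have := hy.1; positivity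
    exact nonneg_of_mul_nonneg_right this hr0
  obtain ⟨e1, e2, e3⟩ := saddle_bounds hθ hξ hδ₁ hθ₁ hδ₂ hs
  have h1 := one_lt_saddle hθ hξ
  have h0 : 0 < saddle θ ξ := by linarith
  have hba : b ≤ (saddle θ ξ)⁻¹ := hb1.trans e1
  have hba' : b ≤ 1 - (saddle θ ξ)⁻¹ := hb2.trans e2
  have hby : b ≤ (saddle θ ξ)⁻¹ - y := by
    -- For `y = 0` the distance to the pole is `a` itself; the identity through `y₀` requires `y >
    -- 0`.
    rcases hy.1.eq_or_lt with h | h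
    · rw [← h, sub_zero]; exact hba
    · have h3 := le_one_sub_mul_saddle hθ hr0 hp hq h hξ hxy hδ₃ hy.2
      have h4 : (saddle θ ξ)⁻¹ - y = (1 - y * saddle θ ξ) * (saddle θ ξ)⁻¹ := by field_simp
      rw [h4]
      exact hb3.trans (mul_le_mul h3 e1 (sq_nonneg _) (hδ₃.le.trans h3))
  have hya : y < (saddle θ ξ)⁻¹ := by linarith
  have hyt : y * saddle θ ξ < 1 := by rwa [← lt_div_iff₀ h0, one_div]
  have hsad := isSaddleAt_inv_saddle hθ hξ (ρ := b / 8) (by positivity) (by linarith) (by linarith)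
  have hmain := hC r hr _ _ _ _ y hsad e3 hba hba' hby
  rw [← partialSeries_eq hθ hξ hsad (by linarith) hby hyt] at hmain
  have hB := noncentralBeta_eq_prefactor_mul hθ hξ (by linarith) hp hq hx hxy hy.1 hya
  generalize (∫ v, Complex.exp (r * (phaseC (cos θ ^ 2) (sin θ ^ 2) ξ (vline (saddle θ ξ)⁻¹ v) -
        phaseC (cos θ ^ 2) (sin θ ^ 2) ξ ((saddle θ ξ)⁻¹ : ℝ))) *
          (vline (saddle θ ξ)⁻¹ v - y)⁻¹) = I at hmain hB
  have hy1 : 0 ≤ 1 - y := by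
    have := inv_lt_one_of_one_lt₀ h1
    linarith
  have hpq : p + q = r := by rw [hp, hq, ← mul_add, cos_sq_add_sin_sq, mul_one]
  have hP : 0 ≤ prefactor p q x y θ ξ := by
    have := hy.1
    rw [prefactor]
    positivity
  set P := prefactor p q x y θ ξ with hPdef
  have hsq : 0 < √(2 * π / r) := Real.sqrt_pos.2 (by positivity)
  have hsqC : (√(2 * π / r) : ℂ) ≠ 0 := by exact_mod_cast hsq.ne'
  have hdiff : ((noncentralBeta p q x y - P * partialSeries θ ξ y r N : ℝ) : ℂ) =
      ((P * (√(2 * π / r))⁻¹ : ℝ) : ℂ) * (I - √(2 * π / r) * (partialSeries θ ξ y r N : ℂ)) := by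
    rw [Complex.ofReal_sub, hB]
    push_cast
    field_simp
  rw [← Real.norm_eq_abs, ← Complex.norm_real, hdiff, norm_mul, Complex.norm_real,
    Real.norm_of_nonneg (by positivity)]
  calc _ ≤ P * (√(2 * π / r))⁻¹ * (C / (√r * r ^ N)) := by gcongr
    _ = C / √(2 * π) * P / r ^ N := by
      rw [Real.sqrt_div (by positivity)]
      have : 0 < √r := Real.sqrt_pos.2 hr0
      field_simp

end Asymptotics

end NoncentralBeta

theorem mainTheorem7 :
    -- the saddle point and the substitution `φ(t) - φ(t₀) = w² / 2`
    (∀ θ ξ : ℝ, θ ∈ Set.Ioo 0 (Real.pi / 2) → 0 ≤ ξ →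
      1 < NoncentralBeta.saddle θ ξ ∧
      HasDerivAt (NoncentralBeta.phase θ ξ) 0 (NoncentralBeta.saddle θ ξ) ∧
      (∀ t : ℝ, 1 < t →
        NoncentralBeta.phase θ ξ t - NoncentralBeta.phase θ ξ (NoncentralBeta.saddle θ ξ) =
          NoncentralBeta.wOf θ ξ t ^ 2 / 2) ∧
      Set.BijOn (NoncentralBeta.wOf θ ξ) (Set.Ioi 1) Set.univ) ∧
    -- the expansion `f(w) = ∑ f_k w^k` and the explicit coefficients `f₀` and `f₂`
    (∀ θ ξ y t₀ φ₂ φ₃ φ₄ : ℝ, θ ∈ Set.Ioo 0 (Real.pi / 2) → 0 ≤ ξ → 0 ≤ y →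
      t₀ = NoncentralBeta.saddle θ ξ → y * t₀ < 1 →
      φ₂ = NoncentralBeta.phaseDeriv θ ξ 2 →
      φ₃ = NoncentralBeta.phaseDeriv θ ξ 3 →
      φ₄ = NoncentralBeta.phaseDeriv θ ξ 4 →
      (∃ ρ : ℝ, 0 < ρ ∧ ∀ w : ℝ, |w| < ρ →
        HasSum (fun k : ℕ => NoncentralBeta.fCoeff θ ξ y k * w ^ k)
          (NoncentralBeta.amplitude θ ξ y w)) ∧
      NoncentralBeta.fCoeff θ ξ y 0 = 1 / √φ₂ / (t₀ * (1 - y * t₀)) ∧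
      NoncentralBeta.fCoeff θ ξ y 0 =
        (t₀ - 1) / ((1 - y * t₀) * √(Real.sin θ ^ 2 * t₀ ^ 2 - (t₀ - 1) ^ 2)) ∧
      NoncentralBeta.fCoeff θ ξ y 2 =
        1 / (24 * φ₂ ^ (7 / 2 : ℝ) * t₀ ^ 3 * (1 - y * t₀) ^ 3) *
          (24 * φ₂ ^ 2 + 12 * φ₂ * (φ₃ - 6 * y * φ₂) * t₀ +
            (72 * φ₂ ^ 2 * y ^ 2 + 5 * φ₃ ^ 2 - 36 * φ₃ * y * φ₂ - 3 * φ₄ * φ₂) * t₀ ^ 2 +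
            2 * y * (12 * φ₃ * y * φ₂ + 3 * φ₄ * φ₂ - 5 * φ₃ ^ 2) * t₀ ^ 3 +
            y ^ 2 * (5 * φ₃ ^ 2 - 3 * φ₄ * φ₂) * t₀ ^ 4)) ∧
    -- the saddle point lies to the left of the pole `1 / y` iff `y < y₀`, iff `x > x₀`
    (∀ θ r p q x y ξ : ℝ, θ ∈ Set.Ioo 0 (Real.pi / 2) → 0 < r →
      p = r * Real.cos θ ^ 2 → q = r * Real.sin θ ^ 2 →
      0 ≤ x → 0 < y → y < 1 → x * y / 2 = r * ξ →
      (NoncentralBeta.saddle θ ξ < 1 / y ↔ y < NoncentralBeta.yTransition p q x) ∧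
      (NoncentralBeta.saddle θ ξ < 1 / y ↔ NoncentralBeta.xTransition p q y < x)) ∧
    -- the asymptotic expansion as `r → ∞`, to all orders and uniformly in the other parameters
    (∀ δ₁ δ₂ δ₃ : ℝ, 0 < δ₁ → 0 < δ₂ → 0 < δ₃ → ∀ N : ℕ,
      ∃ C R : ℝ, 0 < R ∧
        ∀ r θ p q x y ξ : ℝ, R ≤ r → θ ∈ Set.Icc δ₁ (Real.pi / 2 - δ₁) →
          p = r * Real.cos θ ^ 2 → q = r * Real.sin θ ^ 2 →
          0 ≤ x → x * y / 2 = r * ξ →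
          1 + δ₂ ≤ NoncentralBeta.saddle θ ξ →
          y ∈ Set.Icc 0 (NoncentralBeta.yTransition p q x - δ₃) →
          |NoncentralBeta.noncentralBeta p q x y -
              NoncentralBeta.prefactor p q x y θ ξ *
                NoncentralBeta.partialSeries θ ξ y r N| ≤
            C * NoncentralBeta.prefactor p q x y θ ξ / r ^ N) := by
  refine ⟨fun θ ξ hθ hξ => ⟨NoncentralBeta.one_lt_saddle hθ hξ,
    NoncentralBeta.hasDerivAt_phase_saddle hθ hξ, fun t ht => ?_,
    NoncentralBeta.bijOn_wOf hθ hξ⟩, ?_, ?_, ?_⟩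
  · rw [NoncentralBeta.wOf_sq hθ hξ ht]; ring
  · intro θ ξ y t₀ φ₂ φ₃ φ₄ hθ hξ _ ht₀ hy h₂ h₃ h₄
    refine ⟨NoncentralBeta.exists_hasSum_amplitude hθ hξ (ht₀ ▸ hy), ?_, ?_,
      NoncentralBeta.fCoeff_two hθ hξ ht₀ hy h₂ h₃ h₄⟩
    · rw [ht₀, h₂]; exact NoncentralBeta.fCoeff_zero hθ hξ y
    · rw [ht₀]; exact NoncentralBeta.fCoeff_zero' hθ hξ y
  · intro θ r p q x y ξ hθ hr hp hq hx hy hy1 hxy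
    have hξ : 0 ≤ ξ := nonneg_of_mul_nonneg_right (show 0 ≤ r * ξ by rw [← hxy]; positivity) hr
    have h1 := NoncentralBeta.saddle_lt_iff_yTransition hθ hr hp hq hy hξ hxy
    have hpq : p + q = r := by rw [hp, hq, ← mul_add, Real.cos_sq_add_sin_sq, mul_one]
    exact ⟨h1, h1.trans (NoncentralBeta.lt_yTransition_iff (by linarith) hx hy1)⟩
  · exact fun δ₁ δ₂ δ₃ hδ₁ hδ₂ hδ₃ N =>
      NoncentralBeta.exists_uniform_expansion hδ₁ hδ₂ hδ₃ N
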